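/- Let $M$ be a smooth $n$-dimensional manifold without boundary with a smooth Riemannian metric $g=(\cdot,\cdot)$ of positive sectional curvature, and let $\nabla$ be its Levi-Civita connection. We use the convention $$R(X,Y,Z,W)=g\bigl(\nabla_X\nabla_YZ-\nabla_Y\nabla_XZ-\nabla_{[X,Y]}Z,\;W\bigr),$$ so that the sectional curvature of the plane with orthonormal basis $X,Y$ is $R(X,Y,Y,X)$; $R$ is extended complex multilinearly to $TM\otimes\mathbb C$. Let $f:S^2\to M$ be a non-constant smooth harmonic map which is stable, i.e. $\frac{d^2}{dt^2}\big|_{t=0}\frac12\int_{S^2}|df_t|^2\ge 0$ for every smooth variation $f_t$ of $f_0=f$. Let $z=x+iy$ denote positively oriented isothermal coordinates on $S^2$, let $E$ be the complexified normal bundle of the branched immersion $f$ (extended across the branch points; its smooth sections are the smooth sections of $f^*TM\otimes\mathbb C$ orthogonal to the image of $df$), and let $H(E)$ be the space of its holomorphic sections, i.e. the smooth sections $s$ of $E$ for which the normal component of $\nabla_{\bar z}s=\tfrac12(\nabla_xs+i\nabla_ys)$ vanishes. Then $$\langle s_1,s_2\rangle_0=\int_{S^2}\sqrt{-1}\,R(e_1,e_2,s_1,\bar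 s_2)\,da$$ is a Hermitian form on $H(E)$ (complex linear in $s_1$, with $\langle s_1,s_2\rangle_0=\overline{\langle s_2,s_1\rangle_0}$) and it is positive definite: $\langle s,s\rangle_0>0$ for every $s\in H(E)$, $s\neq0$. Here $e_1,e_2$ is a positively oriented orthonormal basis of the tangent plane of the image (oriented by $f_x,f_y$), and $da$ is the area measure induced by $f$. -/

import Mathlib

open scoped Manifold ContDiff TensorProduct
open MeasureTheory Bundle

noncomputable section

namespace StableSphere

instance finrankR3 : Fact (Module.finrank ℝ (EuclideanSpace ℝ (Fin 3)) = 2 + 1) :=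
  ⟨by simp⟩

/-- The model space of an `n`-dimensional manifold. -/
abbrev EE (n : ℕ) : Type := EuclideanSpace ℝ (Fin n)

/-- The unit sphere `S²` in `ℝ³`, with Mathlib's smooth structure. -/
abbrev S2 : Type := Metric.sphere (0 : EuclideanSpace ℝ (Fin 3)) 1

/-- The coordinate `z = x + i y ∈ ℂ` on `S²` minus the south pole (inverse stereographic
projection): `z ↦ (2x, 2y, 1 - |z|²) / (1 + |z|²)`.  The functions `x, y` are positively oriented
isothermal coordinates on the whole sphere but one point. -/
def stereo (z : ℂ) : S2 :=
  ⟨(1 + Complex.normSq z)⁻¹ • !₂[2 * z.re, 2 * z.im, 1 - Complex.normSq z], by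
    have h : 0 < 1 + Complex.normSq z := by
      have := Complex.normSq_nonneg z
      linarith
    rw [mem_sphere_zero_iff_norm, norm_smul, EuclideanSpace.norm_eq]
    have h2 : ∑ i : Fin 3, ‖(!₂[2 * z.re, 2 * z.im, 1 - Complex.normSq z] :
        EuclideanSpace ℝ (Fin 3)) i‖ ^ 2 = (1 + Complex.normSq z) ^ 2 := by
      simp [Fin.sum_univ_three, Complex.normSq_apply]
      ring
    rw [h2, Real.sqrt_sq h.le, Real.norm_of_nonneg (inv_nonneg.2 h.le)]
    exact inv_mul_cancel₀ h.ne'⟩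

/-! ### Complexification of a real vector space -/

section Complexification

variable {V : Type*} [AddCommGroup V] [Module ℝ V]

/-- The real part `v` of `v + i w`, an element of `ℂ ⊗ V`. -/
def reT (s : ℂ ⊗[ℝ] V) : V := TensorProduct.lid ℝ V (LinearMap.rTensor V Complex.reLm s)

/-- The imaginary part `w` of `v + i w`, an element of `ℂ ⊗ V`. -/
def imT (s : ℂ ⊗[ℝ] V) : V := TensorProduct.lid ℝ V (LinearMap.rTensor V Complex.imLm s)

/-- The element `v + i w` of `ℂ ⊗ V`. -/
def mkT (v w : V) : ℂ ⊗[ℝ] V := (1 : ℂ) ⊗ₜ[ℝ] v + Complex.I ⊗ₜ[ℝ] w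

/-- Complex conjugation `v + i w ↦ v - i w` on `ℂ ⊗ V`. -/
def conjT (s : ℂ ⊗[ℝ] V) : ℂ ⊗[ℝ] V := mkT (reT s) (-imT s)

/-- The complex bilinear extension to `ℂ ⊗ V` of a real bilinear form `B`. -/
def extC (B : V → V → ℝ) (s t : ℂ ⊗[ℝ] V) : ℂ :=
  ((B (reT s) (reT t) - B (imT s) (imT t) : ℝ) : ℂ) +
    Complex.I * ((B (reT s) (imT t) + B (imT s) (reT t) : ℝ) : ℂ)

end Complexification

/-! ### Riemannian geometry in charts -/

section Riemannian

variable {n : ℕ} {M : Type*} [TopologicalSpace M] [ChartedSpace (EE n) M]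
  [IsManifold (𝓡 n) ∞ M]

/-- A smooth Riemannian metric on `M`. -/
abbrev RMetric (n : ℕ) (M : Type*) [TopologicalSpace M] [ChartedSpace (EE n) M]
    [IsManifold (𝓡 n) ∞ M] :=
  ContMDiffRiemannianMetric (𝓡 n) ∞ (EE n) (fun x : M ↦ TangentSpace (𝓡 n) x)

/-- The metric `g` in the chart at `p`: the bilinear form `g_u(a, b)` at the point `u` of the
target of that chart. -/
def gram (g : RMetric n M) (p : M) (u a b : EE n) : ℝ :=
  g.inner ((extChartAt (𝓡 n) p).symm u)
    (mfderiv 𝓘(ℝ, EE n) (𝓡 n) (extChartAt (𝓡 n) p).symm u a)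
    (mfderiv 𝓘(ℝ, EE n) (𝓡 n) (extChartAt (𝓡 n) p).symm u b)

/-- The standard basis of the model space. -/
def stdB (n : ℕ) (i : Fin n) : EE n := EuclideanSpace.single i 1

/-- The matrix `(g_ij)` in the chart at `p`, at the point `u`. -/
def gramMatrix (g : RMetric n M) (p : M) (u : EE n) : Matrix (Fin n) (Fin n) ℝ :=
  Matrix.of fun i j ↦ gram g p u (stdB n i) (stdB n j)

/-- Christoffel symbols of the first kind of the Levi-Civita connection in the chart at `p`:
`½ (∂_a g(b, c) + ∂_b g(a, c) - ∂_c g(a, b))` at the point `u`. -/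
def christoffelLow (g : RMetric n M) (p : M) (u a b c : EE n) : ℝ :=
  (fderiv ℝ (fun w ↦ gram g p w b c) u a + fderiv ℝ (fun w ↦ gram g p w a c) u b
    - fderiv ℝ (fun w ↦ gram g p w a b) u c) / 2

/-- Christoffel symbols of the Levi-Civita connection in the chart at `p`, as the bilinear map
`Γ_u(a, b) = Σ_{k,l} g^{kl} Γ_{l,ab} e_k`. -/
def christoffel (g : RMetric n M) (p : M) (u a b : EE n) : EE n :=
  WithLp.toLp 2 fun k ↦ ∑ l, (gramMatrix g p u)⁻¹ k l * christoffelLow g p u a b (stdB n l)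

/-- The curvature operator `R(a, b) c = ∇_a ∇_b c - ∇_b ∇_a c - ∇_[a,b] c` at `p`, computed in the
chart at `p` (in which `T_p M` is the model space). -/
def curvOp (g : RMetric n M) (p : M) (a b c : TangentSpace (𝓡 n) p) : TangentSpace (𝓡 n) p :=
  let Γ := christoffel g p
  let u₀ : EE n := extChartAt (𝓡 n) p p
  let a' : EE n := a
  let b' : EE n := b
  let c' : EE n := c
  (fderiv ℝ (fun u ↦ Γ u b' c') u₀ a' - fderiv ℝ (fun u ↦ Γ u a' c') u₀ b'
    + Γ u₀ a' (Γ u₀ b' c') - Γ u₀ b' (Γ u₀ a' c') : EE n)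

/-- The curvature tensor `R(a, b, c, d) = g(R(a, b) c, d)`; so the sectional curvature of the plane
of an orthonormal pair `a, b` is `R(a, b, b, a)`. -/
def curv (g : RMetric n M) (p : M) (a b c d : TangentSpace (𝓡 n) p) : ℝ :=
  g.inner p (curvOp g p a b c) d

/-- All sectional curvatures are positive: `g(R(a, b) b, a) > 0` whenever `a, b` span a plane. -/
def PositiveCurvature (g : RMetric n M) : Prop :=
  ∀ (p : M) (a b : TangentSpace (𝓡 n) p), LinearIndependent ℝ ![a, b] → 0 < curv g p a b b a

/-- The covariant derivative `∇_e V` at `z`, in the direction `e`, of a vector field `V` along a map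
`u : ℂ → M`, for the pull-back of the Levi-Civita connection, computed in the chart at `u z`:
the derivative of the components of `V` plus `Γ(du(e), V)`. -/
def covAlong (g : RMetric n M) (u : ℂ → M) (V : ∀ z, TangentSpace (𝓡 n) (u z)) (e z : ℂ) :
    TangentSpace (𝓡 n) (u z) :=
  let comp : ℂ → EE n := fun ζ ↦
    mfderiv (𝓡 n) 𝓘(ℝ, EE n) (extChartAt (𝓡 n) (u z)) (u ζ) (V ζ)
  (fderiv ℝ comp z e + christoffel g (u z) (extChartAt (𝓡 n) (u z) (u z))
    (mfderiv 𝓘(ℝ, ℂ) (𝓡 n) u z e) (V z) : EE n)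

end Riemannian

/-! ### Harmonic maps of the sphere and their stability -/

section Maps

variable {n : ℕ} {M : Type*} [TopologicalSpace M] [ChartedSpace (EE n) M]
  [IsManifold (𝓡 n) ∞ M]

/-- The derivative of `f` in the direction `e` with respect to the coordinate `z`: for `e = 1` this
is `f_x`, for `e = i` it is `f_y`. -/
def dd (f : S2 → M) (e z : ℂ) : TangentSpace (𝓡 n) (f (stereo z)) :=
  mfderiv 𝓘(ℝ, ℂ) (𝓡 n) (fun ζ ↦ f (stereo ζ)) z e

/-- The Dirichlet energy `½ ∫ |df|²` of `f : S² → M`, written in the isothermal coordinates `x, y`: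
the integrand `|df|² da = (|f_x|² + |f_y|²) dx dy` is the same for every conformal metric on `S²`,
in particular for the round one, and the omitted point has measure zero. -/
def energy (g : RMetric n M) (f : S2 → M) : ℝ :=
  (1 / 2) * ∫ z : ℂ, (g.inner (f (stereo z)) (dd (n := n) f 1 z) (dd (n := n) f 1 z)
    + g.inner (f (stereo z)) (dd (n := n) f Complex.I z) (dd (n := n) f Complex.I z))

/-- A smooth map `f : S² → M` is harmonic if its tension field vanishes; in isothermal coordinates
the equation is `∇_x f_x + ∇_y f_y = 0`.  (At the omitted point it then holds by continuity.) -/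
def IsHarmonic (g : RMetric n M) (f : S2 → M) : Prop :=
  ContMDiff (𝓡 2) (𝓡 n) ∞ f ∧
    ∀ z : ℂ, covAlong g (fun ζ ↦ f (stereo ζ)) (fun ζ ↦ dd f 1 ζ) 1 z
      + covAlong g (fun ζ ↦ f (stereo ζ)) (fun ζ ↦ dd f Complex.I ζ) Complex.I z = 0

/-- Stability: the second variation of the energy is nonnegative for every smooth variation
`F_t` of `f`. -/
def IsStable (g : RMetric n M) (f : S2 → M) : Prop :=
  ∀ F : ℝ → S2 → M,
    ContMDiff (𝓘(ℝ, ℝ).prod (𝓡 2)) (𝓡 n) ∞ (fun q : ℝ × S2 ↦ F q.1 q.2) → F 0 = f →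
      0 ≤ iteratedDeriv 2 (fun t ↦ energy g (F t)) 0

/-! ### The complexified normal bundle and its holomorphic sections -/

/-- Sections, with no regularity, of the complexified pull-back `f^*TM ⊗ ℂ`. -/
abbrev CSection (n : ℕ) {M : Type*} [TopologicalSpace M] [ChartedSpace (EE n) M]
    (f : S2 → M) : Type :=
  ∀ x : S2, ℂ ⊗[ℝ] TangentSpace (𝓡 n) (f x)

/-- The vector field `V` along `f : S² → M` is smooth. -/
def SmoothAlong (f : S2 → M) (V : ∀ x : S2, TangentSpace (𝓡 n) (f x)) : Prop :=
  ContMDiff (𝓡 2) (𝓡 n).tangent ∞ (fun x ↦ (⟨f x, V x⟩ : TangentBundle (𝓡 n) M))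

/-- `s` is a smooth section of the complexified normal bundle `E`: a smooth section of
`f^*TM ⊗ ℂ` whose real and imaginary parts are orthogonal to the image of `df`.  At a branch point
(`df = 0`) the condition is void, but the branch points of a non-constant harmonic map are isolated,
so that `s` lies, by continuity, in the fibre there of the extended normal bundle. -/
def IsNormalSection (g : RMetric n M) (f : S2 → M) (s : CSection n f) : Prop :=
  SmoothAlong f (fun x ↦ reT (s x)) ∧ SmoothAlong f (fun x ↦ imT (s x)) ∧
    ∀ (x : S2) (v : TangentSpace (𝓡 2) x),
      g.inner (f x) (mfderiv (𝓡 2) (𝓡 n) f x v) (reT (s x)) = 0 ∧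
      g.inner (f x) (mfderiv (𝓡 2) (𝓡 n) f x v) (imT (s x)) = 0

/-- The complex linear extension to sections `s` of `f^*TM ⊗ ℂ` of the covariant derivative
`∇_e`. -/
def covC (g : RMetric n M) (f : S2 → M) (s : CSection n f) (e z : ℂ) :
    ℂ ⊗[ℝ] TangentSpace (𝓡 n) (f (stereo z)) :=
  mkT (covAlong g (fun ζ ↦ f (stereo ζ)) (fun ζ ↦ reT (s (stereo ζ))) e z)
    (covAlong g (fun ζ ↦ f (stereo ζ)) (fun ζ ↦ imT (s (stereo ζ))) e z)

/-- `∇_{z̄} s = ½ (∇_x s + i ∇_y s)`. -/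
def covBar (g : RMetric n M) (f : S2 → M) (s : CSection n f) (z : ℂ) :
    ℂ ⊗[ℝ] TangentSpace (𝓡 n) (f (stereo z)) :=
  (1 / 2 : ℂ) • (covC g f s 1 z + Complex.I • covC g f s Complex.I z)

/-- The space `H(E)` of holomorphic sections of the complexified normal bundle: smooth sections
`s` of `E` with `∇^⊥_{z̄} s = 0`, that is, such that `∇_{z̄} s` is in the complexified tangent
plane, the complex span of `f_x, f_y`.  The condition is imposed at the points of the coordinate
domain where `f` is an immersion; these are dense, and `∇^⊥_{z̄} s` is a continuous section of `E`
(up to the choice of coordinate), so that it vanishes at the remaining, isolated, points too. -/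
def holSections (g : RMetric n M) (f : S2 → M) : Set (CSection n f) :=
  {s | IsNormalSection g f s ∧
    ∀ z : ℂ, LinearIndependent ℝ ![dd (n := n) f 1 z, dd (n := n) f Complex.I z] →
      covBar g f s z ∈ Submodule.span ℂ
        ({(1 : ℂ) ⊗ₜ[ℝ] dd (n := n) f 1 z, (1 : ℂ) ⊗ₜ[ℝ] dd (n := n) f Complex.I z} :
          Set (ℂ ⊗[ℝ] TangentSpace (𝓡 n) (f (stereo z))))}

/-! ### The Hermitian form -/

/-- The length of a tangent vector of `M`. -/
def gnorm (g : RMetric n M) (p : M) (v : TangentSpace (𝓡 n) p) : ℝ := √(g.inner p v v)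

/-- First vector of the oriented orthonormal basis of the tangent plane of the image obtained from
`f_x, f_y` by the Gram-Schmidt process. -/
def e₁ (g : RMetric n M) (f : S2 → M) (z : ℂ) : TangentSpace (𝓡 n) (f (stereo z)) :=
  (gnorm g (f (stereo z)) (dd (n := n) f 1 z))⁻¹ • dd (n := n) f 1 z

/-- The component of `f_y` orthogonal to `f_x`. -/
def fyPerp (g : RMetric n M) (f : S2 → M) (z : ℂ) : TangentSpace (𝓡 n) (f (stereo z)) :=
  dd (n := n) f Complex.I z
    - g.inner (f (stereo z)) (dd (n := n) f Complex.I z) (e₁ g f z) • e₁ g f z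

/-- Second vector of the oriented orthonormal basis obtained from `f_x, f_y`. -/
def e₂ (g : RMetric n M) (f : S2 → M) (z : ℂ) : TangentSpace (𝓡 n) (f (stereo z)) :=
  (gnorm g (f (stereo z)) (fyPerp g f z))⁻¹ • fyPerp g f z

/-- The density of the area measure `da` of the image with respect to `dx dy`: the area of the
parallelogram spanned by `f_x, f_y`.  It vanishes where `f` is not an immersion. -/
def areaDensity (g : RMetric n M) (f : S2 → M) (z : ℂ) : ℝ :=
  gnorm g (f (stereo z)) (dd (n := n) f 1 z) * gnorm g (f (stereo z)) (fyPerp g f z)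

/-- The pointwise form `⟨v, w⟩_x = √-1 R(e₁, e₂, v, w̄)` at the point `x` with coordinate `z`. -/
def formAt (g : RMetric n M) (f : S2 → M) (z : ℂ)
    (v w : ℂ ⊗[ℝ] TangentSpace (𝓡 n) (f (stereo z))) : ℂ :=
  Complex.I * extC (curv g (f (stereo z)) (e₁ g f z) (e₂ g f z)) v (conjT w)

/-- The form `⟨s₁, s₂⟩_0 = ∫ √-1 R(e₁, e₂, s₁, s̄₂) da`. -/
def form (g : RMetric n M) (f : S2 → M) (s₁ s₂ : CSection n f) : ℂ :=
  ∫ z : ℂ, formAt g f z (s₁ (stereo z)) (s₂ (stereo z)) * (areaDensity g f z : ℂ)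

end Maps

end StableSphere

end

noncomputable section

set_option maxSynthPendingDepth 3
set_option linter.unusedSectionVars false

namespace StableSphere

/-! ### Levi-Civita calculus on an open subset of a vector space -/

section LocalCalculus

/-! Write `X = f_x`, `Y = f_y`, and `s = a + i b` for a holomorphic normal section. For a
complexified field `W = a + i b` with compact support in the coordinate plane, stability applied to
`a` and to `b`, followed by one integration by parts, gives `∫ R(X - iY, W, W̄, X + iY) ≤ ∫ |∇_x W +
i ∇_y W|²` (`integral_kap_le`). By the first Bianchi identity the integrand on the left is a sum of
four sectional curvature terms minus `2 R(X, Y, a, b)` (`kap_eq`), and `2 R(X, Y, a, b) dx dy` is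
exactly the density of `⟨s, s⟩_0`. So if `W` could be chosen with vanishing right-hand side and the
same left-hand integrand as `s`, positive curvature would give the claim.

Such a `W` is `s + h (X - iY)`. The Hopf differential of a harmonic sphere is holomorphic and
decays, hence vanishes, so `f` is conformal and `X - iY` is isotropic (`conformal_of_harmonic`).
Differentiating the orthogonality of `s` to `X` and `Y` and using harmonicity shows that `∇_z̄ s`,
which is tangential by assumption, is a multiple of `X - iY` (`ip_dRe_dIm`). Since `X - iY` is
itself `∂̄`-holomorphic, the correction only requires solving the scalar equation `∂̄h = β`, which
the Cauchy transform does with a bounded solution (`exists_dbar_eq`). Adding a multiple of `X - iY`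
does not affect the curvature term, because `R` is alternating in its first pair (`kap_add`).

Three analytic points remain. The plane is not compact, so fields are truncated by logarithmic
cutoffs of arbitrarily small Dirichlet energy (`exists_cutoff`). The coefficient of `X - iY` is
singular where `df = 0`; it is regularized by replacing `λ = |f_x|²` by `λ + δ`, and the error tends
to zero by dominated convergence provided that `{df = 0}` is a null set
(`tendsto_integral_regularized`). This last fact is strong unique continuation: in local coordinates
`∂_z f` satisfies `|∂̄u| ≤ C|u|`, so a zero of infinite order propagates, and a zero set of positive
measure contains zeros of infinite order (`volume_zeros_eq_zero`). The limit is
`integral_secSum_le`, and strict positivity holds because a nonzero `s` is nonzero at some immersed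
point, where a sectional curvature term is positive.

The Hermitian symmetry and linearity are pointwise algebra of `R`, integrated with the decay `|z|⁻⁴`
of the density at infinity. -/

lemma minSmoothness_two_le_infty : minSmoothness ℝ 2 ≤ (∞ : WithTop ℕ∞) := by
  rw [minSmoothness_of_isRCLikeNormedField]
  exact WithTop.coe_le_coe.2 le_top

variable {E : Type*} [NormedAddCommGroup E] [NormedSpace ℝ E]

/-- A smooth Riemannian metric on an open set `Ω` of a vector space. -/
structure LocalMetric (G : E → E →L[ℝ] E →L[ℝ] ℝ) (Ω : Set E) : Prop where
  isOpen : IsOpen Ω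
  smooth : ContDiffOn ℝ ∞ G Ω
  symm : ∀ u ∈ Ω, ∀ a b, G u a b = G u b a
  pos : ∀ u ∈ Ω, ∀ a, a ≠ 0 → 0 < G u a a

/-- The Christoffel form of the first kind `½ (∂_a G(b, ·) + ∂_b G(a, ·) - ∂ G(a, b))`. -/
def low (G : E → E →L[ℝ] E →L[ℝ] ℝ) (u a b : E) : E →L[ℝ] ℝ :=
  (1 / 2 : ℝ) • (fderiv ℝ G u a b + fderiv ℝ G u b a - ((fderiv ℝ G u).flip a).flip b)

/-- The Christoffel symbols `Γ_u(a, b)` of the metric `G`. -/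
def gam (G : E → E →L[ℝ] E →L[ℝ] ℝ) (u a b : E) : E := (G u).inverse (low G u a b)

lemma low_apply (G : E → E →L[ℝ] E →L[ℝ] ℝ) (u a b c : E) : low G u a b c =
    (fderiv ℝ G u a b c + fderiv ℝ G u b a c - fderiv ℝ G u c a b) / 2 := by
  simp [low]; ring

/-- The Christoffel symbols as a bilinear map. -/
def gamL [FiniteDimensional ℝ E] (G : E → E →L[ℝ] E →L[ℝ] ℝ) (u : E) : E →L[ℝ] E →L[ℝ] E :=
  LinearMap.toContinuousLinearMap
    { toFun := fun a ↦ LinearMap.toContinuousLinearMap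
        { toFun := fun b ↦ gam G u a b
          map_add' := fun b b' ↦ by
            rw [gam, gam, gam, ← map_add]; congr 1; ext c; simp [low_apply]; ring
          map_smul' := fun r b ↦ by
            rw [gam, gam, ← map_smul]; congr 1; ext c; simp [low_apply]; ring }
      map_add' := fun a a' ↦ by
        ext1 b
        change gam G u (a + a') b = gam G u a b + gam G u a' b
        rw [gam, gam, gam, ← map_add]; congr 1; ext c; simp [low_apply]; ring
      map_smul' := fun r a ↦ by
        ext1 b
        change gam G u (r • a) b = r • gam G u a b
        rw [gam, gam, ← map_smul]; congr 1; ext c; simp [low_apply]; ring }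

variable [FiniteDimensional ℝ E] {G : E → E →L[ℝ] E →L[ℝ] ℝ} {Ω : Set E} {u : E}

lemma gamL_apply (G : E → E →L[ℝ] E →L[ℝ] ℝ) (u a b : E) : gamL G u a b = gam G u a b := rfl

namespace LocalMetric

variable (h : LocalMetric G Ω)
include h

/-- Positive definiteness makes `G u` injective, and a finite-dimensional space and its dual have
equal dimension. This guarantees that `ContinuousLinearMap.inverse` in `gam` is a genuine inverse
and not its default value `0`. -/
lemma exists_equiv (hu : u ∈ Ω) : ∃ e : E ≃L[ℝ] (E →L[ℝ] ℝ), (e : E →L[ℝ] E →L[ℝ] ℝ) = G u := by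
  have hinj : Function.Injective (G u : E →ₗ[ℝ] E →L[ℝ] ℝ) := by
    refine (injective_iff_map_eq_zero _).2 fun a ha ↦ ?_
    by_contra hne
    have h1 := h.pos u hu a hne
    have h2 : G u a = 0 := ha
    simp [h2] at h1
  have hdim : Module.finrank ℝ E = Module.finrank ℝ (E →L[ℝ] ℝ) := by
    rw [← Subspace.dual_finrank_eq]
    exact LinearEquiv.finrank_eq LinearMap.toContinuousLinearMap
  refine ⟨(LinearEquiv.ofInjectiveOfFinrankEq (G u : E →ₗ[ℝ] E →L[ℝ] ℝ) hinj hdim).toContinuousLinearEquiv, ?_⟩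
  ext a b
  rfl

lemma gam_spec (hu : u ∈ Ω) (a b : E) : G u (gam G u a b) = low G u a b := by
  obtain ⟨e, he⟩ := h.exists_equiv hu
  rw [gam, ← he, ContinuousLinearMap.inverse_equiv]
  simp

lemma eq_of_inner (hu : u ∈ Ω) {a b : E} (hab : ∀ c, G u a c = G u b c) : a = b := by
  obtain ⟨e, he⟩ := h.exists_equiv hu
  apply e.injective
  have := he
  ext c
  have h1 := hab c
  rw [← he] at h1
  exact h1

lemma contDiffAt (hu : u ∈ Ω) : ContDiffAt ℝ ∞ G u :=
  h.smooth.contDiffAt (h.isOpen.mem_nhds hu)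

lemma differentiableAt (hu : u ∈ Ω) : DifferentiableAt ℝ G u :=
  (h.contDiffAt hu).differentiableAt (by simp)

lemma eventually_mem (hu : u ∈ Ω) : ∀ᶠ w in nhds u, w ∈ Ω := h.isOpen.mem_nhds hu

lemma hasFDerivAt_apply (hu : u ∈ Ω) (a b : E) :
    HasFDerivAt (fun w ↦ G w a b) (((fderiv ℝ G u).flip a).flip b) u := by
  have h1 := ((h.differentiableAt hu).hasFDerivAt.clm_apply (hasFDerivAt_const a u)).clm_apply
    (hasFDerivAt_const b u)
  exact h1.congr_fderiv (by ext x; simp)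

lemma fderiv_symm (hu : u ∈ Ω) (e a b : E) : fderiv ℝ G u e a b = fderiv ℝ G u e b a := by
  have h1 := h.hasFDerivAt_apply hu a b
  have h2 := (h.hasFDerivAt_apply hu b a).congr_of_eventuallyEq
    (f₁ := fun w ↦ G w a b) (by
      filter_upwards [h.eventually_mem hu] with w hw using h.symm w hw a b)
  have := congrArg (fun T : E →L[ℝ] ℝ ↦ T e) (h1.unique h2)
  simpa using this

lemma gam_symm (hu : u ∈ Ω) (a b : E) : gam G u a b = gam G u b a := by
  apply h.eq_of_inner hu
  intro c
  rw [h.gam_spec hu, h.gam_spec hu, low_apply, low_apply, h.fderiv_symm hu c a b]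
  ring

/-- The Levi-Civita connection preserves the metric. -/
lemma compat (hu : u ∈ Ω) (e a b : E) :
    fderiv ℝ G u e a b = G u (gam G u e a) b + G u a (gam G u e b) := by
  rw [h.symm u hu a, h.gam_spec hu, h.gam_spec hu, low_apply, low_apply, h.fderiv_symm hu e a b,
    h.fderiv_symm hu a e b, h.fderiv_symm hu b e a]
  ring

/-- Inversion of continuous linear maps is smooth at every equivalence, and the symbols of the first
kind are combinations of first derivatives of `G`. -/
lemma contDiffAt_gamL (hu : u ∈ Ω) : ContDiffAt ℝ ∞ (gamL G) u := by
  have hD : ContDiffAt ℝ ∞ (fderiv ℝ G) u := (h.contDiffAt hu).fderiv_right (by simp)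
  have hD' : ContDiffOn ℝ ∞ (fderiv ℝ G) Ω := h.smooth.fderiv_of_isOpen h.isOpen (by simp)
  have key : ContDiffOn ℝ ∞ (gamL G) Ω := by
    rw [contDiffOn_clm_apply]
    intro a
    rw [contDiffOn_clm_apply]
    intro b
    have hinv : ContDiffOn ℝ ∞ (fun w ↦ (G w).inverse) Ω := by
      intro w hw
      obtain ⟨e, he⟩ := h.exists_equiv hw
      have := contDiffAt_map_inverse (n := ∞) e
      rw [he] at this
      exact this.comp_contDiffWithinAt w (h.smooth w hw)
    refine hinv.clm_apply ?_
    rw [contDiffOn_clm_apply]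
    intro c
    simp only [low_apply]
    have hc : ∀ x y z : E, ContDiffOn ℝ ∞ (fun w ↦ fderiv ℝ G w x y z) Ω := fun x y z ↦
      ((hD'.clm_apply contDiffOn_const).clm_apply contDiffOn_const).clm_apply contDiffOn_const
    exact (((hc a b c).add (hc b a c)).sub (hc c a b)).div_const 2
  exact key.contDiffAt (h.isOpen.mem_nhds hu)

end LocalMetric

/-! #### Curvature -/

/-- The curvature operator of the metric `G`. -/
def rm (G : E → E →L[ℝ] E →L[ℝ] ℝ) (u a b c : E) : E :=
  fderiv ℝ (gamL G) u a b c - fderiv ℝ (gamL G) u b a c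
    + gam G u a (gam G u b c) - gam G u b (gam G u a c)

namespace LocalMetric

variable (h : LocalMetric G Ω)
include h

lemma hasFDerivAt_gam (hu : u ∈ Ω) (a b : E) :
    HasFDerivAt (fun w ↦ gam G w a b) (((fderiv ℝ (gamL G) u).flip a).flip b) u := by
  have h1 := (((h.contDiffAt_gamL hu).differentiableAt (by simp)).hasFDerivAt.clm_apply
    (hasFDerivAt_const a u)).clm_apply (hasFDerivAt_const b u)
  exact h1.congr_fderiv (by ext1 x; simp)

lemma fderiv_gam (hu : u ∈ Ω) (e a b : E) :
    fderiv ℝ (fun w ↦ gam G w a b) u e = fderiv ℝ (gamL G) u e a b := by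
  rw [(h.hasFDerivAt_gam hu a b).fderiv]; simp

lemma fderiv_gamL_symm (hu : u ∈ Ω) (e a b : E) :
    fderiv ℝ (gamL G) u e a b = fderiv ℝ (gamL G) u e b a := by
  rw [← h.fderiv_gam hu, ← h.fderiv_gam hu]
  congr 1
  apply Filter.EventuallyEq.fderiv_eq
  filter_upwards [h.eventually_mem hu] with w hw using h.gam_symm hw a b

omit h in
lemma rm_antisymm (a b c : E) : rm G u a b c = - rm G u b a c := by
  simp only [rm]; abel

/-- In the cyclic sum both the derivative terms and the quadratic terms cancel in pairs, by the
symmetry of `Γ` in its two arguments. -/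
lemma rm_bianchi (hu : u ∈ Ω) (a b c : E) : rm G u a b c + rm G u b c a + rm G u c a b = 0 := by
  simp only [rm]
  rw [h.fderiv_gamL_symm hu a b c, h.fderiv_gamL_symm hu b a c, h.fderiv_gamL_symm hu c b a,
    h.gam_symm hu b c, h.gam_symm hu a c, h.gam_symm hu b a]
  abel

/-- The second derivative of the metric in terms of the Christoffel symbols. -/
lemma fderiv_fderiv (hu : u ∈ Ω) (a b c d : E) :
    fderiv ℝ (fderiv ℝ G) u a b c d =
      (G u (gam G u a (gam G u b c)) d + G u (gam G u b c) (gam G u a d)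
        + G u (fderiv ℝ (gamL G) u a b c) d)
      + (G u (gam G u a c) (gam G u b d) + G u c (gam G u a (gam G u b d))
        + G u c (fderiv ℝ (gamL G) u a b d)) := by
  have hD : DifferentiableAt ℝ (fderiv ℝ G) u :=
    ((h.contDiffAt hu).fderiv_right (m := ∞) (by simp)).differentiableAt (by simp)
  have h1 : HasFDerivAt (fun w ↦ fderiv ℝ G w b c d) _ u :=
    ((hD.hasFDerivAt.clm_apply (hasFDerivAt_const b u)).clm_apply
    (hasFDerivAt_const c u)).clm_apply (hasFDerivAt_const d u)
  have hG := (h.differentiableAt hu).hasFDerivAt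
  have h2 : HasFDerivAt (fun w ↦ G w (gam G w b c) d + G w c (gam G w b d)) _ u :=
    ((hG.clm_apply (h.hasFDerivAt_gam hu b c)).clm_apply (hasFDerivAt_const d u)).add
    ((hG.clm_apply (hasFDerivAt_const c u)).clm_apply (h.hasFDerivAt_gam hu b d))
  have h3 := h2.congr_of_eventuallyEq (f₁ := fun w ↦ fderiv ℝ G w b c d) (by
      filter_upwards [h.eventually_mem hu] with w hw using h.compat hw b c d)
  have h4 := congrArg (fun T : E →L[ℝ] ℝ ↦ T a) (h1.unique h3)
  simp only [add_apply, ContinuousLinearMap.flip_apply,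
    ContinuousLinearMap.comp_apply, zero_add,
    ContinuousLinearMap.comp_zero, h.compat hu] at h4
  rw [h4]
  ring

/-- Second derivatives of `G` commute. Expanding both orders by `fderiv_fderiv`, the mixed products
`G(Γ, Γ)` cancel and the rest is the curvature. -/
lemma rm_skew (hu : u ∈ Ω) (a b c d : E) : G u (rm G u a b c) d + G u c (rm G u a b d) = 0 := by
  have hs : fderiv ℝ (fderiv ℝ G) u a b = fderiv ℝ (fderiv ℝ G) u b a :=
    (h.contDiffAt hu).isSymmSndFDerivAt minSmoothness_two_le_infty a b
  have h1 := h.fderiv_fderiv hu a b c d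
  have h2 := h.fderiv_fderiv hu b a c d
  rw [hs] at h1
  simp only [rm, map_add, map_sub, add_apply, sub_apply]
  linarith

end LocalMetric

/-! #### The covariant derivative along a map -/

section Along

variable {D : Type*} [NormedAddCommGroup D] [NormedSpace ℝ D]

/-- The covariant derivative of a vector field `v` along a map `c` into the vector space. -/
def covL (G : E → E →L[ℝ] E →L[ℝ] ℝ) (c v : D → E) (e z : D) : E :=
  fderiv ℝ v z e + gam G (c z) (fderiv ℝ c z e) (v z)

omit [FiniteDimensional ℝ E] in
lemma covL_congr {c v w : D → E} {z : D} (hvw : v =ᶠ[nhds z] w) (e : D) :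
    covL G c v e z = covL G c w e z := by
  rw [covL, covL, hvw.fderiv_eq, hvw.self_of_nhds]

omit [FiniteDimensional ℝ E] in
lemma covL_congr_map {c c' v : D → E} {z : D} (hc : c =ᶠ[nhds z] c') (e : D) :
    covL G c v e z = covL G c' v e z := by
  rw [covL, covL, hc.fderiv_eq, hc.self_of_nhds]

namespace LocalMetric

variable (h : LocalMetric G Ω) {c v w : D → E} {z : D}
include h

lemma fderiv_inner (hz : c z ∈ Ω) (hc : DifferentiableAt ℝ c z) (hv : DifferentiableAt ℝ v z)
    (hw : DifferentiableAt ℝ w z) (e : D) :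
    fderiv ℝ (fun ζ ↦ G (c ζ) (v ζ) (w ζ)) z e
      = G (c z) (covL G c v e z) (w z) + G (c z) (v z) (covL G c w e z) := by
  have hG : HasFDerivAt (fun ζ ↦ G (c ζ)) _ z :=
    (h.differentiableAt hz).hasFDerivAt.comp z hc.hasFDerivAt
  have h1 : HasFDerivAt (fun ζ ↦ G (c ζ) (v ζ) (w ζ)) _ z :=
    (hG.clm_apply hv.hasFDerivAt).clm_apply hw.hasFDerivAt
  rw [h1.fderiv]
  simp [covL, h.compat hz]
  ring

lemma covL_torsion (hz : c z ∈ Ω) (hc : ContDiffAt ℝ ∞ c z) (e e' : D) :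
    covL G c (fun ζ ↦ fderiv ℝ c ζ e') e z = covL G c (fun ζ ↦ fderiv ℝ c ζ e) e' z := by
  have hD : DifferentiableAt ℝ (fderiv ℝ c) z :=
    (hc.fderiv_right (m := ∞) (by simp)).differentiableAt (by simp)
  have hs : fderiv ℝ (fderiv ℝ c) z e e' = fderiv ℝ (fderiv ℝ c) z e' e :=
    hc.isSymmSndFDerivAt minSmoothness_two_le_infty e e'
  have h1 : ∀ d, fderiv ℝ (fun ζ ↦ fderiv ℝ c ζ d) z = (fderiv ℝ (fderiv ℝ c) z).flip d := by
    intro d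
    have : HasFDerivAt (fun ζ ↦ fderiv ℝ c ζ d) _ z :=
      hD.hasFDerivAt.clm_apply (hasFDerivAt_const d z)
    rw [this.fderiv]; ext1 x; simp
  simp only [covL, h1, ContinuousLinearMap.flip_apply, hs]
  rw [h.gam_symm hz]

/-- The second derivatives of `v` and of `c` are symmetric and drop out; the derivative of `Γ` along
`c` and the products `Γ(Γ)` that are left form `rm`. -/
lemma covL_commutator (hz : c z ∈ Ω) (hc : ContDiffAt ℝ ∞ c z) (hv : ContDiffAt ℝ ∞ v z)
    (e e' : D) :
    covL G c (covL G c v e') e z - covL G c (covL G c v e) e' z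
      = rm G (c z) (fderiv ℝ c z e) (fderiv ℝ c z e') (v z) := by
  have hDc : DifferentiableAt ℝ (fderiv ℝ c) z :=
    (hc.fderiv_right (m := ∞) (by simp)).differentiableAt (by simp)
  have hDv : DifferentiableAt ℝ (fderiv ℝ v) z :=
    (hv.fderiv_right (m := ∞) (by simp)).differentiableAt (by simp)
  have hsc : fderiv ℝ (fderiv ℝ c) z e e' = fderiv ℝ (fderiv ℝ c) z e' e :=
    hc.isSymmSndFDerivAt minSmoothness_two_le_infty e e'
  have hsv : fderiv ℝ (fderiv ℝ v) z e e' = fderiv ℝ (fderiv ℝ v) z e' e :=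
    hv.isSymmSndFDerivAt minSmoothness_two_le_infty e e'
  have hG : HasFDerivAt (fun ζ ↦ gamL G (c ζ)) _ z :=
    ((h.contDiffAt_gamL hz).differentiableAt (by simp)).hasFDerivAt.comp z
      (hc.differentiableAt (by simp)).hasFDerivAt
  have key : ∀ d d' : D, fderiv ℝ (covL G c v d) z d' = fderiv ℝ (fderiv ℝ v) z d' d
      + fderiv ℝ (gamL G) (c z) (fderiv ℝ c z d') (fderiv ℝ c z d) (v z)
      + gam G (c z) (fderiv ℝ (fderiv ℝ c) z d' d) (v z)
      + gam G (c z) (fderiv ℝ c z d) (fderiv ℝ v z d') := by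
    intro d d'
    have : HasFDerivAt (covL G c v d) _ z :=
      (hDv.hasFDerivAt.clm_apply (hasFDerivAt_const d z)).add
      ((hG.clm_apply (hDc.hasFDerivAt.clm_apply (hasFDerivAt_const d z))).clm_apply
        (hv.differentiableAt (by simp)).hasFDerivAt)
    rw [this.fderiv]
    simp [gamL_apply]
    abel
  have hadd : ∀ x y y' : E, gam G (c z) x (y + y') = gam G (c z) x y + gam G (c z) x y' :=
    fun x y y' ↦ map_add (gamL G (c z) x) y y'
  have hunf : ∀ (y : D → E) (d : D),
      covL G c y d z = fderiv ℝ y z d + gam G (c z) (fderiv ℝ c z d) (y z) := fun _ _ ↦ rfl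
  rw [hunf (covL G c v e'), hunf (covL G c v e), key, key, hsc, hsv, rm]
  simp only [covL, hadd]
  abel

end LocalMetric

/-- Covariant derivatives are natural under isometric changes of coordinates `θ`. -/
lemma covL_change {G' : E → E →L[ℝ] E →L[ℝ] ℝ} {Ω' : Set E} (h : LocalMetric G Ω)
    (h' : LocalMetric G' Ω') {θ : E → E} {c v : D → E} {z : D} (hz : c z ∈ Ω)
    (hθz : θ (c z) ∈ Ω') (hθ : ContDiffAt ℝ ∞ θ (c z))
    (hiso : ∀ᶠ u in nhds (c z), ∀ a b, G u a b = G' (θ u) (fderiv ℝ θ u a) (fderiv ℝ θ u b))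
    (hsurj : Function.Surjective (fderiv ℝ θ (c z)))
    (hc : DifferentiableAt ℝ c z) (hv : DifferentiableAt ℝ v z) (e : D) :
    covL G' (fun ζ ↦ θ (c ζ)) (fun ζ ↦ fderiv ℝ θ (c ζ) (v ζ)) e z
      = fderiv ℝ θ (c z) (covL G c v e z) := by
  have hD : DifferentiableAt ℝ (fderiv ℝ θ) (c z) :=
    (hθ.fderiv_right (m := ∞) (by simp)).differentiableAt (by simp)
  have hθd : HasFDerivAt θ (fderiv ℝ θ (c z)) (c z) :=
    (hθ.differentiableAt (by simp)).hasFDerivAt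
  have hs : ∀ a b, fderiv ℝ (fderiv ℝ θ) (c z) a b = fderiv ℝ (fderiv ℝ θ) (c z) b a :=
    hθ.isSymmSndFDerivAt minSmoothness_two_le_infty
  set A := fderiv ℝ θ (c z) with hA
  set B := fderiv ℝ (fderiv ℝ θ) (c z) with hB
  -- The isometry identity, differentiated once in the direction `x`.
  have hmet : ∀ x a b : E, fderiv ℝ G (c z) x a b
      = fderiv ℝ G' (θ (c z)) (A x) (A a) (A b) + G' (θ (c z)) (B x a) (A b)
        + G' (θ (c z)) (A a) (B x b) := by
    intro x a b
    have h1 := h.hasFDerivAt_apply hz a b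
    have h2 : HasFDerivAt (fun u ↦ G' (θ u) (fderiv ℝ θ u a) (fderiv ℝ θ u b)) _ (c z) :=
      (((h'.differentiableAt hθz).hasFDerivAt.comp (c z) hθd).clm_apply
        (hD.hasFDerivAt.clm_apply (hasFDerivAt_const a (c z)))).clm_apply
        (hD.hasFDerivAt.clm_apply (hasFDerivAt_const b (c z)))
    have h3 := h2.congr_of_eventuallyEq (f₁ := fun w ↦ G w a b) (by
      filter_upwards [hiso] with w hw using hw a b)
    have h4 := congrArg (fun T : E →L[ℝ] ℝ ↦ T x) (h1.unique h3)
    simp [← hA, ← hB] at h4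
    rw [h4]
    ring
  -- The transformation law of the Christoffel symbols. Its inhomogeneous term `B a b` is what the
  -- derivative of `dθ(v)` contributes in `hcov`.
  have hgam : ∀ a b, A (gam G (c z) a b) = gam G' (θ (c z)) (A a) (A b) + B a b := by
    intro a b
    apply h'.eq_of_inner hθz
    intro y
    obtain ⟨x, rfl⟩ := hsurj y
    have h1 := hiso.self_of_nhds (gam G (c z) a b) x
    rw [← hA] at h1
    rw [← h1, h.gam_spec hz, map_add, add_apply, h'.gam_spec hθz, low_apply,
      low_apply, hmet, hmet, hmet, hs b a, hs x a, hs x b, h'.symm _ hθz (A b) (B a x),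
      h'.symm _ hθz (A a) (B b x)]
    ring
  have hcov : fderiv ℝ (fun ζ ↦ fderiv ℝ θ (c ζ) (v ζ)) z e
      = B (fderiv ℝ c z e) (v z) + A (fderiv ℝ v z e) := by
    have : HasFDerivAt (fun ζ ↦ fderiv ℝ θ (c ζ) (v ζ)) _ z :=
      (hD.hasFDerivAt.comp z hc.hasFDerivAt).clm_apply hv.hasFDerivAt
    rw [this.fderiv]
    simp [← hA, ← hB]
    abel
  have hcc : fderiv ℝ (fun ζ ↦ θ (c ζ)) z e = A (fderiv ℝ c z e) := by
    have : HasFDerivAt (fun ζ ↦ θ (c ζ)) _ z := hθd.comp z hc.hasFDerivAt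
    rw [this.fderiv]
    simp
  rw [covL, covL, hcov, hcc, map_add, hgam]
  abel

/-- An isometry `θ` of an open set `U` with the metric `G` into `Ω'` with the metric `G'`. -/
structure LocalIsometry (G : E → E →L[ℝ] E →L[ℝ] ℝ) (Ω : Set E) (G' : E → E →L[ℝ] E →L[ℝ] ℝ)
    (Ω' : Set E) (θ : E → E) (U : Set E) : Prop where
  isOpen : IsOpen U
  subset : U ⊆ Ω
  mapsTo : ∀ u ∈ U, θ u ∈ Ω'
  smooth : ContDiffOn ℝ ∞ θ U
  iso : ∀ u ∈ U, ∀ a b, G u a b = G' (θ u) (fderiv ℝ θ u a) (fderiv ℝ θ u b)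
  surj : ∀ u ∈ U, Function.Surjective (fderiv ℝ θ u)

namespace LocalIsometry

variable {G' : E → E →L[ℝ] E →L[ℝ] ℝ} {Ω' U : Set E} {θ : E → E}
  (h : LocalMetric G Ω) (h' : LocalMetric G' Ω') (hθ : LocalIsometry G Ω G' Ω' θ U)
include h h' hθ

/-- Covariant derivatives are natural under isometries. -/
lemma covL_eq {c v : D → E} {z : D} (hz : c z ∈ U) (hc : DifferentiableAt ℝ c z)
    (hv : DifferentiableAt ℝ v z) (e : D) :
    covL G' (fun ζ ↦ θ (c ζ)) (fun ζ ↦ fderiv ℝ θ (c ζ) (v ζ)) e z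
      = fderiv ℝ θ (c z) (covL G c v e z) :=
  covL_change h h' (hθ.subset hz) (hθ.mapsTo _ hz)
    (hθ.smooth.contDiffAt (hθ.isOpen.mem_nhds hz))
    (by filter_upwards [hθ.isOpen.mem_nhds hz] with w hw using hθ.iso w hw)
    (hθ.surj _ hz) hc hv e

/-- The curvature is natural under isometries. -/
lemma rm_eq (hu : u ∈ U) (a b x : E) :
    rm G' (θ u) (fderiv ℝ θ u a) (fderiv ℝ θ u b) (fderiv ℝ θ u x)
      = fderiv ℝ θ u (rm G u a b x) := by
  -- Curvature is the commutator of covariant derivatives of the constant field `x` along an affine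
  -- two-parameter map with velocities `a` and `b`. Its naturality thus follows from that of
  -- covariant derivatives, applied twice.
  let c : ℝ × ℝ → E := fun q ↦ u + (q.1 • a + q.2 • b)
  have hc : ContDiff ℝ ∞ c := by fun_prop
  have hc0 : c 0 = u := by simp [c]
  have hUc : ∀ᶠ q in nhds (0 : ℝ × ℝ), c q ∈ U :=
    hc.continuous.continuousAt.preimage_mem_nhds (by rw [hc0]; exact hθ.isOpen.mem_nhds hu)
  have hc' : ∀ q : ℝ × ℝ, HasFDerivAt c ((ContinuousLinearMap.fst ℝ ℝ ℝ).smulRight a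
      + (ContinuousLinearMap.snd ℝ ℝ ℝ).smulRight b) q := fun q ↦
    (((hasFDerivAt_fst (𝕜 := ℝ) (p := q)).smul_const a).add
      ((hasFDerivAt_snd (𝕜 := ℝ) (p := q)).smul_const b)).const_add u
  have hca : fderiv ℝ c 0 (1, 0) = a := by rw [(hc' 0).fderiv]; simp
  have hcb : fderiv ℝ c 0 (0, 1) = b := by rw [(hc' 0).fderiv]; simp
  have hθat : ContDiffAt ℝ ∞ θ (c 0) := by
    rw [hc0]; exact hθ.smooth.contDiffAt (hθ.isOpen.mem_nhds hu)
  have hDθ : ContDiffAt ℝ ∞ (fderiv ℝ θ) (c 0) := hθat.fderiv_right (by simp)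
  have hθc : ContDiffAt ℝ ∞ (fun q ↦ θ (c q)) 0 := hθat.comp 0 hc.contDiffAt
  have hw : ContDiffAt ℝ ∞ (fun q ↦ fderiv ℝ θ (c q) x) 0 :=
    (hDθ.comp (0 : ℝ × ℝ) hc.contDiffAt).clm_apply contDiffAt_const
  have hv : ContDiffAt ℝ ∞ (fun _ : ℝ × ℝ ↦ x) 0 := contDiffAt_const
  have h1 := h'.covL_commutator (c := fun q ↦ θ (c q)) (v := fun q ↦ fderiv ℝ θ (c q) x)
    (z := (0 : ℝ × ℝ)) (by rw [hc0]; exact hθ.mapsTo u hu) hθc hw (1, 0) (0, 1)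
  have h2 := h.covL_commutator (c := c) (v := fun _ ↦ x) (z := (0 : ℝ × ℝ))
    (by rw [hc0]; exact hθ.subset hu) hc.contDiffAt hv (1, 0) (0, 1)
  -- An identity of germs, since it is differentiated once more in `h6`.
  have h3 : ∀ e : ℝ × ℝ, covL G' (fun q ↦ θ (c q)) (fun q ↦ fderiv ℝ θ (c q) x) e =ᶠ[nhds 0]
      fun q ↦ fderiv ℝ θ (c q) (covL G c (fun _ ↦ x) e q) := by
    intro e
    filter_upwards [hUc] with q hq
    exact covL_eq h h' hθ hq (hc.differentiable (by simp) q) (differentiableAt_const x) e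
  have hdiff : ∀ e : ℝ × ℝ, DifferentiableAt ℝ (covL G c (fun _ ↦ x) e) 0 := by
    intro e
    have hg : ContDiffAt ℝ ∞ (fun q ↦ gamL G (c q)) 0 :=
      (h.contDiffAt_gamL (by rw [hc0]; exact hθ.subset hu)).comp (0 : ℝ × ℝ) hc.contDiffAt
    have hf : ContDiffAt ℝ ∞ (fderiv ℝ c) 0 := hc.contDiffAt.fderiv_right (by simp)
    have h4 : ContDiffAt ℝ ∞ (fun q ↦ gamL G (c q) (fderiv ℝ c q e) x) 0 :=
      (hg.clm_apply (hf.clm_apply contDiffAt_const)).clm_apply contDiffAt_const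
    have h5 : covL G c (fun _ ↦ x) e = fun q ↦ gamL G (c q) (fderiv ℝ c q e) x := by
      funext q; simp [covL, gamL_apply]
    rw [h5]
    exact h4.differentiableAt (by simp)
  have h6 : ∀ e e' : ℝ × ℝ, covL G' (fun q ↦ θ (c q)) (covL G' (fun q ↦ θ (c q))
      (fun q ↦ fderiv ℝ θ (c q) x) e') e 0
      = fderiv ℝ θ (c 0) (covL G c (covL G c (fun _ ↦ x) e') e 0) := by
    intro e e'
    rw [← covL_eq h h' hθ (c := c) (v := covL G c (fun _ ↦ x) e') (by rw [hc0]; exact hu)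
      (hc.differentiable (by simp) 0) (hdiff e') e]
    exact covL_congr (h3 e') e
  have hθc' : ∀ e, fderiv ℝ (fun q ↦ θ (c q)) 0 e = fderiv ℝ θ (c 0) (fderiv ℝ c 0 e) := by
    intro e
    have : HasFDerivAt (fun q ↦ θ (c q)) _ 0 :=
      (hθat.differentiableAt (by simp)).hasFDerivAt.comp (0 : ℝ × ℝ)
        (hc.differentiable (by simp) 0).hasFDerivAt
    rw [this.fderiv]; simp
  rw [h6, h6, ← map_sub, h2, hθc', hθc', hca, hcb, hc0] at h1
  exact h1.symm

end LocalIsometry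

end Along

end LocalCalculus

/-! ### Riemannian calculus along maps into a manifold -/

section GlobalCalculus

variable {n : ℕ} {M : Type*} [TopologicalSpace M] [ChartedSpace (EE n) M]
  [IsManifold (𝓡 n) ∞ M]

/-- The components of a tangent vector at `q` in the chart at `p`. -/
def tc (p q : M) : EE n →L[ℝ] EE n := mfderiv (𝓡 n) 𝓘(ℝ, EE n) (extChartAt (𝓡 n) p) q

/-- The tangent vector with given components in the chart at `p`, at the point `u`. -/
def ct (p : M) (u : EE n) : EE n →L[ℝ] EE n :=
  mfderiv 𝓘(ℝ, EE n) (𝓡 n) (extChartAt (𝓡 n) p).symm u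

lemma isOpen_target (p : M) : IsOpen (extChartAt (𝓡 n) p).target := isOpen_extChartAt_target p

lemma source_mem_nhds' {p q : M} (hq : q ∈ (extChartAt (𝓡 n) p).source) :
    (extChartAt (𝓡 n) p).source ∈ nhds q := (isOpen_extChartAt_source p).mem_nhds hq

lemma contMDiffAt_chart {p q : M} (hq : q ∈ (extChartAt (𝓡 n) p).source) :
    ContMDiffAt (𝓡 n) 𝓘(ℝ, EE n) ∞ (extChartAt (𝓡 n) p) q :=
  contMDiffAt_extChartAt' (by rwa [extChartAt_source] at hq)

lemma contMDiffAt_chart_symm {p : M} {u : EE n} (hu : u ∈ (extChartAt (𝓡 n) p).target) :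
    ContMDiffAt 𝓘(ℝ, EE n) (𝓡 n) ∞ (extChartAt (𝓡 n) p).symm u :=
  (contMDiffOn_extChartAt_symm p).contMDiffAt ((isOpen_target p).mem_nhds hu)

lemma mdiffAt_chart {p q : M} (hq : q ∈ (extChartAt (𝓡 n) p).source) :
    MDifferentiableAt (𝓡 n) 𝓘(ℝ, EE n) (extChartAt (𝓡 n) p) q :=
  (contMDiffAt_chart hq).mdifferentiableAt (by simp)

lemma mdiffAt_chart_symm {p : M} {u : EE n} (hu : u ∈ (extChartAt (𝓡 n) p).target) :
    MDifferentiableAt 𝓘(ℝ, EE n) (𝓡 n) (extChartAt (𝓡 n) p).symm u :=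
  (contMDiffAt_chart_symm hu).mdifferentiableAt (by simp)

lemma tc_ct {p : M} {u : EE n} (hu : u ∈ (extChartAt (𝓡 n) p).target) (a : EE n) :
    tc p ((extChartAt (𝓡 n) p).symm u) (ct p u a) = a := by
  have h := mfderiv_extChartAt_comp_mfderivWithin_extChartAt_symm (I := 𝓡 n) hu
  have h2 := congrArg (fun T ↦ T a) h
  simp only [modelWithCornersSelf_coe, Set.range_id, mfderivWithin_univ] at h2
  exact h2

lemma ct_tc {p q : M} (hq : q ∈ (extChartAt (𝓡 n) p).source) (v : EE n) :
    ct p (extChartAt (𝓡 n) p q) (tc p q v) = v := by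
  have h := mfderivWithin_extChartAt_symm_comp_mfderiv_extChartAt' (I := 𝓡 n) hq
  have h2 := congrArg (fun T ↦ T v) h
  simp only [modelWithCornersSelf_coe, Set.range_id, mfderivWithin_univ] at h2
  exact h2

/-- The tangent space at `p` is trivialized by the preferred chart at `p` itself; hence vectors at
`p` and their components in that chart may be confused, as the definitions of `curvOp` and
`covAlong` do. -/
lemma tc_self (p : M) (v : EE n) : tc p p v = v := by
  have h := tangentCoordChange_self (I := 𝓡 n) (x := p) (z := p) (v := v)
    (mem_extChartAt_source p)
  have h2 : (tc p p : EE n →L[ℝ] EE n) = tangentCoordChange (𝓡 n) p p p := by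
    have := TangentBundle.continuousLinearMapAt_trivializationAt (I := 𝓡 n) (x₀ := p) (x := p)
      (mem_chart_source _ p)
    rw [tc, ← this, TangentBundle.continuousLinearMapAt_trivializationAt_eq_core
      (mem_chart_source _ p)]
  rw [h2]; exact h

/-- The metric as a family of bilinear forms on the model space. -/
def ip (g : RMetric n M) (q : M) : EE n →L[ℝ] EE n →L[ℝ] ℝ := g.inner q

lemma ip_symm (g : RMetric n M) (q : M) (v w : EE n) : ip g q v w = ip g q w v := g.symm q v w

lemma ip_pos (g : RMetric n M) (q : M) {v : EE n} (hv : v ≠ 0) : 0 < ip g q v v := g.pos q v hv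

/-- The metric in the chart at `p`, as a map into the continuous bilinear forms. -/
def gramL (g : RMetric n M) (p : M) (u : EE n) : EE n →L[ℝ] EE n →L[ℝ] ℝ :=
  (ip g ((extChartAt (𝓡 n) p).symm u)).bilinearComp (ct p u) (ct p u)

lemma gramL_apply (g : RMetric n M) (p : M) (u a b : EE n) :
    gramL g p u a b = ip g ((extChartAt (𝓡 n) p).symm u) (ct p u a) (ct p u b) := rfl

lemma gram_eq_gramL (g : RMetric n M) (p : M) (u a b : EE n) :
    gram g p u a b = gramL g p u a b := rfl

lemma ip_eq_gramL (g : RMetric n M) {p q : M} (hq : q ∈ (extChartAt (𝓡 n) p).source)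
    (v w : EE n) :
    ip g q v w = gramL g p (extChartAt (𝓡 n) p q) (tc p q v) (tc p q w) := by
  rw [gramL_apply, ct_tc hq, ct_tc hq, (extChartAt (𝓡 n) p).left_inv hq]

/-- A map into the tangent bundle, given by the base point and the vector. -/
def tb {N : Type*} (u : N → M) (V : N → EE n) (ζ : N) : TangentBundle (𝓡 n) M := ⟨u ζ, V ζ⟩

section ManifoldDomain

variable {D : Type*} [NormedAddCommGroup D] [NormedSpace ℝ D] {H : Type*} [TopologicalSpace H]
  {I : ModelWithCorners ℝ D H} {N : Type*} [TopologicalSpace N] [ChartedSpace H N]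
  {u : N → M} {z : N} {V W : N → EE n}

lemma contMDiffAt_ip (g : RMetric n M) (hV : ContMDiffAt I (𝓡 n).tangent ∞ (tb u V) z)
    (hW : ContMDiffAt I (𝓡 n).tangent ∞ (tb u W) z) :
    ContMDiffAt I 𝓘(ℝ, ℝ) ∞ (fun ζ ↦ ip g (u ζ) (V ζ) (W ζ)) z := by
  have hb : ContMDiffAt I (𝓡 n) ∞ u z := (contMDiffAt_totalSpace.1 hV).1
  have h1 : ContMDiffAt I ((𝓡 n).prod 𝓘(ℝ, ℝ)) ∞ (fun ζ ↦ TotalSpace.mk' ℝ (E := Bundle.Trivial M ℝ)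
      (u ζ) (g.inner (u ζ) (V ζ) (W ζ))) z := by
    refine ContMDiffAt.clm_bundle_apply₂ (F₁ := EE n) (F₂ := EE n) (E₁ := TangentSpace (𝓡 n))
      (E₂ := TangentSpace (𝓡 n)) ?_ hV hW
    exact (g.contMDiff (u z)).comp z hb
  exact (contMDiffAt_totalSpace.1 h1).2

end ManifoldDomain

lemma tc_eq_triv {p q : M} (hq : q ∈ (extChartAt (𝓡 n) p).source) (v : EE n) :
    tc p q v = (trivializationAt (EE n) (TangentSpace (𝓡 n)) p (⟨q, v⟩ : TangentBundle (𝓡 n) M)).2 := by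
  rw [extChartAt_source] at hq
  have h1 := TangentBundle.continuousLinearMapAt_trivializationAt (I := 𝓡 n) (x₀ := p) (x := q) hq
  have h2 := congrArg (fun T : TangentSpace (𝓡 n) q →L[ℝ] EE n ↦ T v) h1
  have h3 := congrFun (Trivialization.coe_linearMapAt_of_mem (R := ℝ)
    (e := trivializationAt (EE n) (TangentSpace (𝓡 n) (M := M)) p) (b := q)
    (by simpa using hq)) v
  exact h2.symm.trans h3

section VectorDomain

variable {D : Type*} [NormedAddCommGroup D] [NormedSpace ℝ D]
  {u : D → M} {z : D} {V W : D → EE n}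

/-- The trivialization of the tangent bundle over a chart domain is given by `tc p`, so the
smoothness of a field along a smooth map can be tested on its components in any chart. -/
lemma field_iff {p : M} (hu : ContMDiffAt 𝓘(ℝ, D) (𝓡 n) ∞ u z)
    (hz : u z ∈ (extChartAt (𝓡 n) p).source) :
    ContMDiffAt 𝓘(ℝ, D) (𝓡 n).tangent ∞ (tb u V) z ↔
      ContDiffAt ℝ ∞ (fun ζ ↦ tc p (u ζ) (V ζ)) z := by
  have hz' : tb u V z ∈ (trivializationAt (EE n) (TangentSpace (𝓡 n)) p).source := by
    rw [Trivialization.mem_source]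
    simpa [tb] using hz
  rw [Trivialization.contMDiffAt_iff hz', contMDiffAt_iff_contDiffAt]
  have hu' : ContMDiffAt 𝓘(ℝ, D) (𝓡 n) ∞ (fun x ↦ (tb u V x).proj) z := hu
  simp only [hu', true_and]
  have key : (fun ζ ↦ tc p (u ζ) (V ζ)) =ᶠ[nhds z]
      fun ζ ↦ (trivializationAt (EE n) (TangentSpace (𝓡 n)) p (tb u V ζ)).2 := by
    filter_upwards [hu.continuousAt.preimage_mem_nhds (source_mem_nhds' hz)] with ζ hζ
    exact tc_eq_triv hζ _
  exact ⟨fun h ↦ h.congr_of_eventuallyEq key, fun h ↦ h.congr_of_eventuallyEq key.symm⟩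

/-- The derivative of a map `u` in the direction `e`. -/
def du (u : D → M) (e z : D) : EE n := mfderiv 𝓘(ℝ, D) (𝓡 n) u z e

lemma contDiffAt_chart_comp {p : M} (hu : ContMDiffAt 𝓘(ℝ, D) (𝓡 n) ∞ u z)
    (hz : u z ∈ (extChartAt (𝓡 n) p).source) :
    ContDiffAt ℝ ∞ (fun ζ ↦ extChartAt (𝓡 n) p (u ζ)) z :=
  ((contMDiffAt_chart hz).comp z hu).contDiffAt

lemma tc_du {p : M} (hu : MDifferentiableAt 𝓘(ℝ, D) (𝓡 n) u z)
    (hz : u z ∈ (extChartAt (𝓡 n) p).source) (e : D) :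
    tc p (u z) (du u e z) = fderiv ℝ (fun ζ ↦ extChartAt (𝓡 n) p (u ζ)) z e := by
  have h := mfderiv_comp z (mdiffAt_chart hz) hu
  rw [← mfderiv_eq_fderiv]
  exact (congrArg (fun T ↦ T e) h).symm

lemma eventually_mdiff (hu : ContMDiffAt 𝓘(ℝ, D) (𝓡 n) ∞ u z) :
    ∀ᶠ ζ in nhds z, MDifferentiableAt 𝓘(ℝ, D) (𝓡 n) u ζ := by
  have h1 : ContMDiffAt 𝓘(ℝ, D) (𝓡 n) 1 u z := hu.of_le (WithTop.coe_le_coe.2 le_top)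
  filter_upwards [contMDiffAt_iff_contMDiffAt_nhds (by simp) |>.1 h1] with ζ hζ
    using hζ.mdifferentiableAt (by simp)

lemma contMDiffAt_du (hu : ContMDiffAt 𝓘(ℝ, D) (𝓡 n) ∞ u z) (e : D) :
    ContMDiffAt 𝓘(ℝ, D) (𝓡 n).tangent ∞ (tb (n := n) u (du u e)) z := by
  have hz : u z ∈ (extChartAt (𝓡 n) (u z)).source := mem_extChartAt_source _
  rw [field_iff hu hz]
  have h2 : ContDiffAt ℝ ∞ (fun ζ ↦ fderiv ℝ (fun ζ ↦ extChartAt (𝓡 n) (u z) (u ζ)) ζ e) z :=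
    ((contDiffAt_chart_comp hu hz).fderiv_right (by simp)).clm_apply contDiffAt_const
  refine h2.congr_of_eventuallyEq ?_
  filter_upwards [hu.continuousAt.preimage_mem_nhds (source_mem_nhds' hz), eventually_mdiff hu]
    with ζ h1 h2
  exact tc_du h2 h1 e

end VectorDomain

/-! #### The metric in charts -/

lemma localMetric (g : RMetric n M) (p : M) :
    LocalMetric (gramL g p) (extChartAt (𝓡 n) p).target where
  isOpen := isOpen_target p
  smooth := by
    rw [contDiffOn_clm_apply]
    intro a
    rw [contDiffOn_clm_apply]
    intro b u hu
    have h := fun e : EE n ↦ contMDiffAt_du (contMDiffAt_chart_symm hu) e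
    exact (contMDiffAt_ip g (h a) (h b)).contDiffAt.contDiffWithinAt
  symm u _ a b := by rw [gramL_apply, gramL_apply, ip_symm]
  pos u hu a ha := by
    rw [gramL_apply]
    apply ip_pos
    intro h0
    apply ha
    rw [← tc_ct hu a, h0, map_zero]

lemma christoffelLow_eq (g : RMetric n M) {p : M} {u : EE n}
    (hu : u ∈ (extChartAt (𝓡 n) p).target) (a b c : EE n) :
    christoffelLow g p u a b c = low (gramL g p) u a b c := by
  have h := (localMetric g p).hasFDerivAt_apply hu
  have h1 : ∀ a b e, fderiv ℝ (fun w ↦ gram g p w a b) u e = fderiv ℝ (gramL g p) u e a b := by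
    intro a b e
    rw [show (fun w ↦ gram g p w a b) = fun w ↦ gramL g p w a b from rfl, (h a b).fderiv]
    simp
  rw [christoffelLow, h1, h1, h1, low_apply]

/-- Lowering the index of `gam` returns the symbols of the first kind, and the Gram matrix is
invertible by positivity. This identifies the classical formula with the coordinate-free one, for
which the symmetries were proved. -/
lemma christoffel_eq (g : RMetric n M) {p : M} {u : EE n}
    (hu : u ∈ (extChartAt (𝓡 n) p).target) (a b : EE n) :
    christoffel g p u a b = gam (gramL g p) u a b := by
  have hm := localMetric g p
  set y := gam (gramL g p) u a b with hy
  have hsum : ∀ x : EE n, x = ∑ k, x k • stdB n k := by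
    intro x
    ext j
    simp [stdB, Pi.single_apply]
  have hlow : (fun l ↦ christoffelLow g p u a b (stdB n l)) = (gramMatrix g p u).mulVec y := by
    funext l
    rw [christoffelLow_eq g hu, ← hm.gam_spec hu, ← hy, hm.symm u hu]
    conv_lhs => rw [hsum y]
    simp only [map_sum, map_smul, smul_eq_mul]
    simp [Matrix.mulVec, dotProduct, gramMatrix, gram_eq_gramL, mul_comm]
  have hunit : IsUnit (gramMatrix g p u).det := by
    rw [← Matrix.isUnit_iff_isUnit_det, ← Matrix.mulVec_injective_iff_isUnit]
    intro x x' hx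
    rw [← sub_eq_zero, ← Matrix.mulVec_sub] at hx
    rw [← sub_eq_zero]
    generalize x - x' = w at hx ⊢
    by_contra hw
    have h1 := hm.pos u hu (WithLp.toLp 2 w) (by simpa using hw)
    have h2 : gramL g p u (WithLp.toLp 2 w) (WithLp.toLp 2 w)
        = dotProduct w ((gramMatrix g p u).mulVec w) := by
      conv_lhs => rw [hsum (WithLp.toLp 2 w)]
      simp only [map_sum, map_smul, smul_eq_mul, sum_apply,
        smul_apply]
      simp [Matrix.mulVec, dotProduct, gramMatrix, gram_eq_gramL, mul_comm, Finset.mul_sum]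
      rw [Finset.sum_comm]
      refine Finset.sum_congr rfl fun i _ ↦ Finset.sum_congr rfl fun j _ ↦ ?_
      ring
    rw [h2, hx] at h1
    simp at h1
  have h3 : christoffel g p u a b
      = WithLp.toLp 2 ((gramMatrix g p u)⁻¹.mulVec fun l ↦ christoffelLow g p u a b (stdB n l)) := rfl
  rw [h3, hlow, Matrix.mulVec_mulVec, Matrix.nonsing_inv_mul _ hunit, Matrix.one_mulVec]

end GlobalCalculus

/-! ### Chart independence of the connection and of the curvature -/

section GlobalConnection

variable {n : ℕ} {M : Type*} [TopologicalSpace M] [ChartedSpace (EE n) M]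
  [IsManifold (𝓡 n) ∞ M]

/-- The change of coordinates from the chart at `q` to the chart at `p`. -/
def trans (q p : M) (u : EE n) : EE n := extChartAt (𝓡 n) p ((extChartAt (𝓡 n) q).symm u)

/-- The domain of the change of coordinates. -/
def transDom (q p : M) : Set (EE n) :=
  (extChartAt (𝓡 n) q).target ∩ (extChartAt (𝓡 n) q).symm ⁻¹' (extChartAt (𝓡 n) p).source

lemma mem_transDom {q p x : M} (hq : x ∈ (extChartAt (𝓡 n) q).source)
    (hp : x ∈ (extChartAt (𝓡 n) p).source) : extChartAt (𝓡 n) q x ∈ transDom q p := by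
  refine ⟨(extChartAt (𝓡 n) q).map_source hq, ?_⟩
  rw [Set.mem_preimage, (extChartAt (𝓡 n) q).left_inv hq]
  exact hp

lemma trans_chart {q p x : M} (hq : x ∈ (extChartAt (𝓡 n) q).source) :
    trans q p (extChartAt (𝓡 n) q x) = extChartAt (𝓡 n) p x := by
  rw [trans, (extChartAt (𝓡 n) q).left_inv hq]

lemma fderiv_trans {q p : M} {u : EE n} (hu : u ∈ transDom q p) (a : EE n) :
    fderiv ℝ (trans q p) u a = tc p ((extChartAt (𝓡 n) q).symm u) (ct q u a) := by
  have h := mfderiv_comp u (mdiffAt_chart hu.2) (mdiffAt_chart_symm hu.1)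
  rw [← mfderiv_eq_fderiv]
  exact congrArg (fun T ↦ T a) h

lemma fderiv_trans_tc {q p x : M} (hq : x ∈ (extChartAt (𝓡 n) q).source)
    (hp : x ∈ (extChartAt (𝓡 n) p).source) (v : EE n) :
    fderiv ℝ (trans q p) (extChartAt (𝓡 n) q x) (tc q x v) = tc p x v := by
  rw [fderiv_trans (mem_transDom hq hp), ct_tc hq, (extChartAt (𝓡 n) q).left_inv hq]

/-- Both charts represent the same metric `g`, so the coordinate change is an isometry; its
derivative is onto because the opposite change inverts it. Chart independence of covariant
derivatives and curvature rests on this. -/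
lemma localIsometry_trans (g : RMetric n M) (q p : M) :
    LocalIsometry (gramL g q) (extChartAt (𝓡 n) q).target (gramL g p) (extChartAt (𝓡 n) p).target
      (trans q p) (transDom q p) where
  isOpen := (continuousOn_extChartAt_symm q).isOpen_inter_preimage (isOpen_target q)
    (isOpen_extChartAt_source p)
  subset := Set.inter_subset_left
  mapsTo u hu := (extChartAt (𝓡 n) p).map_source hu.2
  smooth u hu :=
    ((contMDiffAt_chart hu.2).comp u (contMDiffAt_chart_symm hu.1)).contDiffAt.contDiffWithinAt
  iso u hu a b := by
    rw [fderiv_trans hu, fderiv_trans hu, trans, ← ip_eq_gramL g hu.2, gramL_apply]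
  surj u hu y := by
    refine ⟨tc q ((extChartAt (𝓡 n) q).symm u) (ct p (trans q p u) y), ?_⟩
    have h1 : (extChartAt (𝓡 n) q).symm u ∈ (extChartAt (𝓡 n) q).source :=
      (extChartAt (𝓡 n) q).map_target hu.1
    have h2 := fderiv_trans_tc h1 hu.2 (ct p (trans q p u) y)
    rw [(extChartAt (𝓡 n) q).right_inv hu.1] at h2
    rw [h2]
    have h3 := tc_ct ((extChartAt (𝓡 n) p).map_source hu.2) y
    rw [(extChartAt (𝓡 n) p).left_inv hu.2] at h3
    exact h3

/-! #### The covariant derivative along a map -/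

/-- The curvature operator at `p`. -/
def cv (g : RMetric n M) (p : M) (a b c : EE n) : EE n :=
  rm (gramL g p) (extChartAt (𝓡 n) p p) a b c

lemma curvOp_eq_cv (g : RMetric n M) (p : M) (a b c : EE n) : curvOp g p a b c = cv g p a b c := by
  have hm := localMetric g p
  have h0 : extChartAt (𝓡 n) p p ∈ (extChartAt (𝓡 n) p).target := mem_extChartAt_target p
  have h1 : ∀ b c, (fun u ↦ christoffel g p u b c) =ᶠ[nhds (extChartAt (𝓡 n) p p)]
      fun u ↦ gam (gramL g p) u b c := by
    intro b c
    filter_upwards [hm.eventually_mem h0] with u hu using christoffel_eq g hu b c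
  have h2 : curvOp g p a b c = (fderiv ℝ (fun u ↦ christoffel g p u b c) (extChartAt (𝓡 n) p p) a
    - fderiv ℝ (fun u ↦ christoffel g p u a c) (extChartAt (𝓡 n) p p) b
    + christoffel g p (extChartAt (𝓡 n) p p) a (christoffel g p (extChartAt (𝓡 n) p p) b c)
    - christoffel g p (extChartAt (𝓡 n) p p) b (christoffel g p (extChartAt (𝓡 n) p p) a c) : EE n) :=
    rfl
  rw [h2, (h1 b c).fderiv_eq, (h1 a c).fderiv_eq, hm.fderiv_gam h0, hm.fderiv_gam h0]
  simp only [christoffel_eq g h0]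
  rfl

/-- The curvature at `q`, computed in the chart at `p`. -/
lemma tc_cv (g : RMetric n M) {p q : M} (hq : q ∈ (extChartAt (𝓡 n) p).source) (a b c : EE n) :
    tc p q (cv g q a b c) =
      rm (gramL g p) (extChartAt (𝓡 n) p q) (tc p q a) (tc p q b) (tc p q c) := by
  have hs := mem_extChartAt_source (I := 𝓡 n) q
  have h := LocalIsometry.rm_eq (localMetric g q) (localMetric g p) (localIsometry_trans g q p)
    (mem_transDom hs hq)
  have h2 := h (tc q q a) (tc q q b) (tc q q c)
  rw [fderiv_trans_tc hs hq, fderiv_trans_tc hs hq, fderiv_trans_tc hs hq, trans_chart hs] at h2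
  rw [h2, tc_self, tc_self, tc_self, ← cv]
  conv_rhs => rw [← tc_self q (cv g q a b c)]
  rw [fderiv_trans_tc hs hq]

lemma cv_antisymm (g : RMetric n M) (p : M) (a b c : EE n) : cv g p a b c = - cv g p b a c :=
  LocalMetric.rm_antisymm a b c

lemma cv_bianchi (g : RMetric n M) (p : M) (a b c : EE n) :
    cv g p a b c + cv g p b c a + cv g p c a b = 0 :=
  (localMetric g p).rm_bianchi (mem_extChartAt_target p) a b c

lemma ip_self_eq (g : RMetric n M) (p : M) (v w : EE n) :
    ip g p v w = gramL g p (extChartAt (𝓡 n) p p) v w := by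
  rw [ip_eq_gramL g (mem_extChartAt_source p), tc_self, tc_self]

lemma cv_skew (g : RMetric n M) (p : M) (a b c d : EE n) :
    ip g p (cv g p a b c) d = - ip g p (cv g p a b d) c := by
  have h := (localMetric g p).rm_skew (mem_extChartAt_target p) a b c d
  rw [← ip_self_eq, ← ip_self_eq, ip_symm g p c] at h
  exact eq_neg_of_add_eq_zero_left h

/-! ### Multilinearity and symmetries of the curvature tensor -/

section Linear
variable (g : RMetric n M) (p : M)

lemma gam_eq_gamL (u a b : EE n) : gam (gramL g p) u a b = gamL (gramL g p) u a b := rfl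

lemma cv_add_left (a a' b c : EE n) : cv g p (a + a') b c = cv g p a b c + cv g p a' b c := by
  simp only [cv, rm, gam_eq_gamL, map_add, add_apply]; abel

lemma cv_smul_left (r : ℝ) (a b c : EE n) : cv g p (r • a) b c = r • cv g p a b c := by
  simp only [cv, rm, gam_eq_gamL, map_smul, smul_apply, smul_sub, smul_add]

lemma cv_add_right (a b c c' : EE n) : cv g p a b (c + c') = cv g p a b c + cv g p a b c' := by
  simp only [cv, rm, gam_eq_gamL, map_add]; abel

lemma cv_smul_right (r : ℝ) (a b c : EE n) : cv g p a b (r • c) = r • cv g p a b c := by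
  simp only [cv, rm, gam_eq_gamL, map_smul, smul_sub, smul_add]

lemma cv_add_mid (a b b' c : EE n) : cv g p a (b + b') c = cv g p a b c + cv g p a b' c := by
  rw [cv_antisymm, cv_add_left, cv_antisymm g p b, cv_antisymm g p b']; abel

lemma cv_smul_mid (r : ℝ) (a b c : EE n) : cv g p a (r • b) c = r • cv g p a b c := by
  rw [cv_antisymm, cv_smul_left, cv_antisymm g p b, smul_neg, neg_neg]

/-- The curvature tensor `g(R(a, b) c, d)`. -/
def rt (a b c d : EE n) : ℝ := ip g p (cv g p a b c) d

/-- The octahedron argument: four Bianchi identities, combined with skew symmetry in each pair, add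
up to the exchange of the pairs. -/
lemma rt_pair (a b c d : EE n) : rt g p a b c d = rt g p c d a b := by
  have sk : ∀ a b c d, rt g p a b c d = - rt g p a b d c := fun a b c d ↦ cv_skew g p a b c d
  have an : ∀ a b c d, rt g p a b c d = - rt g p b a c d := by
    intro a b c d; rw [rt, rt, cv_antisymm, map_neg, neg_apply]
  have bi : ∀ a b c d, rt g p a b c d + rt g p b c a d + rt g p c a b d = 0 := by
    intro a b c d
    rw [rt, rt, rt, ← add_apply, ← add_apply, ← map_add, ← map_add,
      cv_bianchi, map_zero, zero_apply]
  linarith [bi a b c d, bi b c d a, bi c d a b, bi d a b c, sk a b c d, sk b c a d, sk c a b d,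
    sk b c d a, sk c d b a, sk d b c a, sk c d a b, sk d a c b, sk a c d b, sk d a b c, sk a b d c,
    sk b d a c, an a b c d, an b c a d, an c a b d, an a b d c, an b c d a, an c a d b,
    an c d a b, an d a b c, an b d a c, an b d c a, an d b c a, an d a c b]

end Linear

/-! ### Calculus of covariant derivatives along maps into the manifold -/

section Cov

variable {D : Type*} [NormedAddCommGroup D] [NormedSpace ℝ D]

/-- The covariant derivative `∇_e V` of a vector field `V` along a map `u`. -/
def cov (g : RMetric n M) (u : D → M) (V : D → EE n) (e z : D) : EE n :=
  fderiv ℝ (fun ζ ↦ tc (u z) (u ζ) (V ζ)) z e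
    + christoffel g (u z) (extChartAt (𝓡 n) (u z) (u z)) (du u e z) (V z)

/-- A smooth vector field along a smooth map. -/
def SmoothField (u : D → M) (V : D → EE n) : Prop :=
  ContMDiff 𝓘(ℝ, D) (𝓡 n).tangent ∞ (tb (n := n) u V)

variable {u : D → M} {V W : D → EE n}

lemma SmoothField.map (h : SmoothField u V) : ContMDiff 𝓘(ℝ, D) (𝓡 n) ∞ u :=
  fun z ↦ (contMDiffAt_totalSpace.1 (h z)).1

lemma SmoothField.contDiffAt (h : SmoothField u V) {p : M} {z : D}
    (hz : u z ∈ (extChartAt (𝓡 n) p).source) : ContDiffAt ℝ ∞ (fun ζ ↦ tc p (u ζ) (V ζ)) z :=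
  (field_iff (h.map z) hz).1 (h z)

lemma smoothField_of_local (hu : ContMDiff 𝓘(ℝ, D) (𝓡 n) ∞ u)
    (h : ∀ z, ContDiffAt ℝ ∞ (fun ζ ↦ tc (u z) (u ζ) (V ζ)) z) : SmoothField u V :=
  fun z ↦ (field_iff (hu z) (mem_extChartAt_source _)).2 (h z)

lemma smoothField_du (hu : ContMDiff 𝓘(ℝ, D) (𝓡 n) ∞ u) (e : D) :
    SmoothField (n := n) u (du u e) := fun z ↦ contMDiffAt_du (hu z) e

lemma SmoothField.add (hV : SmoothField u V) (hW : SmoothField u W) :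
    SmoothField u (fun z ↦ V z + W z) := by
  refine smoothField_of_local hV.map fun z ↦ ?_
  simp only [map_add]
  exact (hV.contDiffAt (mem_extChartAt_source _)).add (hW.contDiffAt (mem_extChartAt_source _))

lemma SmoothField.smul (hV : SmoothField u V) {φ : D → ℝ} (hφ : ContDiff ℝ ∞ φ) :
    SmoothField u (fun z ↦ φ z • V z) := by
  refine smoothField_of_local hV.map fun z ↦ ?_
  simp only [map_smul]
  exact hφ.contDiffAt.smul (hV.contDiffAt (mem_extChartAt_source _))

lemma SmoothField.ip (g : RMetric n M) (hV : SmoothField u V) (hW : SmoothField u W) :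
    ContDiff ℝ ∞ (fun z ↦ ip g (u z) (V z) (W z)) :=
  contDiff_iff_contDiffAt.2 fun z ↦ (contMDiffAt_ip g (hV z) (hW z)).contDiffAt

variable (g : RMetric n M)

/-- The covariant derivative, computed in the chart at `p`. -/
lemma tc_cov {p : M} {z : D} (hV : SmoothField u V) (hz : u z ∈ (extChartAt (𝓡 n) p).source)
    (e : D) : tc p (u z) (cov g u V e z) =
      covL (gramL g p) (fun ζ ↦ extChartAt (𝓡 n) p (u ζ)) (fun ζ ↦ tc p (u ζ) (V ζ)) e z := by
  have hu := hV.map z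
  have hs := mem_extChartAt_source (I := 𝓡 n) (u z)
  have hsn : ∀ᶠ ζ in nhds z, u ζ ∈ (extChartAt (𝓡 n) (u z)).source :=
    hu.continuousAt.preimage_mem_nhds (source_mem_nhds' hs)
  have hpn : ∀ᶠ ζ in nhds z, u ζ ∈ (extChartAt (𝓡 n) p).source :=
    hu.continuousAt.preimage_mem_nhds (source_mem_nhds' hz)
  have h1 : cov g u V e z = covL (gramL g (u z)) (fun ζ ↦ extChartAt (𝓡 n) (u z) (u ζ))
      (fun ζ ↦ tc (u z) (u ζ) (V ζ)) e z := by
    rw [cov, covL, christoffel_eq g (mem_extChartAt_target _),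
      ← tc_du (hu.mdifferentiableAt (by simp)) hs, tc_self, tc_self]
  -- `cov` is defined in the chart at `u z`, which moves with `z`; transport to a fixed chart at `p`
  -- is what allows it to be differentiated again.
  have h2 := LocalIsometry.covL_eq (localMetric g (u z)) (localMetric g p)
    (localIsometry_trans g (u z) p) (c := fun ζ ↦ extChartAt (𝓡 n) (u z) (u ζ))
    (v := fun ζ ↦ tc (u z) (u ζ) (V ζ)) (z := z) (mem_transDom hs hz)
    ((contDiffAt_chart_comp hu hs).differentiableAt (by simp))
    ((hV.contDiffAt hs).differentiableAt (by simp)) e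
  rw [← h1] at h2
  have h3 := fderiv_trans_tc hs hz (cov g u V e z)
  rw [tc_self] at h3
  rw [h3] at h2
  rw [← h2]
  have h4 : (fun ζ ↦ trans (u z) p (extChartAt (𝓡 n) (u z) (u ζ))) =ᶠ[nhds z]
      fun ζ ↦ extChartAt (𝓡 n) p (u ζ) := by
    filter_upwards [hsn] with ζ hζ using trans_chart hζ
  have h5 : (fun ζ ↦ fderiv ℝ (trans (u z) p) (extChartAt (𝓡 n) (u z) (u ζ))
      (tc (u z) (u ζ) (V ζ))) =ᶠ[nhds z] fun ζ ↦ tc p (u ζ) (V ζ) := by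
    filter_upwards [hsn, hpn] with ζ h h' using fderiv_trans_tc h h' _
  rw [covL_congr_map h4, covL_congr h5]

lemma SmoothField.cov (hV : SmoothField u V) (e : D) : SmoothField u (cov g u V e) := by
  refine smoothField_of_local hV.map fun z ↦ ?_
  have hu := hV.map z
  have hs := mem_extChartAt_source (I := 𝓡 n) (u z)
  have hc := contDiffAt_chart_comp hu hs
  have hv := hV.contDiffAt hs
  have h1 : ContDiffAt ℝ ∞ (fun ζ ↦ covL (gramL g (u z)) (fun ζ ↦ extChartAt (𝓡 n) (u z) (u ζ))
      (fun ζ ↦ tc (u z) (u ζ) (V ζ)) e ζ) z := by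
    have hΓ : ContDiffAt ℝ ∞ (fun ζ ↦ gamL (gramL g (u z)) (extChartAt (𝓡 n) (u z) (u ζ))) z :=
      ContDiffAt.comp (g := gamL (gramL g (u z))) z
        ((localMetric g (u z)).contDiffAt_gamL (mem_extChartAt_target _)) hc
    exact ((hv.fderiv_right (by simp)).clm_apply contDiffAt_const).add
      ((hΓ.clm_apply ((hc.fderiv_right (by simp)).clm_apply contDiffAt_const)).clm_apply hv)
  refine h1.congr_of_eventuallyEq ?_
  filter_upwards [hu.continuousAt.preimage_mem_nhds (source_mem_nhds' hs)] with ζ hζ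
  exact tc_cov g hV hζ e

lemma fderiv_ip (hV : SmoothField u V) (hW : SmoothField u W) (e z : D) :
    fderiv ℝ (fun ζ ↦ ip g (u ζ) (V ζ) (W ζ)) z e
      = ip g (u z) (cov g u V e z) (W z) + ip g (u z) (V z) (cov g u W e z) := by
  have hu := hV.map z
  have hs := mem_extChartAt_source (I := 𝓡 n) (u z)
  have h1 : (fun ζ ↦ ip g (u ζ) (V ζ) (W ζ)) =ᶠ[nhds z] fun ζ ↦
      gramL g (u z) (extChartAt (𝓡 n) (u z) (u ζ)) (tc (u z) (u ζ) (V ζ)) (tc (u z) (u ζ) (W ζ)) := by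
    filter_upwards [hu.continuousAt.preimage_mem_nhds (source_mem_nhds' hs)] with ζ hζ
    exact ip_eq_gramL g hζ _ _
  rw [h1.fderiv_eq, (localMetric g (u z)).fderiv_inner (c := fun ζ ↦ extChartAt (𝓡 n) (u z) (u ζ))
    (mem_extChartAt_target _)
    ((contDiffAt_chart_comp hu hs).differentiableAt (by simp))
    ((hV.contDiffAt hs).differentiableAt (by simp)) ((hW.contDiffAt hs).differentiableAt (by simp)),
    ← tc_cov g hV hs, ← tc_cov g hW hs, ← ip_eq_gramL g hs, ← ip_eq_gramL g hs]

lemma tc_injective {p q : M} (hq : q ∈ (extChartAt (𝓡 n) p).source) {a b : EE n}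
    (h : tc p q a = tc p q b) : a = b := by
  rw [← ct_tc hq a, h, ct_tc hq]

/-- The Levi-Civita connection is torsion free. -/
lemma cov_du_symm (hu : ContMDiff 𝓘(ℝ, D) (𝓡 n) ∞ u) (e e' z : D) :
    cov g u (du u e') e z = cov g u (du u e) e' z := by
  have hs := mem_extChartAt_source (I := 𝓡 n) (u z)
  apply tc_injective hs
  have h : ∀ e : D, (fun ζ ↦ tc (u z) (u ζ) (du u e ζ)) =ᶠ[nhds z]
      fun ζ ↦ fderiv ℝ (fun ζ ↦ extChartAt (𝓡 n) (u z) (u ζ)) ζ e := by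
    intro e
    filter_upwards [(hu z).continuousAt.preimage_mem_nhds (source_mem_nhds' hs)] with ζ hζ
    exact tc_du ((hu ζ).mdifferentiableAt (by simp)) hζ e
  rw [tc_cov g (smoothField_du hu e') hs, tc_cov g (smoothField_du hu e) hs, covL_congr (h e'),
    covL_congr (h e)]
  exact (localMetric g (u z)).covL_torsion
    (c := fun ζ ↦ extChartAt (𝓡 n) (u z) (u ζ)) (mem_extChartAt_target _)
    (contDiffAt_chart_comp (hu z) hs) e e'

/-- Covariant derivatives commute up to curvature. -/
lemma cov_commutator (hV : SmoothField u V) (e e' z : D) :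
    cov g u (cov g u V e') e z - cov g u (cov g u V e) e' z
      = cv g (u z) (du u e z) (du u e' z) (V z) := by
  have hu := hV.map
  have hs := mem_extChartAt_source (I := 𝓡 n) (u z)
  apply tc_injective hs
  have h : ∀ e : D, (fun ζ ↦ tc (u z) (u ζ) (cov g u V e ζ)) =ᶠ[nhds z]
      covL (gramL g (u z)) (fun ζ ↦ extChartAt (𝓡 n) (u z) (u ζ))
        (fun ζ ↦ tc (u z) (u ζ) (V ζ)) e := by
    intro e
    filter_upwards [(hu z).continuousAt.preimage_mem_nhds (source_mem_nhds' hs)] with ζ hζ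
    exact tc_cov g hV hζ e
  rw [map_sub, tc_cov g (hV.cov g e') hs, tc_cov g (hV.cov g e) hs, covL_congr (h e'),
    covL_congr (h e), (localMetric g (u z)).covL_commutator
    (c := fun ζ ↦ extChartAt (𝓡 n) (u z) (u ζ)) (mem_extChartAt_target _)
    (contDiffAt_chart_comp (hu z) hs) (hV.contDiffAt hs), tc_cv g hs,
    tc_du ((hu z).mdifferentiableAt (by simp)) hs, tc_du ((hu z).mdifferentiableAt (by simp)) hs]

lemma cov_add (hV : SmoothField u V) (hW : SmoothField u W) (e z : D) :
    cov g u (fun ζ ↦ V ζ + W ζ) e z = cov g u V e z + cov g u W e z := by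
  have hs := mem_extChartAt_source (I := 𝓡 n) (u z)
  have h0 : extChartAt (𝓡 n) (u z) (u z) ∈ (extChartAt (𝓡 n) (u z)).target := mem_extChartAt_target _
  simp only [cov, map_add, christoffel_eq g h0, gam_eq_gamL]
  rw [fderiv_fun_add ((hV.contDiffAt hs).differentiableAt (by simp))
    ((hW.contDiffAt hs).differentiableAt (by simp)), add_apply]
  abel

lemma cov_smul {φ : D → ℝ} (hφ : ContDiff ℝ ∞ φ) (hV : SmoothField u V) (e z : D) :
    cov g u (fun ζ ↦ φ ζ • V ζ) e z = fderiv ℝ φ z e • V z + φ z • cov g u V e z := by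
  have hs := mem_extChartAt_source (I := 𝓡 n) (u z)
  have h0 : extChartAt (𝓡 n) (u z) (u z) ∈ (extChartAt (𝓡 n) (u z)).target := mem_extChartAt_target _
  simp only [cov, map_smul, christoffel_eq g h0, gam_eq_gamL]
  rw [fderiv_fun_smul (hφ.differentiable (by simp) z) ((hV.contDiffAt hs).differentiableAt (by simp))]
  simp [tc_self]
  abel

lemma cov_congr {z : D} (h : V =ᶠ[nhds z] W) (e : D) : cov g u V e z = cov g u W e z := by
  have h1 : (fun ζ ↦ tc (u z) (u ζ) (V ζ)) =ᶠ[nhds z] fun ζ ↦ tc (u z) (u ζ) (W ζ) := by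
    filter_upwards [h] with ζ hζ; rw [hζ]
  rw [cov, cov, h1.fderiv_eq, h.self_of_nhds]

/-- The curvature applied to smooth vector fields along a map. -/
lemma SmoothField.cv {A B C : D → EE n} (hA : SmoothField u A) (hB : SmoothField u B)
    (hC : SmoothField u C) : SmoothField u (fun z ↦ cv g (u z) (A z) (B z) (C z)) := by
  refine smoothField_of_local hA.map fun z ↦ ?_
  have hu := hA.map z
  have hs := mem_extChartAt_source (I := 𝓡 n) (u z)
  have hc := contDiffAt_chart_comp hu hs
  have ha := hA.contDiffAt hs
  have hb := hB.contDiffAt hs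
  have hcc := hC.contDiffAt hs
  have hm := localMetric g (u z)
  have h0 : extChartAt (𝓡 n) (u z) (u z) ∈ (extChartAt (𝓡 n) (u z)).target := mem_extChartAt_target _
  have hΓ : ContDiffAt ℝ ∞ (fun ζ ↦ gamL (gramL g (u z)) (extChartAt (𝓡 n) (u z) (u ζ))) z :=
    ContDiffAt.comp (g := gamL (gramL g (u z))) z (hm.contDiffAt_gamL h0) hc
  have hDΓ : ContDiffAt ℝ ∞
      (fun ζ ↦ fderiv ℝ (gamL (gramL g (u z))) (extChartAt (𝓡 n) (u z) (u ζ))) z :=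
    ((hm.contDiffAt_gamL h0).fderiv_right (m := ∞) (by simp)).comp z hc
  have h1 : ContDiffAt ℝ ∞ (fun ζ ↦ rm (gramL g (u z)) (extChartAt (𝓡 n) (u z) (u ζ))
      (tc (u z) (u ζ) (A ζ)) (tc (u z) (u ζ) (B ζ)) (tc (u z) (u ζ) (C ζ))) z :=
    (((((hDΓ.clm_apply ha).clm_apply hb).clm_apply hcc).sub
      (((hDΓ.clm_apply hb).clm_apply ha).clm_apply hcc)).add
      ((hΓ.clm_apply ha).clm_apply ((hΓ.clm_apply hb).clm_apply hcc))).sub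
      ((hΓ.clm_apply hb).clm_apply ((hΓ.clm_apply ha).clm_apply hcc))
  refine h1.congr_of_eventuallyEq ?_
  filter_upwards [hu.continuousAt.preimage_mem_nhds (source_mem_nhds' hs)] with ζ hζ
  exact tc_cv g hζ _ _ _

/-- Covariant derivatives of the restriction to an affine subspace. -/
lemma cov_comp {D' : Type*} [NormedAddCommGroup D'] [NormedSpace ℝ D'] (hV : SmoothField u V)
    {ι : D' → D} {L : D' →L[ℝ] D} {z : D'} (hι : HasFDerivAt ι L z) (e : D') :
    cov g (fun ζ ↦ u (ι ζ)) (fun ζ ↦ V (ι ζ)) e z = cov g u V (L e) (ι z) := by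
  have hs := mem_extChartAt_source (I := 𝓡 n) (u (ι z))
  have h1 : HasFDerivAt (fun ζ ↦ tc (u (ι z)) (u (ι ζ)) (V (ι ζ))) _ z :=
    ((hV.contDiffAt hs).differentiableAt (by simp)).hasFDerivAt.comp z hι
  have h2 : du (n := n) (fun ζ ↦ u (ι ζ)) e z = du u (L e) (ι z) := by
    have h3 := HasMFDerivAt.comp z ((hV.map (ι z)).mdifferentiableAt (by simp)).hasMFDerivAt
      hι.hasMFDerivAt
    rw [du, du]
    exact congrArg (fun T ↦ T e) h3.mfderiv
  rw [cov, cov, h1.fderiv, h2]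
  rfl

end Cov

end GlobalConnection

/-! ### Analysis in the plane -/

section Plane

open Complex Set

/-- A divergence with compact support has integral zero. -/
lemma integral_fderiv_apply_eq_zero {X : ℂ → ℝ} (hX : ContDiff ℝ 1 X) (hc : HasCompactSupport X)
    (v : ℂ) : ∫ z, fderiv ℝ X z v = 0 := by
  -- Integration by parts against the constant function `1`.
  have h := integral_mul_fderiv_eq_neg_fderiv_mul_of_integrable (μ := volume) (𝕜 := ℝ)
    (f := fun _ : ℂ ↦ (1 : ℝ)) (g := X) (v := v) (by simp)
    (by
      simp only [one_mul]
      exact ((hX.continuous_fderiv (by simp)).clm_apply continuous_const).integrable_of_hasCompactSupport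
        (hc.fderiv_apply (𝕜 := ℝ) v))
    (by simpa using hX.continuous.integrable_of_hasCompactSupport hc)
    (fun _ _ ↦ differentiableAt_const _) (fun x _ ↦ hX.differentiable (by simp) x)
  simpa using h

/-- The operator `∂_x + i ∂_y = 2 ∂_z̄`. -/
def dbar (h : ℂ → ℂ) (z : ℂ) : ℂ := fderiv ℝ h z 1 + I * fderiv ℝ h z I

/-- The unit vector with angle `θ`. -/
def dir (θ : ℝ) : ℂ := Real.cos θ + Real.sin θ * I

lemma continuous_dir : Continuous dir := by
  unfold dir; fun_prop

lemma hasDerivAt_dir (θ : ℝ) : HasDerivAt dir (I * dir θ) θ := by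
  have h1 : HasDerivAt (fun t : ℝ ↦ ((Real.cos t : ℝ) : ℂ)) ((-Real.sin θ : ℝ) : ℂ) θ :=
    (Real.hasDerivAt_cos θ).ofReal_comp
  have h2 : HasDerivAt (fun t : ℝ ↦ ((Real.sin t : ℝ) : ℂ)) ((Real.cos θ : ℝ) : ℂ) θ :=
    (Real.hasDerivAt_sin θ).ofReal_comp
  convert! h1.add (h2.mul_const I) using 1
  simp only [dir]
  push_cast
  ring_nf
  rw [I_sq]; ring

lemma norm_dir (θ : ℝ) : ‖dir θ‖ = 1 := by
  have : dir θ = exp (θ * I) := by rw [exp_mul_I, dir]; simp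
  rw [this, norm_exp_ofReal_mul_I]

lemma dir_ne_zero (θ : ℝ) : dir θ ≠ 0 := by
  rw [← norm_ne_zero_iff, norm_dir]; norm_num

/-- Rotating the frame `(1, I)` by the angle `θ` multiplies `∂_x + i ∂_y` by `e^{-iθ}`. In polar
coordinates this factor is what remains of `w⁻¹` after multiplication by the Jacobian `r`. -/
lemma fderiv_dir (γ : ℂ → ℂ) (w : ℂ) (θ : ℝ) :
    fderiv ℝ γ w (dir θ) + I * fderiv ℝ γ w (I * dir θ) = dbar γ w * (dir θ)⁻¹ := by
  have h1 : dir θ = Real.cos θ • (1 : ℂ) + Real.sin θ • I := by simp [dir]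
  have h2 : I * dir θ = (-Real.sin θ) • (1 : ℂ) + Real.cos θ • I := by
    simp only [dir, real_smul]; push_cast; ring_nf; rw [I_sq]; ring
  rw [eq_mul_inv_iff_mul_eq₀ (dir_ne_zero θ), h2]
  nth_rw 1 [h1]
  have hl : ∀ c s : ℝ, fderiv ℝ γ w (c • (1 : ℂ) + s • I)
      = c * fderiv ℝ γ w 1 + s * fderiv ℝ γ w I := by
    intro c s
    rw [map_add, ContinuousLinearMap.map_smul, ContinuousLinearMap.map_smul, real_smul, real_smul]
  have h3 : (Real.cos θ : ℂ) ^ 2 + (Real.sin θ) ^ 2 = 1 := by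
    exact_mod_cast Real.cos_sq_add_sin_sq θ
  rw [hl, hl, dbar, dir]
  generalize fderiv ℝ γ w 1 = a
  generalize fderiv ℝ γ w I = b
  push_cast at h3 ⊢
  linear_combination (a + I * b) * h3 +
    (-(sin θ : ℂ) ^ 2 * a + (cos θ : ℂ) * sin θ * b) * I_sq

/-- The Cauchy-Pompeiu formula for functions with compact support. -/
lemma integral_dbar_mul_inv {γ : ℂ → ℂ} (hγ : ContDiff ℝ 1 γ) (hc : HasCompactSupport γ) :
    ∫ w, dbar γ w * w⁻¹ = - (2 * Real.pi) * γ 0 := by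
  obtain ⟨R, hR⟩ := hc.isBounded.subset_closedBall (0 : ℂ)
  have hR0 : ∀ w : ℂ, R < ‖w‖ → w ∉ tsupport γ := by
    intro w hw hm
    have := hR hm
    rw [mem_closedBall_zero_iff] at this
    linarith
  have hDγ : Continuous (fderiv ℝ γ) := hγ.continuous_fderiv (by simp)
  have hD0 : ∀ w : ℂ, R < ‖w‖ → fderiv ℝ γ w = 0 := fun w hw ↦
    image_eq_zero_of_notMem_tsupport fun h ↦ hR0 w hw (tsupport_fderiv_subset ℝ h)
  have hγ0 : ∀ w : ℂ, R < ‖w‖ → γ w = 0 := fun w hw ↦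
    image_eq_zero_of_notMem_tsupport (hR0 w hw)
  let P : ℝ × ℝ → ℂ := fun p ↦ p.1 * dir p.2
  have hPc : Continuous P := by
    have := continuous_dir
    fun_prop
  have hPn : ∀ p, ‖P p‖ = |p.1| := fun p ↦ by simp [P, norm_dir]
  -- In polar coordinates the integrand becomes `A + i B`, with `A` the radial derivative of `γ` and
  -- `B` its angular derivative divided by `r`. Along each ray `A` integrates to `-γ 0`, and over
  -- each circle `B` integrates to `0` by periodicity.
  let A : ℝ × ℝ → ℂ := fun p ↦ fderiv ℝ γ (P p) (dir p.2)
  let B : ℝ × ℝ → ℂ := fun p ↦ fderiv ℝ γ (P p) (I * dir p.2)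
  have hdir2 : Continuous fun p : ℝ × ℝ ↦ dir p.2 := continuous_dir.comp continuous_snd
  have hA : Continuous A := (hDγ.comp hPc).clm_apply hdir2
  have hB : Continuous B := (hDγ.comp hPc).clm_apply (continuous_const.mul hdir2)
  have hint : ∀ F : ℝ × ℝ → ℂ, Continuous F → (∀ p : ℝ × ℝ, R < |p.1| → F p = 0) →
      IntegrableOn F (Ioi (0 : ℝ) ×ˢ Ioo (-Real.pi) Real.pi) (volume.prod volume) := by
    intro F hF h0
    have h1 : IntegrableOn F (Icc (0 : ℝ) R ×ˢ Icc (-Real.pi) Real.pi) (volume.prod volume) :=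
      hF.continuousOn.integrableOn_compact (isCompact_Icc.prod isCompact_Icc)
    have h2 : IntegrableOn F ((Icc (0 : ℝ) R ×ˢ Icc (-Real.pi) Real.pi) ∩
        (Ioi (0 : ℝ) ×ˢ Ioo (-Real.pi) Real.pi)) (volume.prod volume) :=
      h1.mono_set inter_subset_left
    refine h2.of_forall_sdiff_eq_zero (measurableSet_Ioi.prod measurableSet_Ioo) ?_
    rintro ⟨r, θ⟩ ⟨⟨hr, hθ⟩, hn⟩
    apply h0
    by_contra hle
    push Not at hle
    exact hn ⟨⟨⟨le_of_lt hr, (le_abs_self r).trans hle⟩, Ioo_subset_Icc_self hθ⟩, hr, hθ⟩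
  have hIA := hint A hA fun p hp ↦ by simp only [A]; rw [hD0 _ (by rwa [hPn])]; simp
  have hIB := hint B hB fun p hp ↦ by simp only [B]; rw [hD0 _ (by rwa [hPn])]; simp
  have hAval : ∫ p in Ioi (0 : ℝ) ×ˢ Ioo (-Real.pi) Real.pi, A p = - (2 * Real.pi) * γ 0 := by
    have h1 : ∀ θ : ℝ, ∫ r in Ioi (0 : ℝ), A (r, θ) = - γ 0 := by
      intro θ
      have hd : ∀ r : ℝ, HasDerivAt (fun r : ℝ ↦ γ (r * dir θ)) (A (r, θ)) r := by
        intro r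
        have h2 : HasDerivAt (fun r : ℝ ↦ (r : ℂ) * dir θ) (dir θ) r := by
          simpa using (ofRealCLM.hasDerivAt (x := r)).mul_const (dir θ)
        exact ((hγ.differentiable (by simp) _).hasFDerivAt).comp_hasDerivAt r h2
      have hcs : HasCompactSupport fun r : ℝ ↦ γ (r * dir θ) := by
        apply HasCompactSupport.intro (isCompact_Icc (a := -R) (b := R))
        intro r hr
        apply hγ0
        rw [norm_mul, norm_dir, mul_one, norm_real, Real.norm_eq_abs]
        by_contra hle
        push Not at hle
        exact hr (abs_le.1 hle)
      have hC1 : ContDiff ℝ 1 fun r : ℝ ↦ γ (r * dir θ) :=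
        hγ.comp (ofRealCLM.contDiff.mul contDiff_const)
      have h3 := hcs.integral_Ioi_deriv_eq hC1 0
      have h4 : deriv (fun r : ℝ ↦ γ (r * dir θ)) = fun r ↦ A (r, θ) :=
        funext fun r ↦ (hd r).deriv
      rw [h4] at h3
      simpa using h3
    rw [Measure.volume_eq_prod, ← Measure.prod_restrict, integral_prod_symm _
      (by rw [Measure.prod_restrict]; exact hIA)]
    simp only [h1]
    rw [setIntegral_const]
    simp [Measure.real, Real.volume_Ioo]
    left
    rw [ENNReal.toReal_ofReal (by positivity)]
    push_cast
    ring
  have hBval : ∫ p in Ioi (0 : ℝ) ×ˢ Ioo (-Real.pi) Real.pi, B p = 0 := by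
    rw [Measure.volume_eq_prod, setIntegral_prod _ hIB]
    apply integral_eq_zero_of_ae
    filter_upwards [ae_restrict_mem measurableSet_Ioi] with r hr
    have hr' : (r : ℂ) ≠ 0 := by exact_mod_cast (ne_of_gt hr)
    have hd : ∀ θ : ℝ, HasDerivAt (fun θ : ℝ ↦ (r : ℂ)⁻¹ * γ (r * dir θ)) (B (r, θ)) θ := by
      intro θ
      have h2 := (hasDerivAt_dir θ).const_mul (r : ℂ)
      have h3 := (((hγ.differentiable (by simp) ((r : ℂ) * dir θ)).hasFDerivAt).comp_hasDerivAt θ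
        h2).const_mul ((r : ℂ)⁻¹)
      have h5 : (r : ℂ) * (I * dir θ) = r • (I * dir θ) := by simp
      rw [h5, map_smul, real_smul, inv_mul_cancel_left₀ hr'] at h3
      exact h3
    have hBr : Continuous fun θ ↦ B (r, θ) := hB.comp (by fun_prop)
    have h3 := intervalIntegral.integral_eq_sub_of_hasDerivAt (a := -Real.pi) (b := Real.pi)
      (fun θ _ ↦ hd θ) (hBr.intervalIntegrable _ _)
    rw [intervalIntegral.integral_of_le (by linarith [Real.pi_pos]), integral_Ioc_eq_integral_Ioo]
      at h3
    rw [h3]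
    simp [dir]
  rw [← Complex.integral_comp_polarCoord_symm]
  have hcongr : ∫ p in polarCoord.target, p.1 • (dbar γ (Complex.polarCoord.symm p) *
      (Complex.polarCoord.symm p)⁻¹) = ∫ p in Ioi (0 : ℝ) ×ˢ Ioo (-Real.pi) Real.pi,
        (A p + I * B p) := by
    rw [polarCoord_target]
    apply setIntegral_congr_fun (measurableSet_Ioi.prod measurableSet_Ioo)
    rintro ⟨r, θ⟩ ⟨hr, -⟩
    have hr' : (r : ℂ) ≠ 0 := by exact_mod_cast (ne_of_gt hr)
    have hP : Complex.polarCoord.symm (r, θ) = P (r, θ) := by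
      rw [Complex.polarCoord_symm_apply]; simp [P, dir]
    simp only [hP, A, B]
    rw [fderiv_dir, real_smul]
    simp only [P, mul_inv]
    field_simp
  rw [hcongr, integral_add (by rw [Measure.volume_eq_prod]; exact hIA)
    (by rw [Measure.volume_eq_prod]; exact hIB.const_mul I), hAval, integral_const_mul, hBval]
  simp

/-- The function `1 / |w|` is integrable on balls of the plane. -/
lemma integrableOn_inv_norm (R : ℝ) : IntegrableOn (fun w : ℂ ↦ ‖w‖⁻¹) (Metric.ball 0 R) := by
  have h : Integrable (fun w : ℂ ↦ (Iio R).indicator (fun r : ℝ ↦ r⁻¹) ‖w‖) := by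
    rw [integrable_fun_norm_addHaar volume]
    have h1 : IntegrableOn (fun _ : ℝ ↦ (1 : ℝ)) (Ioo 0 R) := integrableOn_const (by simp) 
    have h2 : IntegrableOn ((Iio R).indicator fun _ : ℝ ↦ (1 : ℝ)) (Ioi 0) := by
      rw [IntegrableOn, integrable_indicator_iff measurableSet_Iio, IntegrableOn,
        Measure.restrict_restrict measurableSet_Iio, inter_comm, Ioi_inter_Iio]
      exact h1
    refine h2.congr_fun ?_ measurableSet_Ioi
    intro r hr
    have hr' : r ≠ 0 := ne_of_gt hr
    simp only [indicator, finrank_real_complex]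
    split_ifs <;> simp [hr']
  rw [← integrable_indicator_iff Metric.isOpen_ball.measurableSet]
  refine h.congr (Filter.Eventually.of_forall fun w ↦ ?_)
  simp [indicator]

lemma locallyIntegrable_inv : LocallyIntegrable (fun w : ℂ ↦ w⁻¹) := by
  rw [locallyIntegrable_iff]
  intro k hk
  obtain ⟨R, hR⟩ := hk.isBounded.subset_ball (0 : ℂ)
  have h := (integrableOn_inv_norm R).mono_set hR
  refine Integrable.mono' h (measurable_inv.aestronglyMeasurable) ?_
  exact Filter.Eventually.of_forall fun w ↦ by simp

/-- The Cauchy-Pompeiu formula, at an arbitrary point. -/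
lemma integral_dbar_mul_inv_sub {γ : ℂ → ℂ} (hγ : ContDiff ℝ 1 γ) (hc : HasCompactSupport γ)
    (z : ℂ) : ∫ w, dbar γ w * (z - w)⁻¹ = (2 * Real.pi) * γ z := by
  let γ' : ℂ → ℂ := fun w ↦ γ (w + z)
  have h1 : ContDiff ℝ 1 γ' := hγ.comp (contDiff_id.add contDiff_const)
  have h2 : HasCompactSupport γ' := hc.comp_homeomorph (Homeomorph.addRight z)
  have h3 : ∀ w, dbar γ' w = dbar γ (w + z) := by
    intro w
    simp only [dbar, γ']
    rw [fderiv_comp_add_right]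
  have h4 := integral_dbar_mul_inv h1 h2
  simp only [h3] at h4
  have h5 := integral_add_right_eq_self (fun w ↦ dbar γ w * (w - z)⁻¹) z (μ := volume)
  simp only [add_sub_cancel_right] at h5
  have h6 : ∀ w, dbar γ w * (z - w)⁻¹ = - (dbar γ w * (w - z)⁻¹) := by
    intro w
    rw [← neg_sub w z, inv_neg]; ring
  simp only [h6]
  rw [integral_neg]; rw [← h5, h4]
  simp [γ']

/-- The inhomogeneous Cauchy-Riemann equation has a bounded solution. -/
theorem exists_dbar_eq {β : ℂ → ℂ} (hβ : ContDiff ℝ ∞ β) (hc : HasCompactSupport β) :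
    ∃ h : ℂ → ℂ, ContDiff ℝ ∞ h ∧ (∀ z, dbar h z = β z) ∧ ∃ C, ∀ z, ‖h z‖ ≤ C := by
  -- The fundamental solution of `∂_x + i ∂_y`. In the convolution `β * k` the derivatives fall on
  -- `β`, and the Cauchy-Pompeiu formula returns `β`.
  let k : ℂ → ℂ := fun w ↦ (2 * Real.pi : ℂ)⁻¹ * w⁻¹
  have hk : LocallyIntegrable k := locallyIntegrable_inv.smul ((2 * Real.pi : ℂ)⁻¹)
  let L := ContinuousLinearMap.mul ℝ ℂ
  let h : ℂ → ℂ := convolution β k L volume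
  have hβ1 : ContDiff ℝ 1 β := hβ.of_le (WithTop.coe_le_coe.2 le_top)
  have hd : ∀ z v, fderiv ℝ h z v = ∫ w, fderiv ℝ β w v * k (z - w) := by
    intro z v
    have h1 := hc.hasFDerivAt_convolution_left (μ := volume) L hβ1 hk z
    rw [h1.fderiv, convolution_def]
    rw [ContinuousLinearMap.integral_apply]
    · rfl
    · exact (hc.fderiv (𝕜 := ℝ)).convolutionExists_left (ContinuousLinearMap.precompL ℂ L)
        (hβ1.continuous_fderiv (by simp)) hk z
  have hi : ∀ z v, Integrable fun w ↦ fderiv ℝ β w v * k (z - w) := fun z v ↦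
    (hc.fderiv_apply (𝕜 := ℝ) v).convolutionExists_left L
      ((hβ1.continuous_fderiv (by simp)).clm_apply continuous_const) hk z
  refine ⟨h, hc.contDiff_convolution_left L hβ hk, fun z ↦ ?_, ?_⟩
  · rw [dbar, hd, hd, ← integral_const_mul, ← integral_add (hi z 1) ((hi z I).const_mul I)]
    have h2 : ∀ w, fderiv ℝ β w 1 * k (z - w) + I * (fderiv ℝ β w I * k (z - w))
        = (2 * Real.pi : ℂ)⁻¹ * (dbar β w * (z - w)⁻¹) := by
      intro w; simp only [k, dbar]; ring
    simp only [h2]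
    rw [integral_const_mul, integral_dbar_mul_inv_sub hβ1 hc]
    have : (2 * Real.pi : ℂ) ≠ 0 := by simp [Real.pi_ne_zero]
    field_simp
  · obtain ⟨S, hS⟩ := hβ.continuous.bounded_above_of_compact_support hc
    have hS0 : 0 ≤ S := (norm_nonneg _).trans (hS 0)
    have hI1 : Integrable (fun w : ℂ ↦ (Metric.ball (0 : ℂ) 1).indicator (fun w ↦ ‖w‖⁻¹) w) :=
      (integrable_indicator_iff Metric.isOpen_ball.measurableSet).2 (integrableOn_inv_norm 1)
    have hI2 : Integrable (fun w ↦ ‖β w‖) :=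
      (hβ.continuous.integrable_of_hasCompactSupport hc).norm
    -- The kernel is split at distance `1`: inside it is integrable and `β` is bounded by `S`,
    -- outside it is at most `1` and `β` is integrable. The resulting bound does not depend on `z`.
    have hpt : ∀ z w : ℂ, ‖β w * (z - w)⁻¹‖ ≤
        S * (Metric.ball (0 : ℂ) 1).indicator (fun w ↦ ‖w‖⁻¹) (z - w) + ‖β w‖ := by
      intro z w
      rw [norm_mul, norm_inv]
      by_cases hw : z - w ∈ Metric.ball (0 : ℂ) 1
      · rw [indicator_of_mem hw]
        have := mul_le_mul_of_nonneg_right (hS w) (inv_nonneg.2 (norm_nonneg (z - w)))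
        linarith [norm_nonneg (β w)]
      · rw [indicator_of_notMem hw]
        rw [mem_ball_zero_iff, not_lt] at hw
        have := mul_le_mul_of_nonneg_left (inv_le_one_of_one_le₀ hw) (norm_nonneg (β w))
        linarith
    refine ⟨‖(2 * Real.pi : ℂ)⁻¹‖ * (S * (∫ w : ℂ, (Metric.ball (0 : ℂ) 1).indicator
      (fun w ↦ ‖w‖⁻¹) w) + ∫ w, ‖β w‖), fun z ↦ ?_⟩
    have h1 : h z = (2 * Real.pi : ℂ)⁻¹ * ∫ w, β w * (z - w)⁻¹ := by
      rw [← integral_const_mul]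
      simp only [h, convolution_def]
      congr 1
      funext w
      simp only [L, k, ContinuousLinearMap.mul_apply']
      ring
    rw [h1, norm_mul]
    gcongr
    have hI3 := hI1.comp_sub_left z
    refine (norm_integral_le_of_norm_le ((hI3.const_mul S).add hI2)
      (Filter.Eventually.of_forall (hpt z))).trans ?_
    simp only [Pi.add_apply]
    rw [integral_add (hI3.const_mul S) hI2, integral_const_mul,
      integral_sub_left_eq_self (fun w ↦ (Metric.ball (0 : ℂ) 1).indicator (fun w ↦ ‖w‖⁻¹) w)]

end Plane

/-! ### Cutoff functions of small energy -/

section Cutoff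

open Complex Set

/-- The squared length of the gradient. -/
def gradSq (χ : ℂ → ℝ) (z : ℂ) : ℝ := fderiv ℝ χ z 1 ^ 2 + fderiv ℝ χ z I ^ 2

/-- A smooth function which is `1` on the ball of radius `R` and vanishes outside of the ball of
radius `2 R`. -/
def cut (R : ℝ) (z : ℂ) : ℝ := (⟨1, 2, by norm_num, by norm_num⟩ : ContDiffBump (0 : ℂ)) (R⁻¹ • z)

lemma contDiff_cut (R : ℝ) : ContDiff ℝ ∞ (cut R) :=
  (ContDiffBump.contDiff _).comp (contDiff_const_smul _)

lemma cut_nonneg (R : ℝ) (z : ℂ) : 0 ≤ cut R z := ContDiffBump.nonneg _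
lemma cut_le_one (R : ℝ) (z : ℂ) : cut R z ≤ 1 := ContDiffBump.le_one _

lemma cut_eq_one {R : ℝ} (hR : 0 < R) {z : ℂ} (hz : ‖z‖ ≤ R) : cut R z = 1 := by
  apply ContDiffBump.one_of_mem_closedBall
  rw [mem_closedBall_zero_iff, norm_smul, norm_inv, Real.norm_of_nonneg hR.le]
  exact inv_mul_le_one_of_le₀ hz hR.le

lemma cut_eq_zero {R : ℝ} (hR : 0 < R) {z : ℂ} (hz : 2 * R ≤ ‖z‖) : cut R z = 0 := by
  apply ContDiffBump.zero_of_le_dist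
  rw [dist_zero_right, norm_smul, norm_inv, Real.norm_of_nonneg hR.le]
  change 2 ≤ R⁻¹ * ‖z‖
  rw [inv_mul_eq_div, le_div_iff₀ hR]
  exact hz

lemma fderiv_cut_eq_zero_of_lt {R : ℝ} (hR : 0 < R) {z : ℂ} (hz : ‖z‖ < R) :
    fderiv ℝ (cut R) z = 0 := by
  have : cut R =ᶠ[nhds z] fun _ ↦ 1 := by
    filter_upwards [(isOpen_lt continuous_norm continuous_const).mem_nhds hz] with w hw
    exact cut_eq_one hR (le_of_lt hw)
  rw [this.fderiv_eq]; simp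

lemma fderiv_cut_eq_zero_of_gt {R : ℝ} (hR : 0 < R) {z : ℂ} (hz : 2 * R < ‖z‖) :
    fderiv ℝ (cut R) z = 0 := by
  have : cut R =ᶠ[nhds z] fun _ ↦ 0 := by
    filter_upwards [(isOpen_lt continuous_const continuous_norm).mem_nhds hz] with w hw
    exact cut_eq_zero hR (le_of_lt hw)
  rw [this.fderiv_eq]; simp

lemma hasCompactSupport_cut {R : ℝ} (hR : 0 < R) : HasCompactSupport (cut R) := by
  apply HasCompactSupport.intro (isCompact_closedBall (0 : ℂ) (2 * R))
  intro z hz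
  rw [mem_closedBall_zero_iff, not_le] at hz
  exact cut_eq_zero hR hz.le

lemma continuous_gradSq {χ : ℂ → ℝ} (hχ : ContDiff ℝ ∞ χ) : Continuous (gradSq χ) := by
  have h := hχ.continuous_fderiv (by simp)
  unfold gradSq
  fun_prop

lemma gradSq_nonneg (χ : ℂ → ℝ) (z : ℂ) : 0 ≤ gradSq χ z := by unfold gradSq; positivity

lemma hasCompactSupport_gradSq {χ : ℂ → ℝ} (hc : HasCompactSupport χ) :
    HasCompactSupport (gradSq χ) := by
  apply HasCompactSupport.intro hc
  intro z hz
  have : fderiv ℝ χ z = 0 :=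
    image_eq_zero_of_notMem_tsupport fun h ↦ hz (tsupport_fderiv_subset ℝ h)
  simp [gradSq, this]

lemma integrable_gradSq {χ : ℂ → ℝ} (hχ : ContDiff ℝ ∞ χ) (hc : HasCompactSupport χ) :
    Integrable (gradSq χ) :=
  (continuous_gradSq hχ).integrable_of_hasCompactSupport (hasCompactSupport_gradSq hc)

lemma fderiv_cut (R : ℝ) (z v : ℂ) : fderiv ℝ (cut R) z v = R⁻¹ * fderiv ℝ (cut 1) (R⁻¹ • z) v := by
  have h : cut R = fun z ↦ cut 1 (R⁻¹ • z) := by funext z; simp [cut]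
  rw [h]
  have h1 : HasFDerivAt (fun z : ℂ ↦ cut 1 (R⁻¹ • z)) _ z :=
    ((contDiff_cut 1).differentiable (by simp) (R⁻¹ • z)).hasFDerivAt.comp z
      ((hasFDerivAt_id z).const_smul R⁻¹)
  rw [h1.fderiv]
  simp

/-- The energy of the cutoff functions is scale invariant. -/
lemma integral_gradSq_cut {R : ℝ} (hR : 0 < R) : ∫ z, gradSq (cut R) z = ∫ z, gradSq (cut 1) z := by
  have h : ∀ z, gradSq (cut R) z = (R ^ 2)⁻¹ * gradSq (cut 1) (R⁻¹ • z) := by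
    intro z; simp only [gradSq, fderiv_cut R]; ring
  simp only [h]
  rw [integral_const_mul, Measure.integral_comp_inv_smul]
  simp only [finrank_real_complex, abs_of_nonneg (sq_nonneg R), smul_eq_mul]
  rw [inv_mul_cancel_left₀ (by positivity)]

/-- There are cutoff functions, equal to `1` on arbitrarily large balls, of arbitrarily small
energy. -/
theorem exists_cutoff (R : ℝ) {ε : ℝ} (hε : 0 < ε) : ∃ χ : ℂ → ℝ, ContDiff ℝ ∞ χ ∧
    HasCompactSupport χ ∧ (∀ z, 0 ≤ χ z) ∧ (∀ z, χ z ≤ 1) ∧ (∀ z, ‖z‖ ≤ R → χ z = 1) ∧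
    ∫ z, gradSq χ z ≤ ε := by
  obtain ⟨m, hm⟩ := pow_unbounded_of_one_lt R (by norm_num : (1 : ℝ) < 3)
  set c := ∫ z, gradSq (cut 1) z with hc
  have hc0 : 0 ≤ c := integral_nonneg (gradSq_nonneg _)
  obtain ⟨k, hk⟩ := exists_nat_gt (c / ε)
  have hk0 : (0 : ℝ) < k := lt_of_le_of_lt (by positivity) hk
  -- A discrete logarithmic cutoff: the average of `k` cutoffs at scales growing by `3`, more than
  -- the factor `2` between the radii of one cutoff, so that their gradients have disjoint supports.
  -- Each has the same energy `c`, hence the average has energy `k c / k² = c / k < ε`.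
  let r : ℕ → ℝ := fun j ↦ 3 ^ (m + j)
  have hr : ∀ j, 0 < r j := fun j ↦ by positivity
  let χ : ℂ → ℝ := fun z ↦ (k : ℝ)⁻¹ * ∑ j ∈ Finset.range k, cut (r j) z
  have hfd : ∀ z v, fderiv ℝ χ z v = (k : ℝ)⁻¹ * ∑ j ∈ Finset.range k, fderiv ℝ (cut (r j)) z v := by
    intro z v
    have h1 : HasFDerivAt χ ((k : ℝ)⁻¹ • ∑ j ∈ Finset.range k, fderiv ℝ (cut (r j)) z) z :=
      (HasFDerivAt.fun_sum fun j _ ↦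
        ((contDiff_cut (r j)).differentiable (by simp) z).hasFDerivAt).const_mul _
    rw [h1.fderiv]; simp
  have hdisj : ∀ z v, ∀ i j, i < j → fderiv ℝ (cut (r i)) z v * fderiv ℝ (cut (r j)) z v = 0 := by
    intro z v i j hij
    have hrij : 2 * r i < r j := by
      have h1 : r (i + 1) ≤ r j := pow_le_pow_right₀ (by norm_num) (by omega)
      have h2 : r (i + 1) = 3 * r i := by simp only [r]; ring
      linarith [hr i]
    rcases lt_or_ge ‖z‖ (r j) with h | h
    · rw [fderiv_cut_eq_zero_of_lt (hr j) h]; simp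
    · rw [fderiv_cut_eq_zero_of_gt (hr i) (by linarith)]; simp
  have hsq : ∀ z v, (∑ j ∈ Finset.range k, fderiv ℝ (cut (r j)) z v) ^ 2
      = ∑ j ∈ Finset.range k, fderiv ℝ (cut (r j)) z v ^ 2 := by
    intro z v
    rw [sq, Finset.sum_mul_sum]
    refine Finset.sum_congr rfl fun i hi ↦ ?_
    rw [Finset.sum_eq_single_of_mem i hi, sq]
    intro j _ hji
    rcases lt_or_gt_of_ne hji with h | h
    · rw [mul_comm]; exact hdisj z v j i h
    · exact hdisj z v i j h
  have hgrad : ∀ z, gradSq χ z = ((k : ℝ) ^ 2)⁻¹ * ∑ j ∈ Finset.range k, gradSq (cut (r j)) z := by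
    intro z
    rw [gradSq, hfd, hfd, mul_pow, mul_pow, hsq, hsq, ← mul_add, ← Finset.sum_add_distrib, inv_pow]
    rfl
  refine ⟨χ, ?_, ?_, fun z ↦ ?_, fun z ↦ ?_, fun z hz ↦ ?_, ?_⟩
  · exact contDiff_const.mul (ContDiff.sum fun j _ ↦ contDiff_cut (r j))
  · apply HasCompactSupport.intro (isCompact_closedBall (0 : ℂ) (2 * r k))
    intro z hz
    rw [mem_closedBall_zero_iff, not_le] at hz
    have : ∀ j ∈ Finset.range k, cut (r j) z = 0 := by
      intro j hj
      apply cut_eq_zero (hr j)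
      have : r j ≤ r k := pow_le_pow_right₀ (by norm_num) (by have := Finset.mem_range.1 hj; omega)
      linarith
    simp only [χ]
    rw [Finset.sum_eq_zero this, mul_zero]
  · exact mul_nonneg (by positivity) (Finset.sum_nonneg fun j _ ↦ cut_nonneg _ _)
  · have : ∑ j ∈ Finset.range k, cut (r j) z ≤ k := by
      simpa using Finset.sum_le_card_nsmul (Finset.range k) (fun j ↦ cut (r j) z) 1
        fun j _ ↦ cut_le_one _ _
    exact inv_mul_le_one_of_le₀ this hk0.le
  · have : ∀ j ∈ Finset.range k, cut (r j) z = 1 := by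
      intro j _
      apply cut_eq_one (hr j)
      have : (3 : ℝ) ^ m ≤ r j := pow_le_pow_right₀ (by norm_num) (by omega)
      linarith
    simp only [χ]
    rw [Finset.sum_congr rfl this]
    simp [hk0.ne']
  · simp only [hgrad]
    rw [integral_const_mul, integral_finsetSum _ fun j _ ↦
      integrable_gradSq (contDiff_cut _) (hasCompactSupport_cut (hr j))]
    simp only [integral_gradSq_cut (hr _), ← hc]
    rw [Finset.sum_const, Finset.card_range, nsmul_eq_mul]
    rw [div_lt_iff₀ hε] at hk
    have : ((k : ℝ) ^ 2)⁻¹ * (k * c) = c / k := by field_simp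
    rw [this, div_le_iff₀ hk0]
    linarith

end Cutoff

/-! ### Strong unique continuation -/

section UniqueContinuation

open Complex Set

/-- An `L¹` estimate for `∂_x + i ∂_y`. -/
lemma exists_integral_norm_le : ∃ c : ℝ, 0 ≤ c ∧ ∀ (R : ℝ) (_ : 0 < R) (v : ℂ → ℂ), ContDiff ℝ 1 v →
    (∀ z, R < ‖z‖ → v z = 0) → ∫ z, ‖v z‖ ≤ c * R * ∫ z, ‖dbar v z‖ := by
  refine ⟨(2 * Real.pi)⁻¹ * (2 * (volume.real (Metric.ball (0 : ℂ) 1)) * 3), by positivity,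
    fun R hR v hv h0 ↦ ?_⟩
  have hc : HasCompactSupport v := by
    apply HasCompactSupport.intro (isCompact_closedBall (0 : ℂ) R)
    intro z hz
    rw [mem_closedBall_zero_iff, not_le] at hz
    exact h0 z hz
  let f : ℂ → ℝ := fun w ↦ ‖dbar v w‖
  -- For `z` and `w` in the disc of radius `R` one has `‖z - w‖ < 3R`, so the Cauchy kernel may be
  -- truncated there. Its integral is then proportional to `R`, and the integral of a convolution is
  -- the product of the integrals.
  let g : ℂ → ℝ := (Metric.ball (0 : ℂ) (3 * R)).indicator fun w ↦ ‖w‖⁻¹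
  have hfd := hv.continuous_fderiv (by simp)
  have hdb : Continuous (dbar v) := by unfold dbar; fun_prop
  have hf0 : ∀ w, R < ‖w‖ → f w = 0 := by
    intro w hw
    have : v =ᶠ[nhds w] fun _ ↦ 0 := by
      filter_upwards [(isOpen_lt continuous_const continuous_norm).mem_nhds hw] with x hx
      exact h0 x hx
    simp [f, dbar, this.fderiv_eq]
  have hf : Integrable f := by
    refine hdb.norm.integrable_of_hasCompactSupport ?_
    apply HasCompactSupport.intro (isCompact_closedBall (0 : ℂ) R)
    intro z hz
    rw [mem_closedBall_zero_iff, not_le] at hz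
    exact hf0 z hz
  have hg : Integrable g :=
    (integrable_indicator_iff Metric.isOpen_ball.measurableSet).2 (integrableOn_inv_norm _)
  have hgval : ∫ w, g w = 2 * (volume.real (Metric.ball (0 : ℂ) 1)) * (3 * R) := by
    have h1 : ∀ w, g w = (Iio (3 * R)).indicator (fun r : ℝ ↦ r⁻¹) ‖w‖ := fun w ↦ by
      simp [g, indicator]
    simp only [h1]
    rw [integral_fun_norm_addHaar volume]
    have h2 : ∫ y in Ioi (0 : ℝ), y ^ (Module.finrank ℝ ℂ - 1) • (Iio (3 * R)).indicator
        (fun r : ℝ ↦ r⁻¹) y = ∫ y in Ioi (0 : ℝ), (Iio (3 * R)).indicator (fun _ ↦ (1 : ℝ)) y := by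
      apply setIntegral_congr_fun measurableSet_Ioi
      intro r hr
      have hr' : r ≠ 0 := ne_of_gt hr
      simp only [indicator, finrank_real_complex]
      split_ifs <;> simp [hr']
    rw [h2, integral_indicator measurableSet_Iio, Measure.restrict_restrict measurableSet_Iio,
      inter_comm, Ioi_inter_Iio]
    simp [finrank_real_complex, Measure.real, ENNReal.toReal_ofReal hR.le]
    ring
  let L := ContinuousLinearMap.mul ℝ ℝ
  have hpt : ∀ z, ‖v z‖ ≤ (2 * Real.pi)⁻¹ * convolution f g L volume z := by
    intro z
    have hconv : 0 ≤ convolution f g L volume z := by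
      rw [convolution_def]
      refine integral_nonneg fun w ↦ mul_nonneg (norm_nonneg _) ?_
      exact indicator_nonneg (fun w _ ↦ inv_nonneg.2 (norm_nonneg w)) _
    rcases lt_or_ge R ‖z‖ with hz | hz
    · rw [h0 z hz, norm_zero]; positivity
    · have h1 := integral_dbar_mul_inv_sub hv hc z
      have h2 : v z = (2 * Real.pi : ℂ)⁻¹ * ∫ w, dbar v w * (z - w)⁻¹ := by
        rw [h1]
        have : (2 * Real.pi : ℂ) ≠ 0 := by simp [Real.pi_ne_zero]
        field_simp
      have h3 : ∀ w, ‖dbar v w * (z - w)⁻¹‖ = L (f w) (g (z - w)) := by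
        intro w
        simp only [L, f, g, ContinuousLinearMap.mul_apply', norm_mul, norm_inv]
        rcases lt_or_ge R ‖w‖ with hw | hw
        · have := hf0 w hw
          simp only [f] at this
          rw [this]; simp
        · rw [indicator_of_mem]
          rw [mem_ball_zero_iff]
          calc ‖z - w‖ ≤ ‖z‖ + ‖w‖ := norm_sub_le _ _
            _ < 3 * R := by linarith
      rw [h2, norm_mul, convolution_def]
      have h4 : ‖(2 * Real.pi : ℂ)⁻¹‖ = (2 * Real.pi)⁻¹ := by
        simp [abs_of_pos Real.pi_pos]
      rw [h4]
      gcongr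
      refine (norm_integral_le_integral_norm _).trans (le_of_eq ?_)
      congr 1
      funext w
      exact h3 w
  have hci : Integrable (convolution f g L volume) := hf.integrable_convolution L hg
  calc ∫ z, ‖v z‖ ≤ ∫ z, (2 * Real.pi)⁻¹ * convolution f g L volume z :=
        integral_mono (hv.continuous.norm.integrable_of_hasCompactSupport hc.norm)
          (hci.const_mul _) hpt
    _ = (2 * Real.pi)⁻¹ * ((∫ z, f z) * ∫ z, g z) := by
        rw [integral_const_mul, integral_convolution L hf hg]; rfl
    _ = _ := by rw [hgval]; ring

/-- Division of a function by `z ^ N` when it vanishes to order `N + 2` at the origin. -/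
lemma contDiff_div_pow {F : ℂ → ℂ} (hF : ContDiff ℝ ∞ F) {N : ℕ} (hN : N ≠ 0) {r K : ℝ}
    (hr : 0 < r) (h0 : ∀ z, ‖z‖ < r → ‖F z‖ ≤ K * ‖z‖ ^ (N + 2))
    (h1 : ∀ z, ‖z‖ < r → ‖fderiv ℝ F z‖ ≤ K * ‖z‖ ^ (N + 2)) :
    ContDiff ℝ 1 (fun z ↦ F z * (z ^ N)⁻¹) ∧
      ∀ z, dbar (fun z ↦ F z * (z ^ N)⁻¹) z = dbar F z * (z ^ N)⁻¹ := by
  set G : ℂ → ℂ := fun z ↦ F z * (z ^ N)⁻¹ with hG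
  have hball : ∀ᶠ z : ℂ in nhds 0, ‖z‖ < r :=
    (isOpen_lt continuous_norm continuous_const).mem_nhds (by simpa using hr)
  have hder0 : HasFDerivAt G (0 : ℂ →L[ℝ] ℂ) 0 := by
    -- The two extra orders of vanishing leave `‖z‖²` after the division, so that `G` has derivative
    -- zero at the origin. There `G` itself is `0`, by `0⁻¹ = 0` and `N ≠ 0`.
    have : G =O[nhds 0] fun z ↦ ‖z - 0‖ ^ 2 := by
      refine Asymptotics.IsBigO.of_bound K ?_
      filter_upwards [hball] with z hz
      rcases eq_or_ne z 0 with rfl | hz0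
      · simp [hG, hN]
      have hzn : 0 < ‖z‖ := norm_pos_iff.2 hz0
      rw [hG, norm_mul, norm_inv, norm_pow, sub_zero, norm_pow, norm_norm,
        mul_inv_le_iff₀ (by positivity)]
      calc ‖F z‖ ≤ K * ‖z‖ ^ (N + 2) := h0 z hz
        _ = K * ‖z‖ ^ 2 * ‖z‖ ^ N := by ring
    exact this.hasFDerivAt (by norm_num)
  set d : ℂ → ℂ := fun z ↦ -(N * z ^ (N - 1)) / (z ^ N) ^ 2 with hd
  set L : ℂ → ℂ →L[ℝ] ℂ := fun z ↦ (F z * d z) • ContinuousLinearMap.id ℝ ℂ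
    + (z ^ N)⁻¹ • fderiv ℝ F z with hL
  have hderz : ∀ z, z ≠ 0 → HasFDerivAt G (L z) z := by
    intro z hz
    have h2 : HasDerivAt (fun z : ℂ ↦ (z ^ N)⁻¹) (d z) z :=
      (hasDerivAt_pow N z).inv (pow_ne_zero _ hz)
    have h4 : HasFDerivAt F (fderiv ℝ F z) z := (hF.differentiable (by simp) z).hasFDerivAt
    have h3 := h4.mul' (h2.hasFDerivAt.restrictScalars ℝ)
    refine h3.congr_fderiv ?_
    ext v <;> (simp [hL]; ring)
  have hfd0 : fderiv ℝ G 0 = 0 := hder0.fderiv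
  have hfdz : ∀ z, z ≠ 0 → fderiv ℝ G z = L z := fun z hz ↦ (hderz z hz).fderiv
  have hnear : ∀ z, ‖z‖ < r → ‖fderiv ℝ G z‖ ≤ K * N * ‖z‖ + K * ‖z‖ ^ 2 := by
    intro z hz
    rcases eq_or_ne z 0 with rfl | hz0
    · simp [hfd0]
    have hzn : 0 < ‖z‖ := norm_pos_iff.2 hz0
    obtain ⟨m, rfl⟩ := Nat.exists_eq_succ_of_ne_zero hN
    rw [hfdz z hz0]
    refine (norm_add_le _ _).trans (add_le_add ?_ ?_)
    · rw [norm_smul]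
      refine (mul_le_mul_of_nonneg_left ContinuousLinearMap.norm_id_le (norm_nonneg _)).trans ?_
      rw [mul_one, norm_mul]
      have hdn : ‖d z‖ = (m + 1 : ℕ) * ‖z‖ ^ m / (‖z‖ ^ (m + 1)) ^ 2 := by
        simp only [hd, norm_div, norm_neg, norm_mul, norm_pow, Complex.norm_natCast]
        simp
      rw [hdn]
      refine (mul_le_mul_of_nonneg_right (h0 z hz) (by positivity)).trans (le_of_eq ?_)
      field_simp
      simp only [Nat.succ_eq_add_one]; ring
    · rw [norm_smul, norm_inv, norm_pow]
      refine (mul_le_mul_of_nonneg_left (h1 z hz) (by positivity)).trans (le_of_eq ?_)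
      field_simp
      ring
  have hcont : Continuous (fderiv ℝ G) := by
    rw [continuous_iff_continuousAt]
    intro z
    rcases eq_or_ne z 0 with rfl | hz0
    · rw [ContinuousAt, hfd0, tendsto_zero_iff_norm_tendsto_zero]
      refine squeeze_zero' (Filter.Eventually.of_forall fun _ ↦ norm_nonneg _)
        (hball.mono fun z hz ↦ hnear z hz) ?_
      have : Continuous fun z : ℂ ↦ K * N * ‖z‖ + K * ‖z‖ ^ 2 := by fun_prop
      simpa using this.tendsto 0
    · have h5 : fderiv ℝ G =ᶠ[nhds z] L := by
        filter_upwards [isOpen_ne.mem_nhds hz0] with w hw using hfdz w hw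
      rw [continuousAt_congr h5]
      have h6 : Continuous F := hF.continuous
      have h7 : Continuous (fderiv ℝ F) := hF.continuous_fderiv (by simp)
      have h8 : ContinuousAt d z := by
        refine ContinuousAt.div (by fun_prop) (by fun_prop) (by simp [hz0])
      have h9 : ContinuousAt (fun z : ℂ ↦ (z ^ N)⁻¹) z :=
        ContinuousAt.inv₀ (by fun_prop) (by simp [hz0])
      exact ((h6.continuousAt.mul h8).smul continuousAt_const).add
        (h9.smul h7.continuousAt)
  refine ⟨contDiff_one_iff_fderiv.2 ⟨fun z ↦ ?_, hcont⟩, fun z ↦ ?_⟩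
  · rcases eq_or_ne z 0 with rfl | hz0
    exacts [hder0.differentiableAt, (hderz z hz0).differentiableAt]
  · rcases eq_or_ne z 0 with rfl | hz0
    · simp [dbar, hfd0, hN]
    · simp only [dbar, hfdz z hz0, hL]
      simp only [add_apply, smul_apply,
        ContinuousLinearMap.id_apply, smul_eq_mul]
      linear_combination (F z * d z) * Complex.I_sq

end UniqueContinuation

/-! ### Strong unique continuation for the inequality `|∂̄u| ≤ C|u|` -/

section UniqueContinuation

open Complex Set

lemma dbar_mul {χ : ℂ → ℝ} {u : ℂ → ℂ} {z : ℂ} (hχ : DifferentiableAt ℝ χ z)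
    (hu : DifferentiableAt ℝ u z) :
    dbar (fun z ↦ (χ z : ℂ) * u z) z = χ z * dbar u z + dbar (fun z ↦ (χ z : ℂ)) z * u z := by
  have h1 : HasFDerivAt (fun z ↦ (χ z : ℂ)) (ofRealCLM.comp (fderiv ℝ χ z)) z :=
    ofRealCLM.hasFDerivAt.comp z hχ.hasFDerivAt
  have h2 : HasFDerivAt (fun z ↦ (χ z : ℂ) * u z) _ z := h1.mul hu.hasFDerivAt
  simp only [dbar, h1.fderiv, h2.fderiv]
  simp
  ring

/-- Strong unique continuation at the origin for the differential inequality `|∂̄u| ≤ C |u|`. -/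
lemma eventually_eq_zero_of_flat_zero {ι : Type*} [Fintype ι] {u : ι → ℂ → ℂ}
    (hu : ∀ j, ContDiff ℝ ∞ (u j)) {C r : ℝ} (hC : 0 ≤ C) (hr : 0 < r)
    (hineq : ∀ z, ‖z‖ < r → ∀ j, ‖dbar (u j) z‖ ≤ C * ∑ k, ‖u k z‖)
    (hflat : ∀ N j, ∃ K, ∀ z, ‖z‖ < 1 → ‖u j z‖ ≤ K * ‖z‖ ^ N ∧ ‖fderiv ℝ (u j) z‖ ≤ K * ‖z‖ ^ N) :
    ∃ ρ > 0, ∀ z, ‖z‖ < ρ → ∀ j, u j z = 0 := by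
  obtain ⟨c, hc0, hc⟩ := exists_integral_norm_le
  -- The radius is so small that, in the summed `L¹` estimate, the term with `C` is at most half of
  -- the left-hand side and can be absorbed.
  obtain ⟨ρ, hρ, hρr, hρ1, hρs⟩ : ∃ ρ : ℝ, 0 < ρ ∧ 2 * ρ < r ∧ 2 * ρ < 1 ∧
      c * (2 * ρ) * C * Fintype.card ι ≤ 1 / 2 := by
    have h0 : 0 ≤ c * C * Fintype.card ι := by positivity
    refine ⟨min (r / 4) (min (1 / 4) (1 / (4 * (c * C * Fintype.card ι + 1)))), by positivity,
      ?_, ?_, ?_⟩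
    · have := min_le_left (r / 4) (min (1 / 4) (1 / (4 * (c * C * Fintype.card ι + 1))))
      linarith
    · have := (min_le_right (r / 4) (min (1 / 4) (1 / (4 * (c * C * Fintype.card ι + 1))))).trans
        (min_le_left _ _)
      linarith
    · have := (min_le_right (r / 4) (min (1 / 4) (1 / (4 * (c * C * Fintype.card ι + 1))))).trans
        (min_le_right _ _)
      set ρ := min (r / 4) (min (1 / 4) (1 / (4 * (c * C * Fintype.card ι + 1))))
      rw [le_div_iff₀ (by positivity)] at this
      have h2 : 0 ≤ ρ := by positivity
      nlinarith
  set χ := cut ρ with hχ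
  have hχs : ContDiff ℝ ∞ χ := contDiff_cut ρ
  have hχC : ContDiff ℝ ∞ (fun z ↦ (χ z : ℂ)) := ofRealCLM.contDiff.comp hχs
  set F : ι → ℂ → ℂ := fun j z ↦ (χ z : ℂ) * u j z with hF
  have hFs : ∀ j, ContDiff ℝ ∞ (F j) := fun j ↦ hχC.mul (hu j)
  have hu0 : ∀ j, u j 0 = 0 := by
    intro j
    obtain ⟨K, hK⟩ := hflat 1 j
    simpa using (hK 0 (by simp)).1
  have hfdχ : Continuous (fderiv ℝ (fun z ↦ (χ z : ℂ))) := hχC.continuous_fderiv (by simp)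
  have hdχ : Continuous (dbar fun z ↦ (χ z : ℂ)) := by unfold dbar; fun_prop
  have hdχ0 : ∀ z, ‖z‖ < ρ → dbar (fun z ↦ (χ z : ℂ)) z = 0 := by
    intro z hz
    have : (fun z ↦ (χ z : ℂ)) =ᶠ[nhds z] fun _ ↦ 1 := by
      filter_upwards [(isOpen_lt continuous_norm continuous_const).mem_nhds hz] with w hw
      rw [hχ, cut_eq_one hρ (le_of_lt hw), ofReal_one]
    simp [dbar, this.fderiv_eq]
  have hχ0 : ∀ z, 2 * ρ < ‖z‖ → χ z = 0 := fun z hz ↦ cut_eq_zero hρ hz.le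
  have hdχ1 : ∀ z, 2 * ρ < ‖z‖ → dbar (fun z ↦ (χ z : ℂ)) z = 0 := by
    intro z hz
    have : (fun z ↦ (χ z : ℂ)) =ᶠ[nhds z] fun _ ↦ 0 := by
      filter_upwards [(isOpen_lt continuous_const continuous_norm).mem_nhds hz] with w hw
      rw [hχ0 w hw, ofReal_zero]
    simp [dbar, this.fderiv_eq]
  have hsupp : ∀ {g : ℂ → ℝ}, (∀ z, 2 * ρ < ‖z‖ → g z = 0) → HasCompactSupport g := by
    intro g hg
    apply HasCompactSupport.intro (isCompact_closedBall (0 : ℂ) (2 * ρ))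
    intro z hz
    rw [mem_closedBall_zero_iff, not_le] at hz
    exact hg z hz
  let hh : ι → ℂ → ℝ := fun j z ↦ ‖dbar (fun z ↦ (χ z : ℂ)) z * u j z‖
  have hhi : ∀ j, Integrable (hh j) := fun j ↦
    (hdχ.mul (hu j).continuous).norm.integrable_of_hasCompactSupport
      (hsupp fun z hz ↦ by simp [hdχ1 z hz])
  set H : ℝ := ∑ j, ∫ z, hh j z with hH
  -- Carleman's device: division by the holomorphic weight `z ^ N` commutes with `∂̄`, and flatness
  -- keeps the quotient of class `C¹`. The error from the cutoff lives on `‖z‖ ≥ ρ`, where the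
  -- weight contributes at most `ρ⁻ᴺ`; on `‖z‖ < ρ / 2` it contributes at least `(ρ / 2)⁻ᴺ`. The
  -- ratio `2⁻ᴺ` tends to zero while the other constants do not depend on `N`.
  have key : ∀ N : ℕ, N ≠ 0 → ∀ j, ∫ z in Metric.ball (0 : ℂ) (ρ / 2), ‖u j z‖
      ≤ (1 / 2) ^ N * (2 * (c * (2 * ρ)) * H) := by
    intro N hN
    let v : ι → ℂ → ℂ := fun j z ↦ F j z * (z ^ N)⁻¹
    have hv : ∀ j, ContDiff ℝ 1 (v j) ∧ ∀ z, dbar (v j) z = dbar (F j) z * (z ^ N)⁻¹ := by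
      intro j
      obtain ⟨K, hK⟩ := hflat (N + 2) j
      obtain ⟨D, hD⟩ := (isCompact_closedBall (0 : ℂ) 1).exists_bound_of_continuousOn
        hfdχ.continuousOn
      have hK0 : 0 ≤ K := by
        have := (norm_nonneg _).trans (hK (1 / 2) (by norm_num)).1
        by_contra hneg
        have h2 : K * ‖(1 / 2 : ℂ)‖ ^ (N + 2) < 0 :=
          mul_neg_of_neg_of_pos (not_le.1 hneg) (pow_pos (by norm_num) _)
        linarith
      have hχ1 : ∀ z, ‖(χ z : ℂ)‖ ≤ 1 := fun z ↦ by
        rw [norm_real, Real.norm_of_nonneg (cut_nonneg _ _)]; exact cut_le_one _ _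
      refine contDiff_div_pow (hFs j) hN (r := 1) (K := K + D * K) one_pos (fun z hz ↦ ?_)
        (fun z hz ↦ ?_)
      · have hD0 : 0 ≤ D := (norm_nonneg _).trans (hD z (by simpa using hz.le))
        rw [hF, norm_mul]
        calc ‖(χ z : ℂ)‖ * ‖u j z‖ ≤ 1 * (K * ‖z‖ ^ (N + 2)) := by
              gcongr; exacts [hχ1 z, (hK z hz).1]
          _ ≤ (K + D * K) * ‖z‖ ^ (N + 2) := by
              rw [add_mul, one_mul]
              have : 0 ≤ D * K * ‖z‖ ^ (N + 2) := by positivity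
              linarith
      · have h3 := (hχC.differentiable (by simp) z).hasFDerivAt.mul
          ((hu j).differentiable (by simp) z).hasFDerivAt
        have h4 : fderiv ℝ (F j) z = _ := h3.fderiv
        have hD0 := hD z (by simpa using hz.le)
        rw [h4]
        calc _ ≤ ‖(χ z : ℂ)‖ * ‖fderiv ℝ (u j) z‖ + ‖u j z‖ * ‖fderiv ℝ (fun z ↦ (χ z : ℂ)) z‖ :=
              (norm_add_le _ _).trans (add_le_add (norm_smul_le _ _) (norm_smul_le _ _))
          _ ≤ 1 * (K * ‖z‖ ^ (N + 2)) + (K * ‖z‖ ^ (N + 2)) * D := by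
              gcongr; exacts [hχ1 z, (hK z hz).2, (hK z hz).1]
          _ = _ := by ring
    have hv0 : ∀ j z, 2 * ρ < ‖z‖ → v j z = 0 := fun j z hz ↦ by simp [v, hF, hχ0 z hz]
    have hvi : ∀ j, Integrable fun z ↦ ‖v j z‖ := fun j ↦
      (hv j).1.continuous.norm.integrable_of_hasCompactSupport
        (hsupp fun z hz ↦ by simp [hv0 j z hz])
    have hpt : ∀ j z, ‖dbar (v j) z‖ ≤ C * ∑ k, ‖v k z‖ + (ρ ^ N)⁻¹ * hh j z := by
      intro j z
      have hd : dbar (v j) z = χ z * dbar (u j) z * (z ^ N)⁻¹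
          + dbar (fun z ↦ (χ z : ℂ)) z * u j z * (z ^ N)⁻¹ := by
        rw [(hv j).2, hF, dbar_mul (hχs.differentiable (by simp) z)
          ((hu j).differentiable (by simp) z), add_mul]
      rw [hd]
      refine (norm_add_le _ _).trans (add_le_add ?_ ?_)
      · rcases lt_or_ge (2 * ρ) ‖z‖ with hz | hz
        · rw [hχ0 z hz]
          simp only [ofReal_zero, zero_mul, norm_zero]
          positivity
        · have h5 := hineq z (hz.trans_lt hρr) j
          have h6 : C * ∑ k, ‖v k z‖ = ‖(χ z : ℂ)‖ * (C * ∑ k, ‖u k z‖) * ‖(z ^ N)⁻¹‖ := by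
            simp only [v, hF, norm_mul, Finset.mul_sum, Finset.sum_mul]
            exact Finset.sum_congr rfl fun k _ ↦ by ring
          rw [h6, norm_mul, norm_mul]
          gcongr
      · rw [norm_mul, mul_comm]
        change _ ≤ (ρ ^ N)⁻¹ * ‖dbar (fun z ↦ (χ z : ℂ)) z * u j z‖
        rcases lt_or_ge ‖z‖ ρ with hz | hz
        · simp [hdχ0 z hz]
        · gcongr
          rw [norm_inv, norm_pow]
          gcongr
    set A : ℝ := ∑ k, ∫ z, ‖v k z‖ with hA
    have hsum : Integrable fun z ↦ ∑ k, ‖v k z‖ := integrable_finsetSum _ fun k _ ↦ hvi k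
    have hAj : ∀ j, ∫ z, ‖v j z‖ ≤ c * (2 * ρ) * (C * A + (ρ ^ N)⁻¹ * ∫ z, hh j z) := by
      intro j
      refine (hc (2 * ρ) (by positivity) (v j) (hv j).1 (hv0 j)).trans ?_
      gcongr
      have hint : Integrable fun z ↦ C * ∑ k, ‖v k z‖ + (ρ ^ N)⁻¹ * hh j z :=
        (hsum.const_mul C).add ((hhi j).const_mul _)
      refine (integral_mono_of_nonneg (Filter.Eventually.of_forall fun _ ↦ norm_nonneg _) hint
        (Filter.Eventually.of_forall (hpt j))).trans (le_of_eq ?_)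
      rw [integral_add (hsum.const_mul C) ((hhi j).const_mul _), integral_const_mul,
        integral_const_mul, integral_finsetSum _ fun k _ ↦ hvi k]
    have hA0 : 0 ≤ A := Finset.sum_nonneg fun k _ ↦ integral_nonneg fun _ ↦ norm_nonneg _
    have hAle : A ≤ 2 * (c * (2 * ρ)) * H * (ρ ^ N)⁻¹ := by
      have h7 : A ≤ ∑ j, c * (2 * ρ) * (C * A + (ρ ^ N)⁻¹ * ∫ z, hh j z) :=
        Finset.sum_le_sum fun j _ ↦ hAj j
      rw [← Finset.mul_sum, Finset.sum_add_distrib, Finset.sum_const, ← Finset.mul_sum,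
        ← hH, Finset.card_univ, nsmul_eq_mul] at h7
      have h8 := mul_le_mul_of_nonneg_right hρs hA0
      nlinarith
    intro j
    have hle : ∀ z ∈ Metric.ball (0 : ℂ) (ρ / 2), ‖u j z‖ ≤ (ρ / 2) ^ N * ‖v j z‖ := by
      intro z hz
      rw [mem_ball_zero_iff] at hz
      rcases eq_or_ne z 0 with rfl | hz0
      · rw [hu0 j, norm_zero]; positivity
      have hz1 : 0 < ‖z‖ := norm_pos_iff.2 hz0
      have h9 : ‖u j z‖ = ‖z‖ ^ N * ‖v j z‖ := by
        simp only [v, hF, hχ, cut_eq_one hρ (by linarith : ‖z‖ ≤ ρ), norm_mul, norm_inv, norm_pow]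
        field_simp
        simp
      rw [h9]
      gcongr
    calc ∫ z in Metric.ball (0 : ℂ) (ρ / 2), ‖u j z‖
        ≤ ∫ z in Metric.ball (0 : ℂ) (ρ / 2), (ρ / 2) ^ N * ‖v j z‖ :=
          setIntegral_mono_on (((hu j).continuous.norm.locallyIntegrable.integrableOn_isCompact
            (isCompact_closedBall 0 (ρ / 2))).mono_set Metric.ball_subset_closedBall)
            ((hvi j).const_mul _).integrableOn Metric.isOpen_ball.measurableSet hle
      _ ≤ ∫ z, (ρ / 2) ^ N * ‖v j z‖ :=
          setIntegral_le_integral ((hvi j).const_mul _)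
            (Filter.Eventually.of_forall fun z ↦ by positivity)
      _ = (ρ / 2) ^ N * ∫ z, ‖v j z‖ := integral_const_mul _ _
      _ ≤ (ρ / 2) ^ N * A := by
          gcongr
          exact Finset.single_le_sum (f := fun k ↦ ∫ z, ‖v k z‖)
            (fun k _ ↦ integral_nonneg fun _ ↦ norm_nonneg _) (Finset.mem_univ j)
      _ ≤ (ρ / 2) ^ N * (2 * (c * (2 * ρ)) * H * (ρ ^ N)⁻¹) := by gcongr
      _ = _ := by rw [div_pow, one_div_pow]; field_simp
  refine ⟨ρ / 2, by positivity, fun z hz j ↦ ?_⟩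
  have hzero : ∫ z in Metric.ball (0 : ℂ) (ρ / 2), ‖u j z‖ ≤ 0 := by
    refine ge_of_tendsto' (x := Filter.atTop) (f := fun N : ℕ ↦ (1 / 2 : ℝ) ^ (N + 1) * (2 * (c * (2 * ρ)) * H)) ?_
      fun N ↦ key (N + 1) (by simp) j
    have : Filter.Tendsto (fun N : ℕ ↦ (1 / 2 : ℝ) ^ (N + 1)) Filter.atTop (nhds 0) :=
      (tendsto_pow_atTop_nhds_zero_of_lt_one (by norm_num) (by norm_num)).comp
        (Filter.tendsto_add_atTop_nat 1)
    simpa using this.mul_const (2 * (c * (2 * ρ)) * H)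
  have hzero' : ∫ z in Metric.ball (0 : ℂ) (ρ / 2), ‖u j z‖ = 0 :=
    le_antisymm hzero (integral_nonneg fun _ ↦ norm_nonneg _)
  have hio : IntegrableOn (fun z ↦ ‖u j z‖) (Metric.ball (0 : ℂ) (ρ / 2)) :=
    ((hu j).continuous.norm.locallyIntegrable.integrableOn_isCompact
            (isCompact_closedBall 0 (ρ / 2))).mono_set Metric.ball_subset_closedBall
  rw [integral_eq_zero_iff_of_nonneg (fun _ ↦ norm_nonneg _) hio] at hzero'
  have h10 := Measure.eqOn_open_of_ae_eq hzero' Metric.isOpen_ball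
    (hu j).continuous.norm.continuousOn continuousOn_const (by simpa using hz)
  simpa using h10

/-- Iterated partial derivatives; `false` stands for `x` and `true` for `y`. -/
def pd : List Bool → (ℂ → ℂ) → ℂ → ℂ
  | [], F => F
  | e :: w, F => pd w fun z ↦ fderiv ℝ F z (if e then I else 1)

lemma contDiff_fderiv_apply {F : ℂ → ℂ} (hF : ContDiff ℝ ∞ F) (e : ℂ) :
    ContDiff ℝ ∞ fun z ↦ fderiv ℝ F z e :=
  (hF.fderiv_right (m := ∞) (by simp)).clm_apply contDiff_const

lemma continuous_pd (w : List Bool) {F : ℂ → ℂ} (hF : ContDiff ℝ ∞ F) : Continuous (pd w F) := by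
  induction w generalizing F with
  | nil => exact hF.continuous
  | cons e w ih => exact ih (contDiff_fderiv_apply hF _)

lemma norm_fderiv_le_add (L : ℂ →L[ℝ] ℂ) : ‖L‖ ≤ ‖L 1‖ + ‖L I‖ := by
  refine L.opNorm_le_bound (by positivity) fun v ↦ ?_
  have hv : L v = v.re • L 1 + v.im • L I := by
    rw [← L.map_smul, ← L.map_smul, ← L.map_add]
    congr 1
    apply Complex.ext <;> simp
  rw [hv]
  refine (norm_add_le _ _).trans ?_
  rw [norm_smul, norm_smul, add_mul]
  refine add_le_add ?_ ?_
  · rw [mul_comm]; gcongr; exact abs_re_le_norm v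
  · rw [mul_comm]; gcongr; exact abs_im_le_norm v

/-- A function with vanishing Taylor series vanishes to infinite order. -/
lemma flat_of_pd_eq_zero (m : ℕ) {F : ℂ → ℂ} (hF : ContDiff ℝ ∞ F) (h : ∀ w, pd w F 0 = 0) :
    ∃ K, 0 ≤ K ∧ ∀ z, ‖z‖ < 1 → ‖F z‖ ≤ K * ‖z‖ ^ m := by
  induction m generalizing F with
  | zero =>
    obtain ⟨K, hK⟩ := (isCompact_closedBall (0 : ℂ) 1).exists_bound_of_continuousOn
      hF.continuous.continuousOn
    exact ⟨K, (norm_nonneg _).trans (hK 0 (by simp)), fun z hz ↦ by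
      simpa using hK z (by simpa using hz.le)⟩
  | succ m ih =>
    obtain ⟨K₁, hK₁0, hK₁⟩ := ih (contDiff_fderiv_apply hF 1) fun w ↦ by
      simpa [pd] using h (false :: w)
    obtain ⟨K₂, hK₂0, hK₂⟩ := ih (contDiff_fderiv_apply hF I) fun w ↦ by
      simpa [pd] using h (true :: w)
    refine ⟨K₁ + K₂, by positivity, fun z hz ↦ ?_⟩
    have h0 : F 0 = 0 := h []
    have hb : ∀ x ∈ Metric.closedBall (0 : ℂ) ‖z‖, ‖fderiv ℝ F x‖ ≤ (K₁ + K₂) * ‖z‖ ^ m := by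
      intro x hx
      rw [mem_closedBall_zero_iff] at hx
      refine (norm_fderiv_le_add _).trans ?_
      rw [add_mul]
      refine add_le_add ((hK₁ x (hx.trans_lt hz)).trans ?_) ((hK₂ x (hx.trans_lt hz)).trans ?_) <;>
      gcongr
    have := (convex_closedBall (0 : ℂ) ‖z‖).norm_image_sub_le_of_norm_fderiv_le (𝕜 := ℝ)
      (fun x _ ↦ hF.differentiable (by simp) x) hb (x := 0) (y := z) (by simp) (by simp)
    rw [h0, sub_zero, sub_zero] at this
    rw [pow_succ, ← mul_assoc]
    exact this

lemma pd_comp_add (w : List Bool) (F : ℂ → ℂ) (a z : ℂ) :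
    pd w (fun z ↦ F (z + a)) z = pd w F (z + a) := by
  induction w generalizing F with
  | nil => rfl
  | cons e w ih => simp only [pd, fderiv_comp_add_right]; exact ih fun z ↦ fderiv ℝ F z _

/-- Strong unique continuation for the differential inequality `|∂̄u| ≤ C |u|`. -/
theorem eventually_eq_zero_of_pd_eq_zero {ι : Type*} [Fintype ι] {u : ι → ℂ → ℂ}
    (hu : ∀ j, ContDiff ℝ ∞ (u j)) {C : ℝ} (hC : 0 ≤ C) {z₀ : ℂ}
    (hineq : ∀ᶠ z in nhds z₀, ∀ j, ‖dbar (u j) z‖ ≤ C * ∑ k, ‖u k z‖)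
    (hpd : ∀ w j, pd w (u j) z₀ = 0) : ∀ᶠ z in nhds z₀, ∀ j, u j z = 0 := by
  obtain ⟨r, hr, hball⟩ := Metric.eventually_nhds_iff.1 hineq
  have hu' : ∀ j, ContDiff ℝ ∞ fun z ↦ u j (z + z₀) := fun j ↦
    (hu j).comp (contDiff_id.add contDiff_const)
  have h1 : ∀ z, ‖z‖ < r → ∀ j, ‖dbar (fun z ↦ u j (z + z₀)) z‖ ≤ C * ∑ k, ‖u k (z + z₀)‖ := by
    intro z hz j
    have := hball (y := z + z₀) (by simpa using hz) j
    simpa only [dbar, fderiv_comp_add_right] using this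
  have h2 : ∀ N j, ∃ K, ∀ z, ‖z‖ < 1 → ‖u j (z + z₀)‖ ≤ K * ‖z‖ ^ N ∧
      ‖fderiv ℝ (fun z ↦ u j (z + z₀)) z‖ ≤ K * ‖z‖ ^ N := by
    intro N j
    have h0 : ∀ w, pd w (fun z ↦ u j (z + z₀)) 0 = 0 := fun w ↦ by
      rw [pd_comp_add, zero_add, hpd]
    obtain ⟨K, hK0, hK⟩ := flat_of_pd_eq_zero N (hu' j) h0
    obtain ⟨K₁, hK₁0, hK₁⟩ := flat_of_pd_eq_zero N (contDiff_fderiv_apply (hu' j) 1) fun w ↦ by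
      simpa [pd] using h0 (false :: w)
    obtain ⟨K₂, hK₂0, hK₂⟩ := flat_of_pd_eq_zero N (contDiff_fderiv_apply (hu' j) I) fun w ↦ by
      simpa [pd] using h0 (true :: w)
    refine ⟨K + (K₁ + K₂), fun z hz ↦ ⟨(hK z hz).trans ?_, ?_⟩⟩
    · gcongr; linarith
    · refine ((norm_fderiv_le_add _).trans (add_le_add (hK₁ z hz) (hK₂ z hz))).trans ?_
      rw [← add_mul]
      exact mul_le_mul_of_nonneg_right (by linarith) (by positivity)
  obtain ⟨ρ, hρ, h⟩ := eventually_eq_zero_of_flat_zero hu' hC hr h1 h2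
  rw [Metric.eventually_nhds_iff]
  refine ⟨ρ, hρ, fun z hz j ↦ ?_⟩
  simpa using h (z - z₀) (by rwa [← dist_eq_norm]) j

/-- Almost every zero of a function is a zero of its derivative. -/
lemma ae_fderiv_eq_zero {F : ℂ → ℂ} (hF : ContDiff ℝ ∞ F) : ∀ᵐ z, F z = 0 → fderiv ℝ F z = 0 := by
  have hS : MeasurableSet {z | F z = 0} :=
    (isClosed_eq hF.continuous continuous_const).measurableSet
  -- On its zero set `F` is approximated by the zero map with error constant `0`. The almost
  -- everywhere bound on the derivative of such a map, a density point argument, then gives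
  -- derivative zero.
  have happ : ApproximatesLinearOn F (0 : ℂ →L[ℝ] ℂ) {z | F z = 0} 0 := by
    intro x hx y hy
    simp only [mem_ofPred_eq] at hx hy
    simp [hx, hy]
  have h := happ.norm_fderiv_sub_le volume hS (fderiv ℝ F) fun x _ ↦
    (hF.differentiable (by simp) x).hasFDerivAt.hasFDerivWithinAt
  rw [ae_restrict_iff' hS] at h
  filter_upwards [h] with z hz h0
  simpa using hz h0

/-- Up to a null set, the zeros of `F` are zeros of each first partial derivative, to which the
induction hypothesis applies. -/
lemma ae_pd_eq_zero (w : List Bool) {F : ℂ → ℂ} (hF : ContDiff ℝ ∞ F) :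
    ∀ᵐ z, F z = 0 → pd w F z = 0 := by
  induction w generalizing F with
  | nil => exact Filter.Eventually.of_forall fun z h ↦ h
  | cons e w ih =>
    filter_upwards [ae_fderiv_eq_zero hF, ih (contDiff_fderiv_apply hF (if e then I else 1))]
      with z h1 h2 h0
    exact h2 (by rw [h1 h0]; rfl)

lemma pd_eq_zero_of_eventually (w : List Bool) {F : ℂ → ℂ} {z : ℂ} (h : ∀ᶠ x in nhds z, F x = 0) :
    pd w F z = 0 := by
  induction w generalizing F with
  | nil => exact h.self_of_nhds
  | cons e w ih =>
    refine ih ?_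
    filter_upwards [h.eventually_nhds] with x hx
    have : F =ᶠ[nhds x] fun _ ↦ 0 := hx
    rw [this.fderiv_eq]; simp

end UniqueContinuation

/-! ### The zeros of the differential of a harmonic map form a null set -/

section HarmonicZeros

open Complex Set

variable {n : ℕ} {M : Type*} [TopologicalSpace M] [ChartedSpace (EE n) M]
  [IsManifold (𝓡 n) ∞ M] {F : ℂ → M}

/-- A map which is smooth near a point agrees near that point with a globally smooth one. -/
lemma exists_contDiff_eventuallyEq {E : Type*} [NormedAddCommGroup E] [NormedSpace ℝ E] {X : ℂ → E}
    {z₀ : ℂ} (h : ∀ᶠ z in nhds z₀, ContDiffAt ℝ ∞ X z) :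
    ∃ Y : ℂ → E, ContDiff ℝ ∞ Y ∧ Y =ᶠ[nhds z₀] X := by
  obtain ⟨r, hr, hball⟩ := Metric.eventually_nhds_iff_ball.1 h
  let χ : ContDiffBump z₀ := ⟨r / 4, r / 2, by positivity, by linarith⟩
  refine ⟨fun z ↦ χ z • X z, contDiff_iff_contDiffAt.2 fun z ↦ ?_, ?_⟩
  · by_cases hz : z ∈ tsupport χ
    · refine χ.contDiff.contDiffAt.smul (hball z ?_)
      rw [χ.tsupport_eq] at hz
      refine Metric.closedBall_subset_ball ?_ hz
      change r / 2 < r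
      linarith
    · have : (fun z ↦ χ z • X z) =ᶠ[nhds z] fun _ ↦ 0 := by
        filter_upwards [(isClosed_tsupport χ).isOpen_compl.mem_nhds hz] with w hw
        rw [image_eq_zero_of_notMem_tsupport hw, zero_smul]
      exact contDiffAt_const.congr_of_eventuallyEq this
  · filter_upwards [χ.eventuallyEq_one] with z hz
    rw [hz, Pi.one_apply, one_smul]

/-- The complex derivative `∂_x - i ∂_y` of the components of a harmonic map satisfies the
hypothesis of the unique continuation theorem. -/
lemma exists_dbar_system (g : RMetric n M) (hF : ContMDiff 𝓘(ℝ, ℂ) (𝓡 n) ∞ F)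
    (hh : ∀ z, cov g F (du F 1) 1 z + cov g F (du F I) I z = 0) (z₀ : ℂ) :
    ∃ (u : Fin n → ℂ → ℂ) (C : ℝ), 0 ≤ C ∧ (∀ j, ContDiff ℝ ∞ (u j)) ∧
      (∀ᶠ z in nhds z₀, ∀ j, ‖dbar (u j) z‖ ≤ C * ∑ k, ‖u k z‖) ∧
      ∀ᶠ z in nhds z₀, (∀ j, u j z = 0) ↔ du (n := n) F 1 z = 0 ∧ du (n := n) F I z = 0 := by
  set p := F z₀ with hp
  have hsrc : ∀ᶠ z in nhds z₀, F z ∈ (extChartAt (𝓡 n) p).source :=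
    hF.continuous.continuousAt.preimage_mem_nhds (source_mem_nhds' (mem_extChartAt_source p))
  -- The coordinates of `F` make sense only near `z₀`, while the unique continuation theorem is
  -- stated for functions smooth on all of `ℂ`.
  obtain ⟨Y, hY, hYX⟩ := exists_contDiff_eventuallyEq
    (hsrc.mono fun z hz ↦ contDiffAt_chart_comp (hF z) hz)
  have hYe : ∀ e, ContDiff ℝ ∞ fun z ↦ fderiv ℝ Y z e := fun e ↦
    (hY.fderiv_right (m := ∞) (by simp)).clm_apply contDiff_const
  have hdu : ∀ᶠ z in nhds z₀, ∀ e, tc p (F z) (du F e z) = fderiv ℝ Y z e := by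
    filter_upwards [hsrc, hYX.eventually_nhds] with z hz hz' e
    rw [tc_du ((hF z).mdifferentiableAt (by simp)) hz, Filter.EventuallyEq.fderiv_eq hz']
  -- This is `2 ∂_z Y`, so `dbar u` is the Laplacian of `Y`. By the harmonic map equation it equals
  -- `-Γ(Y_x, Y_x) - Γ(Y_y, Y_y)`, which is quadratic in the gradient; bounding one factor locally
  -- by `D` leaves an expression linear in `|u|`.
  let u : Fin n → ℂ → ℂ := fun j z ↦ (fderiv ℝ Y z 1 j : ℂ) - I * (fderiv ℝ Y z I j : ℂ)
  have hcoord : ∀ (e : ℂ) (j : Fin n), ContDiff ℝ ∞ fun z ↦ (fderiv ℝ Y z e j : ℂ) := fun e j ↦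
    ofRealCLM.contDiff.comp ((EuclideanSpace.proj (𝕜 := ℝ) j).contDiff.comp (hYe e))
  have hre : ∀ j z, ‖fderiv ℝ Y z 1 j‖ ≤ ‖u j z‖ := fun j z ↦ by
    simpa [u] using abs_re_le_norm (u j z)
  have him : ∀ j z, ‖fderiv ℝ Y z I j‖ ≤ ‖u j z‖ := fun j z ↦ by
    simpa [u] using abs_im_le_norm (u j z)
  have hnorm : ∀ v : EE n, ‖v‖ ≤ ∑ k, ‖v k‖ := by
    intro v
    have : v = ∑ k, v k • EuclideanSpace.single k (1 : ℝ) := by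
      ext j; simp [Finset.sum_apply, Pi.single_apply]
    calc ‖v‖ = ‖∑ k, v k • EuclideanSpace.single k (1 : ℝ)‖ := by rw [← this]
      _ ≤ ∑ k, ‖v k • EuclideanSpace.single k (1 : ℝ)‖ := norm_sum_le _ _
      _ = _ := by simp [norm_smul]
  have hd1 : ∀ z, ‖fderiv ℝ Y z 1‖ ≤ ∑ k, ‖u k z‖ := fun z ↦
    (hnorm _).trans (Finset.sum_le_sum fun k _ ↦ hre k z)
  have hd2 : ∀ z, ‖fderiv ℝ Y z I‖ ≤ ∑ k, ‖u k z‖ := fun z ↦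
    (hnorm _).trans (Finset.sum_le_sum fun k _ ↦ him k z)
  set G := gramL g p
  have hYp : Y z₀ = extChartAt (𝓡 n) p p := hYX.self_of_nhds
  have hgam : ContinuousAt (fun z ↦ gamL G (Y z)) z₀ := by
    refine ContinuousAt.comp (g := gamL G) ?_ hY.continuous.continuousAt
    rw [hYp]
    exact ((localMetric g p).contDiffAt_gamL (mem_extChartAt_target p)).continuousAt
  have hK : ∀ᶠ z in nhds z₀, ‖gamL G (Y z)‖ < ‖gamL G (Y z₀)‖ + 1 :=
    hgam.norm.eventually_lt continuousAt_const (by simp)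
  have hD : ∀ᶠ z in nhds z₀, ‖fderiv ℝ Y z‖ < ‖fderiv ℝ Y z₀‖ + 1 :=
    ((hY.continuous_fderiv (by simp)).continuousAt (x := z₀)).norm.eventually_lt
      continuousAt_const (by simp)
  set K := ‖gamL G (Y z₀)‖ + 1 with hKdef
  set D := ‖fderiv ℝ Y z₀‖ + 1 with hDdef
  have hK0 : 0 ≤ K := by positivity
  have hD0 : 0 ≤ D := by positivity
  refine ⟨u, 2 * (K * D), by positivity, fun j ↦ (hcoord 1 j).sub (contDiff_const.mul (hcoord I j)),
    ?_, ?_⟩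
  · filter_upwards [hsrc, hK, hD, hdu.eventually_nhds, hYX.eventually_nhds] with z hz hzK hzD hzu hzX j
    have htc : ∀ e, tc p (F z) (cov g F (du F e) e z) = fderiv ℝ (fun ζ ↦ fderiv ℝ Y ζ e) z e
        + gamL G (Y z) (fderiv ℝ Y z e) (fderiv ℝ Y z e) := by
      intro e
      rw [tc_cov g (smoothField_du hF e) hz, covL_congr (w := fun ζ ↦ fderiv ℝ Y ζ e)
        (hzu.mono fun ζ hζ ↦ hζ e)]
      rw [covL, ← Filter.EventuallyEq.fderiv_eq hzX, ← hzX.self_of_nhds, gam_eq_gamL]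
    have hsum := congrArg (tc p (F z)) (hh z)
    rw [map_add, map_zero, htc, htc] at hsum
    set A : EE n := gamL G (Y z) (fderiv ℝ Y z 1) (fderiv ℝ Y z 1)
      + gamL G (Y z) (fderiv ℝ Y z I) (fderiv ℝ Y z I) with hA
    have hlap : fderiv ℝ (fun ζ ↦ fderiv ℝ Y ζ 1) z 1 + fderiv ℝ (fun ζ ↦ fderiv ℝ Y ζ I) z I
        = - A := by
      rw [eq_neg_iff_add_eq_zero, ← hsum, hA]; abel
    have hdY : HasFDerivAt (fderiv ℝ Y) (fderiv ℝ (fderiv ℝ Y) z) z :=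
      ((hY.fderiv_right (m := ∞) (by simp)).differentiable (by simp) z).hasFDerivAt
    have hsec : ∀ e e', fderiv ℝ (fun ζ ↦ fderiv ℝ Y ζ e) z e' = fderiv ℝ (fderiv ℝ Y) z e' e := by
      intro e e'
      rw [(hdY.clm_apply (hasFDerivAt_const e z)).fderiv]
      simp
    have hsymm : fderiv ℝ (fun ζ ↦ fderiv ℝ Y ζ 1) z I = fderiv ℝ (fun ζ ↦ fderiv ℝ Y ζ I) z 1 := by
      rw [hsec, hsec]
      exact (hY.contDiffAt.isSymmSndFDerivAt minSmoothness_two_le_infty) I 1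
    have hcd : ∀ e, HasFDerivAt (fun z ↦ (fderiv ℝ Y z e j : ℂ))
        (ofRealCLM.comp ((EuclideanSpace.proj (𝕜 := ℝ) j).comp (fderiv ℝ (fun ζ ↦ fderiv ℝ Y ζ e) z)))
        z := fun e ↦ ofRealCLM.hasFDerivAt.comp z ((EuclideanSpace.proj (𝕜 := ℝ) j).hasFDerivAt.comp z
          ((hYe e).differentiable (by simp) z).hasFDerivAt)
    have hdb : dbar (u j) z = ((- A) j : ℝ) := by
      have hproj : ∀ v : EE n, EuclideanSpace.proj (𝕜 := ℝ) j v = v j := fun _ ↦ rfl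
      have h1 : HasFDerivAt (u j) _ z := (hcd 1).sub ((hcd I).const_mul I)
      rw [dbar, h1.fderiv, ← hlap]
      simp only [ContinuousLinearMap.coe_comp, sub_apply, smul_apply,
        Function.comp_apply, ofRealCLM_apply, hproj, hsymm, PiLp.add_apply,
        ofReal_add, smul_eq_mul]
      linear_combination (-(fderiv ℝ (fun ζ ↦ fderiv ℝ Y ζ I) z I j : ℂ)) * I_sq
    rw [hdb, norm_real, PiLp.neg_apply, norm_neg]
    have hb : ∀ e, ‖e‖ = 1 → ‖fderiv ℝ Y z e‖ ≤ ∑ k, ‖u k z‖ →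
        ‖gamL G (Y z) (fderiv ℝ Y z e) (fderiv ℝ Y z e)‖ ≤ K * D * ∑ k, ‖u k z‖ := by
      intro e he hle
      calc _ ≤ ‖gamL G (Y z)‖ * ‖fderiv ℝ Y z e‖ * ‖fderiv ℝ Y z e‖ :=
            ContinuousLinearMap.le_opNorm₂ _ _ _
        _ ≤ K * D * ∑ k, ‖u k z‖ := by
            gcongr
            calc ‖fderiv ℝ Y z e‖ ≤ ‖fderiv ℝ Y z‖ * ‖e‖ := ContinuousLinearMap.le_opNorm _ _
              _ ≤ D := by rw [he, mul_one]; exact hzD.le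
    calc ‖A j‖ ≤ ‖A‖ := PiLp.norm_apply_le A j
      _ ≤ K * D * ∑ k, ‖u k z‖ + K * D * ∑ k, ‖u k z‖ :=
        (norm_add_le _ _).trans (add_le_add (hb 1 (by simp) (hd1 z)) (hb I (by simp) (hd2 z)))
      _ = _ := by ring
  · filter_upwards [hsrc, hdu] with z hz hzu
    constructor
    · intro h0
      have hs : ∑ k, ‖u k z‖ = 0 := Finset.sum_eq_zero fun k _ ↦ by rw [h0 k, norm_zero]
      have h1 : fderiv ℝ Y z 1 = 0 := norm_le_zero_iff.1 (hs ▸ hd1 z)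
      have h2 : fderiv ℝ Y z I = 0 := norm_le_zero_iff.1 (hs ▸ hd2 z)
      exact ⟨tc_injective hz (by rw [hzu, h1, map_zero]), tc_injective hz (by rw [hzu, h2, map_zero])⟩
    · rintro ⟨h1, h2⟩ j
      have h1' : fderiv ℝ Y z 1 = 0 := by rw [← hzu, h1, map_zero]
      have h2' : fderiv ℝ Y z I = 0 := by rw [← hzu, h2, map_zero]
      simp [u, h1', h2']

/-- The zeros of the differential of a harmonic map are a null set, unless the differential
vanishes identically. -/
theorem volume_zeros_eq_zero (g : RMetric n M) (hF : ContMDiff 𝓘(ℝ, ℂ) (𝓡 n) ∞ F)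
    (hh : ∀ z, cov g F (du F 1) 1 z + cov g F (du F I) I z = 0)
    (hne : ∃ z, ¬ (du (n := n) F 1 z = 0 ∧ du (n := n) F I z = 0)) :
    volume {z | du (n := n) F 1 z = 0 ∧ du (n := n) F I z = 0} = 0 := by
  set Z := {z | du (n := n) F 1 z = 0 ∧ du (n := n) F I z = 0} with hZ
  by_contra hvol
  -- Every neighbourhood of `z₀` meets `Z` in positive measure, and almost all zeros of `u` are
  -- zeros of all its derivatives. Hence a zero of infinite order exists near `z₀`, and unique
  -- continuation makes it an interior point of `Z`.
  obtain ⟨z₀, -, hz₀⟩ := exists_mem_forall_mem_nhdsWithin_pos_measure hvol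
  have hint : (interior Z).Nonempty := by
    obtain ⟨u, C, hC, hu, hineq, hiff⟩ := exists_dbar_system g hF hh z₀
    have hae : ∀ᵐ z, ∀ w j, u j z = 0 → pd w (u j) z = 0 := by
      rw [ae_all_iff]; intro w
      rw [ae_all_iff]; intro j
      exact ae_pd_eq_zero w (hu j)
    have hU : {z | (∀ᶠ x in nhds z, ∀ j, ‖dbar (u j) x‖ ≤ C * ∑ k, ‖u k x‖) ∧
        ∀ᶠ x in nhds z, (∀ j, u j x = 0) ↔ du (n := n) F 1 x = 0 ∧ du (n := n) F I x = 0}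
        ∈ nhds z₀ := hineq.eventually_nhds.and hiff.eventually_nhds
    have hpos := hz₀ _ (Filter.inter_mem (mem_nhdsWithin_of_mem_nhds hU) self_mem_nhdsWithin)
    obtain ⟨z, ⟨⟨h1, h2⟩, hzZ⟩, h3⟩ := (frequently_ae_iff.2 hpos.ne').and_eventually hae |>.exists
    have h0 : ∀ j, u j z = 0 := h2.self_of_nhds.2 hzZ
    have h4 := eventually_eq_zero_of_pd_eq_zero hu hC h1 fun w j ↦ h3 w j (h0 j)
    exact ⟨z, mem_interior_iff_mem_nhds.2 (by
      filter_upwards [h2, h4] with x hx hx' using hx.1 hx')⟩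
  -- At a limit of interior points all derivatives of `u` vanish by continuity, so unique
  -- continuation applies again there. Connectedness of the plane then excludes a nonempty interior,
  -- by `hne`.
  have hclosed : IsClosed (interior Z) := by
    rw [← closure_subset_iff_isClosed]
    intro z hz
    obtain ⟨u, C, hC, hu, hineq, hiff⟩ := exists_dbar_system g hF hh z
    have hpd : ∀ w j, pd w (u j) z = 0 := by
      intro w j
      have hcl : IsClosed {x | pd w (u j) x = 0} :=
        isClosed_eq (continuous_pd w (hu j)) continuous_const
      suffices h : z ∈ {x | pd w (u j) x = 0} from h
      refine hcl.mem_of_frequently_of_tendsto (b := nhds z) (f := id) ?_ Filter.tendsto_id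
      refine ((mem_closure_iff_frequently.1 hz).and_eventually hiff.eventually_nhds).mono ?_
      rintro x ⟨hx1, hx2⟩
      refine pd_eq_zero_of_eventually w ?_
      filter_upwards [hx2, mem_interior_iff_mem_nhds.1 hx1] with y hy hyZ using hy.2 hyZ j
    have h4 := eventually_eq_zero_of_pd_eq_zero hu hC hineq hpd
    exact mem_interior_iff_mem_nhds.2 (by
      filter_upwards [hiff, h4] with x hx hx' using hx.1 hx')
  have huniv : interior Z = univ := IsClopen.eq_univ ⟨hclosed, isOpen_interior⟩ hint
  obtain ⟨z, hz⟩ := hne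
  have hz' : z ∈ interior Z := by rw [huniv]; trivial
  have hz'' : z ∈ Z := interior_subset hz'
  exact hz hz''

end HarmonicZeros

/-! ### The two stereographic coordinates of the sphere -/

section Sphere

open Complex Set

lemma one_add_normSq_pos (z : ℂ) : 0 < 1 + normSq z := by
  have := normSq_nonneg z
  linarith

lemma contDiff_normSq : ContDiff ℝ ∞ (normSq : ℂ → ℝ) := by
  have : (normSq : ℂ → ℝ) = fun z ↦ reCLM z * reCLM z + imCLM z * imCLM z := by
    funext z; simp [normSq_apply]
  rw [this]
  exact (reCLM.contDiff.mul reCLM.contDiff).add (imCLM.contDiff.mul imCLM.contDiff)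

lemma contMDiff_stereo : ContMDiff 𝓘(ℝ, ℂ) (𝓡 2) ∞ stereo := by
  have h : ContDiff ℝ ∞ fun z ↦ (stereo z : EuclideanSpace ℝ (Fin 3)) := by
    refine ContDiff.smul ((contDiff_const.add contDiff_normSq).inv
      fun z ↦ (one_add_normSq_pos z).ne') (contDiff_euclidean.2 fun i ↦ ?_)
    fin_cases i
    · exact contDiff_const.mul reCLM.contDiff
    · exact contDiff_const.mul imCLM.contDiff
    · exact contDiff_const.sub contDiff_normSq
  exact h.contMDiff.codRestrict_sphere fun z ↦ (stereo z).2

/-- The rotation of the sphere about the first axis which exchanges the poles; it maps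
`stereo z⁻¹` to `stereo z`. -/
def flip (x : S2) : S2 :=
  ⟨!₂[(x : EuclideanSpace ℝ (Fin 3)) 0, -(x : EuclideanSpace ℝ (Fin 3)) 1,
    -(x : EuclideanSpace ℝ (Fin 3)) 2], by
    have h : ‖(x : EuclideanSpace ℝ (Fin 3))‖ = 1 := by simp
    rw [mem_sphere_zero_iff_norm]
    refine Eq.trans ?_ h
    rw [EuclideanSpace.norm_eq, EuclideanSpace.norm_eq]
    simp [Fin.sum_univ_three]⟩

lemma contMDiff_flip : ContMDiff (𝓡 2) (𝓡 2) ∞ flip := by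
  have hl : ContDiff ℝ ∞ fun x : EuclideanSpace ℝ (Fin 3) ↦
      (!₂[x 0, -x 1, -x 2] : EuclideanSpace ℝ (Fin 3)) := by
    refine contDiff_euclidean.2 fun i ↦ ?_
    have hp : ∀ j, ContDiff ℝ ∞ fun x : EuclideanSpace ℝ (Fin 3) ↦ x j := fun j ↦
      (EuclideanSpace.proj (𝕜 := ℝ) j).contDiff
    fin_cases i
    exacts [hp 0, (hp 1).neg, (hp 2).neg]
  exact (hl.contMDiff.comp contMDiff_coe_sphere).codRestrict_sphere fun x ↦ (flip x).2

lemma stereo_coord (z : ℂ) (i : Fin 3) : (stereo z : EuclideanSpace ℝ (Fin 3)) i =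
    (1 + normSq z)⁻¹ * (![2 * z.re, 2 * z.im, 1 - normSq z] i) := rfl

lemma stereo_eq_flip {z : ℂ} (hz : z ≠ 0) : stereo z = flip (stereo z⁻¹) := by
  have h0 : normSq z ≠ 0 := by simpa using hz
  have h1 := (one_add_normSq_pos z).ne'
  have h2 := (one_add_normSq_pos z⁻¹).ne'
  rw [normSq_inv] at h2
  apply Subtype.ext
  ext i
  have hf : ∀ i, (flip (stereo z⁻¹) : EuclideanSpace ℝ (Fin 3)) i =
    ![(stereo z⁻¹ : EuclideanSpace ℝ (Fin 3)) 0, -(stereo z⁻¹ : EuclideanSpace ℝ (Fin 3)) 1,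
      -(stereo z⁻¹ : EuclideanSpace ℝ (Fin 3)) 2] i := fun _ ↦ rfl
  rw [hf]
  have h3 : normSq z + 1 ≠ 0 := by rwa [add_comm]
  fin_cases i <;> simp [stereo_coord, inv_re, inv_im] <;> field_simp <;> ring

/-- The coordinate `z` on the sphere minus the south pole. -/
def coord (x : S2) : ℂ := ⟨(x : EuclideanSpace ℝ (Fin 3)) 0 / (1 + (x : EuclideanSpace ℝ (Fin 3)) 2),
  (x : EuclideanSpace ℝ (Fin 3)) 1 / (1 + (x : EuclideanSpace ℝ (Fin 3)) 2)⟩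

lemma coord_stereo (z : ℂ) : coord (stereo z) = z := by
  have h1 := (one_add_normSq_pos z).ne'
  have h2 : 1 + (1 + normSq z)⁻¹ * (1 - normSq z) = 2 * (1 + normSq z)⁻¹ := by
    field_simp; ring
  apply Complex.ext <;> simp [coord, stereo_coord, h2] <;> field_simp

lemma sphere_eq (x : S2) : (x : EuclideanSpace ℝ (Fin 3)) 0 ^ 2 + (x : EuclideanSpace ℝ (Fin 3)) 1 ^ 2
    + (x : EuclideanSpace ℝ (Fin 3)) 2 ^ 2 = 1 := by
  have h : ‖(x : EuclideanSpace ℝ (Fin 3))‖ = 1 := by simp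
  have h2 := EuclideanSpace.norm_sq_eq (x : EuclideanSpace ℝ (Fin 3))
  rw [h] at h2
  simpa [Fin.sum_univ_three] using h2.symm

lemma stereo_coord_eq {x : S2} (hx : 1 + (x : EuclideanSpace ℝ (Fin 3)) 2 ≠ 0) :
    stereo (coord x) = x := by
  have h := sphere_eq x
  set a := (x : EuclideanSpace ℝ (Fin 3)) 0 with ha
  set b := (x : EuclideanSpace ℝ (Fin 3)) 1 with hb
  set c := (x : EuclideanSpace ℝ (Fin 3)) 2 with hc
  have hn : normSq (coord x) = (1 - c) / (1 + c) := by
    rw [normSq_apply]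
    simp only [coord, ← ha, ← hb, ← hc]
    field_simp
    linarith
  have h3 : 1 + (1 - c) / (1 + c) = 2 / (1 + c) := by field_simp; ring
  apply Subtype.ext
  ext i
  rw [stereo_coord, hn, h3]
  fin_cases i
  · simp [coord, ← ha, ← hc]; field_simp
  · simp [coord, ← hb, ← hc]; field_simp
  · simp [← hc]; field_simp; ring

lemma contMDiffAt_coord {x : S2} (hx : 1 + (x : EuclideanSpace ℝ (Fin 3)) 2 ≠ 0) :
    ContMDiffAt (𝓡 2) 𝓘(ℝ, ℂ) ∞ coord x := by
  have hp : ∀ j, ContDiff ℝ ∞ fun x : EuclideanSpace ℝ (Fin 3) ↦ x j := fun j ↦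
      (EuclideanSpace.proj (𝕜 := ℝ) j).contDiff
  have hq : ∀ j, ContDiffAt ℝ ∞ (fun x : EuclideanSpace ℝ (Fin 3) ↦ x j / (1 + x 2)) x := fun j ↦
    (hp j).contDiffAt.div (contDiff_const.add (hp 2)).contDiffAt hx
  have hl : ContDiffAt ℝ ∞ (fun x : EuclideanSpace ℝ (Fin 3) ↦
      ((x 0 / (1 + x 2) : ℝ) : ℂ) + (x 1 / (1 + x 2) : ℝ) * I) x :=
    (ofRealCLM.contDiff.contDiffAt.comp _ (hq 0)).add
      ((ofRealCLM.contDiff.contDiffAt.comp _ (hq 1)).mul contDiffAt_const)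
  have h2 := ContMDiffAt.comp x hl.contMDiffAt (contMDiff_coe_sphere (m := ∞) (n := 2)).contMDiffAt
  refine h2.congr_of_eventuallyEq (Filter.Eventually.of_forall fun y ↦ ?_)
  exact (mk_eq_add_mul_I _ _)

lemma eq_flip_stereo_zero {x : S2} (hx : 1 + (x : EuclideanSpace ℝ (Fin 3)) 2 = 0) :
    x = flip (stereo 0) := by
  have h := sphere_eq x
  have hc : (x : EuclideanSpace ℝ (Fin 3)) 2 = -1 := by linarith
  rw [hc] at h
  have hs : ∀ a b : ℝ, a ^ 2 + b ^ 2 + (-1) ^ 2 = 1 → a = 0 ∧ b = 0 := by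
    intro a b hab
    have ha : a ^ 2 = 0 := by nlinarith [sq_nonneg a, sq_nonneg b]
    have hb : b ^ 2 = 0 := by nlinarith [sq_nonneg a, sq_nonneg b]
    exact ⟨by simpa using ha, by simpa using hb⟩
  obtain ⟨h0, h1⟩ := hs _ _ h
  apply Subtype.ext
  ext i
  have hf : ∀ i, (flip (stereo 0) : EuclideanSpace ℝ (Fin 3)) i =
    ![(stereo 0 : EuclideanSpace ℝ (Fin 3)) 0, -(stereo 0 : EuclideanSpace ℝ (Fin 3)) 1,
      -(stereo 0 : EuclideanSpace ℝ (Fin 3)) 2] i := fun _ ↦ rfl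
  rw [hf]
  fin_cases i <;> simp [stereo_coord, h0, h1, hc]

/-- Only the south pole is missed, and it is the limit of `flip (stereo w) = stereo w⁻¹` as `w → 0`.
Equalities of continuous maps therefore pass from the coordinate domain to the whole sphere. -/
lemma denseRange_stereo : DenseRange stereo := by
  intro x
  by_cases hx : 1 + (x : EuclideanSpace ℝ (Fin 3)) 2 = 0
  · rw [eq_flip_stereo_zero hx]
    have hc : ContinuousAt (fun w ↦ flip (stereo w)) 0 :=
      (contMDiff_flip.continuous.comp contMDiff_stereo.continuous).continuousAt
    have ht : Filter.Tendsto (fun w ↦ flip (stereo w)) (nhdsWithin 0 {0}ᶜ)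
        (nhds (flip (stereo 0))) := hc.tendsto.mono_left nhdsWithin_le_nhds
    refine mem_closure_of_tendsto ht ?_
    filter_upwards [self_mem_nhdsWithin] with w hw
    refine ⟨w⁻¹, ?_⟩
    rw [stereo_eq_flip (inv_ne_zero hw), inv_inv]
  · exact subset_closure ⟨coord x, stereo_coord_eq hx⟩

end Sphere

/-! ### Decay at infinity -/

section Decay

open Complex Set

variable {n : ℕ} {M : Type*} [TopologicalSpace M] [ChartedSpace (EE n) M]
  [IsManifold (𝓡 n) ∞ M] {f : S2 → M}

lemma contMDiff_comp_stereo (hf : ContMDiff (𝓡 2) (𝓡 n) ∞ f) :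
    ContMDiff 𝓘(ℝ, ℂ) (𝓡 n) ∞ fun ζ ↦ f (stereo ζ) := hf.comp contMDiff_stereo

lemma contMDiff_comp_flip_stereo (hf : ContMDiff (𝓡 2) (𝓡 n) ∞ f) :
    ContMDiff 𝓘(ℝ, ℂ) (𝓡 n) ∞ fun ζ ↦ f (flip (stereo ζ)) :=
  (hf.comp contMDiff_flip).comp contMDiff_stereo

lemma smoothField_comp_stereo {V : S2 → EE n}
    (hV : ContMDiff (𝓡 2) (𝓡 n).tangent ∞ (tb f V)) :
    SmoothField (fun ζ ↦ f (stereo ζ)) (fun ζ ↦ V (stereo ζ)) := hV.comp contMDiff_stereo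

lemma smoothField_comp_flip_stereo {V : S2 → EE n}
    (hV : ContMDiff (𝓡 2) (𝓡 n).tangent ∞ (tb f V)) :
    SmoothField (fun ζ ↦ f (flip (stereo ζ))) (fun ζ ↦ V (flip (stereo ζ))) :=
  (hV.comp contMDiff_flip).comp contMDiff_stereo

lemma du_eq_re_im (u : ℂ → M) (α z : ℂ) :
    du (n := n) u α z = α.re • du (n := n) u 1 z + α.im • du (n := n) u I z := by
  have hα : α = α.re • (1 : ℂ) + α.im • I := by
    apply Complex.ext <;> simp
  have h : ∀ L : ℂ →L[ℝ] EE n, L α = α.re • L 1 + α.im • L I := by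
    intro L
    conv_lhs => rw [hα]
    rw [map_add, map_smul, map_smul]
  exact h (mfderiv 𝓘(ℝ, ℂ) (𝓡 n) u z)

/-- The derivative of `f` at a point with coordinate `z`, in terms of the coordinate `z⁻¹`. -/
lemma du_comp_stereo (hf : ContMDiff (𝓡 2) (𝓡 n) ∞ f) {z : ℂ} (hz : z ≠ 0) (e : ℂ) :
    du (n := n) (fun ζ ↦ f (stereo ζ)) e z
      = du (n := n) (fun ζ ↦ f (flip (stereo ζ))) (-(z ^ 2)⁻¹ * e) z⁻¹ := by
  have h1 : (fun ζ ↦ f (stereo ζ)) =ᶠ[nhds z] (fun ζ ↦ f (flip (stereo ζ))) ∘ fun ζ : ℂ ↦ ζ⁻¹ := by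
    filter_upwards [isOpen_ne.mem_nhds hz] with ζ hζ
    rw [Function.comp_apply, stereo_eq_flip hζ]
  have h2 : HasMFDerivAt 𝓘(ℝ, ℂ) 𝓘(ℝ, ℂ) (fun ζ : ℂ ↦ ζ⁻¹) z _ :=
    ((hasDerivAt_inv hz).hasFDerivAt.restrictScalars ℝ).hasMFDerivAt
  have h3 := (((contMDiff_comp_flip_stereo hf) z⁻¹).mdifferentiableAt (by simp)).hasMFDerivAt
  rw [du, h1.mfderiv_eq, (HasMFDerivAt.comp z h3 h2).mfderiv]
  have h4 : ∀ L : ℂ →L[ℝ] EE n, L.comp (ContinuousLinearMap.restrictScalars ℝ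
      (ContinuousLinearMap.toSpanSingleton ℂ (-(z ^ 2)⁻¹))) e = L (-(z ^ 2)⁻¹ * e) := by
    intro L
    rw [ContinuousLinearMap.comp_apply]
    congr 1
    simp [mul_comm]
  exact h4 (mfderiv 𝓘(ℝ, ℂ) (𝓡 n) (fun ζ ↦ f (flip (stereo ζ))) z⁻¹)

lemma exists_bound_closedBall {h : ℂ → ℝ} (hh : Continuous h) :
    ∃ C, 0 ≤ C ∧ ∀ w, ‖w‖ ≤ 1 → |h w| ≤ C := by
  obtain ⟨C, hC⟩ := (isCompact_closedBall (0 : ℂ) 1).exists_bound_of_continuousOn hh.continuousOn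
  exact ⟨C, (norm_nonneg _).trans (hC 0 (by simp)), fun w hw ↦ hC w (by simpa using hw)⟩

lemma norm_neg_inv_sq (z : ℂ) : ‖-(z ^ 2)⁻¹‖ ^ 2 = (‖z‖ ^ 4)⁻¹ := by
  rw [norm_neg, norm_inv, norm_pow]; ring

/-- The first fundamental form decays like `|z|⁻⁴`. -/
lemma exists_ip_du_le (g : RMetric n M) (hf : ContMDiff (𝓡 2) (𝓡 n) ∞ f) :
    ∃ C, 0 ≤ C ∧ ∀ z e e', 1 ≤ ‖z‖ → ‖e‖ = 1 → ‖e'‖ = 1 →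
      |ip g (f (stereo z)) (du (n := n) (fun ζ ↦ f (stereo ζ)) e z)
        (du (n := n) (fun ζ ↦ f (stereo ζ)) e' z)| ≤ C * (‖z‖ ^ 4)⁻¹ := by
  have hF := contMDiff_comp_flip_stereo hf
  set F := fun ζ ↦ f (flip (stereo ζ)) with hFdef
  have hs := fun e : ℂ ↦ smoothField_du (n := n) hF e
  obtain ⟨C₁, h10, h1⟩ := exists_bound_closedBall ((hs 1).ip g (hs 1)).continuous
  obtain ⟨C₂, h20, h2⟩ := exists_bound_closedBall ((hs 1).ip g (hs I)).continuous
  obtain ⟨C₃, h30, h3⟩ := exists_bound_closedBall ((hs I).ip g (hs I)).continuous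
  -- By the chain rule for `z ↦ z⁻¹`, each derivative at `z` is a derivative in the other chart, at
  -- `z⁻¹` in the unit disc, in a direction of length `‖z‖⁻²`. The constants bound the coefficients
  -- of the form there; `C₂` serves both mixed terms.
  refine ⟨C₁ + C₂ + C₂ + C₃, by positivity, fun z e e' hz he he' ↦ ?_⟩
  have hz0 : z ≠ 0 := by rintro rfl; norm_num at hz
  have hw : ‖z⁻¹‖ ≤ 1 := by rw [norm_inv]; exact inv_le_one_of_one_le₀ hz
  rw [du_comp_stereo hf hz0, du_comp_stereo hf hz0, ← norm_neg_inv_sq z,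
    stereo_eq_flip hz0, du_eq_re_im F, du_eq_re_im F (_ * e')]
  set β := ‖-(z ^ 2)⁻¹‖ with hβ
  have hn : ∀ e : ℂ, ‖e‖ = 1 → |(-(z ^ 2)⁻¹ * e).re| ≤ β ∧ |(-(z ^ 2)⁻¹ * e).im| ≤ β := by
    intro e he
    have : ‖-(z ^ 2)⁻¹ * e‖ = β := by rw [norm_mul, he, mul_one]
    exact ⟨this ▸ abs_re_le_norm _, this ▸ abs_im_le_norm _⟩
  obtain ⟨ha, hb⟩ := hn e he
  obtain ⟨hc, hd⟩ := hn e' he'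
  set a := (-(z ^ 2)⁻¹ * e).re
  set b := (-(z ^ 2)⁻¹ * e).im
  set c := (-(z ^ 2)⁻¹ * e').re
  set d := (-(z ^ 2)⁻¹ * e').im
  have hβ0 : 0 ≤ β := norm_nonneg _
  have hp : ∀ {x y t C : ℝ}, |x| ≤ β → |y| ≤ β → |t| ≤ C → |x * y * t| ≤ C * β ^ 2 := by
    intro x y t C hx hy ht
    rw [abs_mul, abs_mul]
    calc |x| * |y| * |t| ≤ β * β * C := by gcongr
      _ = _ := by ring
  simp only [map_add, add_apply, map_smul, smul_apply, smul_eq_mul]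
  rw [ip_symm g _ (du F I z⁻¹) (du F 1 z⁻¹)]
  have e1 := hp ha hc (h1 _ hw)
  have e2 := hp ha hd (h2 _ hw)
  have e3 := hp hb hc (h2 _ hw)
  have e4 := hp hb hd (h3 _ hw)
  simp only [hFdef] at e1 e2 e3 e4 ⊢
  rw [abs_le] at e1 e2 e3 e4 ⊢
  constructor <;> nlinarith

/-- The curvature form decays like `|z|⁻⁴`. -/
lemma exists_rt_du_le (g : RMetric n M) (hf : ContMDiff (𝓡 2) (𝓡 n) ∞ f) {V W : S2 → EE n}
    (hV : ContMDiff (𝓡 2) (𝓡 n).tangent ∞ (tb f V))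
    (hW : ContMDiff (𝓡 2) (𝓡 n).tangent ∞ (tb f W)) :
    ∃ C, 0 ≤ C ∧ ∀ z, 1 ≤ ‖z‖ →
      |rt g (f (stereo z)) (du (n := n) (fun ζ ↦ f (stereo ζ)) 1 z)
        (du (n := n) (fun ζ ↦ f (stereo ζ)) I z) (V (stereo z)) (W (stereo z))|
        ≤ C * (‖z‖ ^ 4)⁻¹ := by
  have hF := contMDiff_comp_flip_stereo hf
  set F := fun ζ ↦ f (flip (stereo ζ)) with hFdef
  have hs := fun e : ℂ ↦ smoothField_du (n := n) hF e
  have hVs := smoothField_comp_flip_stereo hV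
  have hWs := smoothField_comp_flip_stereo hW
  obtain ⟨C, hC0, hC⟩ := exists_bound_closedBall
    (((hs 1).cv g (hs I) hVs).ip g hWs).continuous
  refine ⟨C, hC0, fun z hz ↦ ?_⟩
  have hz0 : z ≠ 0 := by rintro rfl; norm_num at hz
  have hw : ‖z⁻¹‖ ≤ 1 := by rw [norm_inv]; exact inv_le_one_of_one_le₀ hz
  rw [du_comp_stereo hf hz0, du_comp_stereo hf hz0, ← norm_neg_inv_sq z,
    stereo_eq_flip hz0, du_eq_re_im F, du_eq_re_im F (_ * I)]
  have hsq : ‖-(z ^ 2)⁻¹‖ ^ 2 = (-(z ^ 2)⁻¹).re ^ 2 + (-(z ^ 2)⁻¹).im ^ 2 := by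
    rw [← normSq_eq_norm_sq, normSq_apply]; ring
  rw [hsq]
  set α := -(z ^ 2)⁻¹
  have hself : ∀ a c d : EE n, rt g (F z⁻¹) a a c d = 0 := by
    intro a c d
    have := congrArg (fun v ↦ ip g (F z⁻¹) v d) (cv_antisymm g (F z⁻¹) a a c)
    simp only [map_neg, neg_apply] at this
    rw [rt]; linarith
  have hanti : ∀ a b c d : EE n, rt g (F z⁻¹) b a c d = - rt g (F z⁻¹) a b c d := by
    intro a b c d
    have := congrArg (fun v ↦ ip g (F z⁻¹) v d) (cv_antisymm g (F z⁻¹) b a c)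
    simp only [map_neg, neg_apply] at this
    exact this
  -- The curvature is alternating in its first pair, so multiplying the frame by the complex number
  -- `α` multiplies it by the determinant `|α|²`.
  have hexp : ∀ (A B c d : EE n), rt g (F z⁻¹) ((α * 1).re • A + (α * 1).im • B)
      ((α * I).re • A + (α * I).im • B) c d = (α.re ^ 2 + α.im ^ 2) * rt g (F z⁻¹) A B c d := by
    intro A B c d
    have h1 := hself A c d
    have h2 := hself B c d
    have h3 := hanti A B c d
    simp only [rt] at h1 h2 h3
    simp only [rt, cv_add_left, cv_add_mid, cv_smul_left, cv_smul_mid, map_add, map_smul, add_apply,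
      smul_apply, smul_eq_mul, h1, h2, h3]
    simp
    ring
  have h := hexp (du F 1 z⁻¹) (du F I z⁻¹) (V (flip (stereo z⁻¹))) (W (flip (stereo z⁻¹)))
  simp only [hFdef] at h ⊢
  rw [h, abs_mul, abs_of_nonneg (by positivity : 0 ≤ α.re ^ 2 + α.im ^ 2), mul_comm]
  exact mul_le_mul_of_nonneg_right (hC _ hw) (by positivity)

/-- Comparison with `(1 + ‖z‖)⁻⁴`, integrable because `4` exceeds the dimension `2`. The constant
`16 = 2⁴` comes from `1 + ‖z‖ ≤ 2 max(1, ‖z‖)`. -/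
lemma integrable_of_decay {h : ℂ → ℝ} (hc : Continuous h) {C : ℝ}
    (hC : ∀ z, 1 ≤ ‖z‖ → |h z| ≤ C * (‖z‖ ^ 4)⁻¹) : Integrable h := by
  obtain ⟨C', hC'0, hC'⟩ := exists_bound_closedBall hc
  have hC0 : 0 ≤ C := by simpa using (abs_nonneg _).trans (hC 1 (by simp))
  have hint := integrable_one_add_norm (E := ℂ) (μ := volume) (r := 4) (by
    rw [finrank_real_complex]; norm_num)
  refine (hint.const_mul (16 * (C + C'))).mono' hc.aestronglyMeasurable
    (Filter.Eventually.of_forall fun z ↦ ?_)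
  have hrp : (1 + ‖z‖) ^ (-4 : ℝ) = ((1 + ‖z‖) ^ 4)⁻¹ := by
    rw [Real.rpow_neg (by positivity)]; norm_cast
  rw [hrp, Real.norm_eq_abs]
  have h16 : ∀ t : ℝ, 0 ≤ t → t ≤ 1 → (1 + t) ^ 4 ≤ 16 := by
    intro t h0 h1
    calc (1 + t) ^ 4 ≤ (1 + 1) ^ 4 := by gcongr
      _ = 16 := by norm_num
  rcases le_total ‖z‖ 1 with hz | hz
  · have h1 := hC' z hz
    have h2 : 1 ≤ 16 * ((1 + ‖z‖) ^ 4)⁻¹ := by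
      rw [← div_eq_mul_inv, one_le_div (by positivity)]
      exact h16 _ (norm_nonneg z) hz
    calc |h z| ≤ (C + C') * 1 := by linarith
      _ ≤ (C + C') * (16 * ((1 + ‖z‖) ^ 4)⁻¹) := by gcongr
      _ = _ := by ring
  · have h1 := hC z hz
    have hz0 : 0 < ‖z‖ := by linarith
    have h2 : (‖z‖ ^ 4)⁻¹ ≤ 16 * ((1 + ‖z‖) ^ 4)⁻¹ := by
      rw [← div_eq_mul_inv, inv_le_comm₀ (by positivity) (by positivity), inv_div,
        div_le_iff₀ (by norm_num)]
      calc (1 + ‖z‖) ^ 4 ≤ (‖z‖ + ‖z‖) ^ 4 := by gcongr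
        _ = ‖z‖ ^ 4 * 16 := by ring
    calc |h z| ≤ (C + C') * (‖z‖ ^ 4)⁻¹ := by
          refine h1.trans (mul_le_mul_of_nonneg_right (by linarith) (by positivity))
      _ ≤ (C + C') * (16 * ((1 + ‖z‖) ^ 4)⁻¹) := by gcongr
      _ = _ := by ring

/-- A smooth field along `f` is bounded. -/
lemma exists_ip_le (g : RMetric n M) {V : S2 → EE n}
    (hV : ContMDiff (𝓡 2) (𝓡 n).tangent ∞ (tb f V)) :
    ∃ C, 0 ≤ C ∧ ∀ x, ip g (f x) (V x) (V x) ≤ C := by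
  have hc : Continuous fun x ↦ ip g (f x) (V x) (V x) :=
    (show ContMDiff (𝓡 2) 𝓘(ℝ, ℝ) ∞ _ from fun x ↦ contMDiffAt_ip g (hV x) (hV x)).continuous
  obtain ⟨C, hC⟩ := (isCompact_univ (X := S2)).exists_bound_of_continuousOn hc.continuousOn
  exact ⟨C, (norm_nonneg _).trans (hC (stereo 0) trivial), fun x ↦
    (le_abs_self _).trans (hC x trivial)⟩

/-- A smooth field along `f` which vanishes off the south pole vanishes. -/
lemma eq_zero_of_comp_stereo (g : RMetric n M) {V : S2 → EE n}
    (hV : ContMDiff (𝓡 2) (𝓡 n).tangent ∞ (tb f V)) (h : ∀ z, V (stereo z) = 0) (x : S2) :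
    V x = 0 := by
  have hc : Continuous fun x ↦ ip g (f x) (V x) (V x) :=
    (show ContMDiff (𝓡 2) 𝓘(ℝ, ℝ) ∞ _ from fun x ↦ contMDiffAt_ip g (hV x) (hV x)).continuous
  have h0 : (fun x ↦ ip g (f x) (V x) (V x)) = fun _ ↦ 0 :=
    denseRange_stereo.equalizer hc continuous_const (funext fun z ↦ by simp [h z])
  by_contra hx
  exact (ip_pos g (f x) hx).ne' (congrFun h0 x)

end Decay

/-! ### Variations with a given variation field -/

section Variation

open Set

variable {n : ℕ} {M : Type*} [TopologicalSpace M] [ChartedSpace (EE n) M]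
  [IsManifold (𝓡 n) ∞ M]

/-- Addition of a variation supported in a chart domain to a given variation `H`. -/
lemma exists_variation_add {H : ℝ × ℂ → M} (hH : ContMDiff 𝓘(ℝ, ℝ × ℂ) (𝓡 n) ∞ H) {K : Set ℂ}
    (hK : IsCompact K) {p : M} (hp : ∀ z ∈ K, H (0, z) ∈ (extChartAt (𝓡 n) p).source)
    {v V : ℂ → EE n} (hv : ContDiff ℝ ∞ v) (hvK : ∀ z ∈ K, v z = tc p (H (0, z)) (V z))
    (hvK' : ∀ z ∉ K, v z = 0) (hVK : ∀ z ∉ K, V z = 0) :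
    ∃ H' : ℝ × ℂ → M, ContMDiff 𝓘(ℝ, ℝ × ℂ) (𝓡 n) ∞ H' ∧ (∀ z, H' (0, z) = H (0, z)) ∧
      (∀ z, V z = 0 → (∀ t, H (t, z) = H (0, z)) → ∀ t, H' (t, z) = H (0, z)) ∧
      ∀ z, du (n := n) H' (1, 0) (0, z) = du (n := n) H (1, 0) (0, z) + V z := by
  classical
  let O₁ : Set (ℝ × ℂ) := H ⁻¹' (extChartAt (𝓡 n) p).source
  have hO₁ : IsOpen O₁ := (isOpen_extChartAt_source p).preimage hH.continuous
  -- A straight line in the chart with velocity `v`. It stays in the target of the chart only for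
  -- small `t`, uniformly over `K` by compactness.
  let Φ : ℝ × ℂ → EE n := fun q ↦ extChartAt (𝓡 n) p (H q) + q.1 • v q.2
  have hΦ : ∀ q ∈ O₁, ContDiffAt ℝ ∞ Φ q := fun q hq ↦
    (contDiffAt_chart_comp (hH q) hq).add
      (contDiff_fst.smul (hv.comp contDiff_snd)).contDiffAt
  let O : Set (ℝ × ℂ) := O₁ ∩ Φ ⁻¹' (extChartAt (𝓡 n) p).target
  have hO : IsOpen O :=
    ContinuousOn.isOpen_inter_preimage (fun q hq ↦ (hΦ q hq).continuousAt.continuousWithinAt) hO₁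
      (isOpen_target p)
  have hsub : ({0} : Set ℝ) ×ˢ K ⊆ O := by
    rintro ⟨t, z⟩ ⟨ht, hz⟩
    obtain rfl : t = 0 := ht
    refine ⟨hp z hz, ?_⟩
    simp only [mem_preimage, Φ, zero_smul, add_zero]
    exact (extChartAt (𝓡 n) p).map_source (hp z hz)
  obtain ⟨U, W, hU, hW, h0U, hKW, hUW⟩ := generalized_tube_lemma isCompact_singleton hK hO hsub
  obtain ⟨δ', hδ', hball⟩ := Metric.isOpen_iff.1 hU 0 (h0U rfl)
  set δ := δ' / 2 with hδdef
  have hδ : 0 < δ := by positivity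
  -- A variation is required for all real `t`. The reparametrization `δ sin(t / δ)` stays within `δ
  -- < δ'` and has derivative `1` at `0`, so the variation field is unchanged.
  let τ : ℝ → ℝ := fun t ↦ δ * Real.sin (δ⁻¹ * t)
  have hτ : ContDiff ℝ ∞ τ := contDiff_const.mul (Real.contDiff_sin.comp (contDiff_const.mul contDiff_id))
  have hτU : ∀ t, τ t ∈ U := by
    intro t
    apply hball
    rw [mem_ball_zero_iff, Real.norm_eq_abs, abs_mul, abs_of_pos hδ]
    calc δ * |Real.sin (δ⁻¹ * t)| ≤ δ * 1 := by gcongr; exact Real.abs_sin_le_one _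
      _ < δ' := by linarith
  have hτ0 : τ 0 = 0 := by simp [τ]
  have hτ' : HasDerivAt τ 1 0 := by
    have h1 : HasDerivAt (fun t : ℝ ↦ δ⁻¹ * t) δ⁻¹ 0 := by
      simpa using (hasDerivAt_id (0 : ℝ)).const_mul δ⁻¹
    have h2 : HasDerivAt (fun t ↦ Real.sin (δ⁻¹ * t)) (Real.cos (δ⁻¹ * 0) * δ⁻¹) 0 :=
      (Real.hasDerivAt_sin _).comp 0 h1
    have h3 := h2.const_mul δ
    simp only [mul_zero, Real.cos_zero, one_mul, mul_inv_cancel₀ hδ.ne'] at h3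
    exact h3
  let σ : ℝ × ℂ → ℝ × ℂ := fun q ↦ (τ q.1, q.2)
  have hσ : ContDiff ℝ ∞ σ := (hτ.comp contDiff_fst).prodMk contDiff_snd
  have hσO : ∀ t, ∀ z ∈ W, σ (t, z) ∈ O := fun t z hz ↦ hUW ⟨hτU t, hz⟩
  -- Off `K` the field `v` vanishes, so on `W \ K` the chart formula agrees with `H ∘ σ`; since `W`
  -- is an open neighbourhood of `K`, the two pieces glue smoothly.
  let H' : ℝ × ℂ → M := fun q ↦
    if q.2 ∈ K then (extChartAt (𝓡 n) p).symm (Φ (σ q)) else H (σ q)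
  have hHW : ∀ t, ∀ z ∈ W, H' (t, z) = (extChartAt (𝓡 n) p).symm (Φ (σ (t, z))) := by
    intro t z hz
    by_cases hzK : z ∈ K
    · simp only [H', if_pos hzK]
    · simp only [H', if_neg hzK, Φ, σ, hvK' z hzK, smul_zero, add_zero]
      rw [(extChartAt (𝓡 n) p).left_inv (hσO t z hz).1]
  have hHK : ∀ t, ∀ z ∉ K, H' (t, z) = H (σ (t, z)) := fun t z hz ↦ by simp only [H', if_neg hz]
  have hWn : ∀ t, ∀ z ∈ K, ∀ᶠ q : ℝ × ℂ in nhds (t, z), q.2 ∈ W := fun t z hz ↦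
    continuousAt_snd.preimage_mem_nhds (hW.mem_nhds (hKW hz))
  have hKn : ∀ t, ∀ z ∉ K, ∀ᶠ q : ℝ × ℂ in nhds (t, z), q.2 ∉ K := fun t z hz ↦
    (hK.isClosed.isOpen_compl.preimage continuous_snd).mem_nhds hz
  have hH' : ContMDiff 𝓘(ℝ, ℝ × ℂ) (𝓡 n) ∞ H' := by
    rintro ⟨t, z⟩
    by_cases hz : z ∈ K
    · have h1 : H' =ᶠ[nhds (t, z)] fun q ↦ (extChartAt (𝓡 n) p).symm (Φ (σ q)) := by
        filter_upwards [hWn t z hz] with q hq using hHW q.1 q.2 hq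
      refine ContMDiffAt.congr_of_eventuallyEq ?_ h1
      have h2 := hσO t z (hKW hz)
      have h3 : ContDiffAt ℝ ∞ (fun q ↦ Φ (σ q)) (t, z) := (hΦ _ h2.1).comp _ hσ.contDiffAt
      exact (contMDiffAt_chart_symm h2.2).comp (t, z) h3.contMDiffAt
    · have h1 : H' =ᶠ[nhds (t, z)] fun q ↦ H (σ q) := by
        filter_upwards [hKn t z hz] with q hq using hHK q.1 q.2 hq
      exact ((hH _).comp (t, z) hσ.contMDiff.contMDiffAt).congr_of_eventuallyEq h1
  have hH0 : ∀ z, H' (0, z) = H (0, z) := by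
    intro z
    by_cases hz : z ∈ K
    · simp only [hHW 0 z (hKW hz), σ, hτ0, Φ, zero_smul, add_zero]
      exact (extChartAt (𝓡 n) p).left_inv (hp z hz)
    · simp only [hHK 0 z hz, σ, hτ0]
  refine ⟨H', hH', hH0, fun z hz hc t ↦ ?_, fun z ↦ ?_⟩
  · by_cases hzK : z ∈ K
    · have hvz : v z = 0 := by rw [hvK z hzK, hz, map_zero]
      have h1 := (hσO t z (hKW hzK)).1
      simp only [hHW t z (hKW hzK), Φ, σ, hvz, smul_zero, add_zero]
      rw [(extChartAt (𝓡 n) p).left_inv h1, hc]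
    · rw [hHK t z hzK]
      exact hc _
  · have hσ0 : σ (0, z) = (0, z) := by simp only [σ, hτ0]
    have hσd : fderiv ℝ σ (0, z) (1, 0) = (1, 0) := by
      have h1 : HasFDerivAt (fun q : ℝ × ℂ ↦ τ q.1) _ (0, z) :=
        HasFDerivAt.comp (g := τ) (0, z) hτ'.hasFDerivAt hasFDerivAt_fst
      have h2 := h1.prodMk (hasFDerivAt_snd (𝕜 := ℝ) (p := ((0, z) : ℝ × ℂ)))
      have h3 : fderiv ℝ σ (0, z) = _ := h2.fderiv
      rw [h3]
      simp
    have hdσ := (hσ.differentiable (by simp) (0, z)).hasFDerivAt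
    by_cases hz : z ∈ K
    · apply tc_injective (hp z hz)
      have hmd := (hH' (0, z)).mdifferentiableAt (by simp)
      have h1 := tc_du (p := p) hmd (by rw [hH0]; exact hp z hz) (1, 0)
      rw [hH0] at h1
      rw [h1, map_add, ← hvK z hz, tc_du ((hH (0, z)).mdifferentiableAt (by simp)) (hp z hz)]
      have h2 : (fun q ↦ extChartAt (𝓡 n) p (H' q)) =ᶠ[nhds (0, z)] fun q ↦ Φ (σ q) := by
        filter_upwards [hWn 0 z hz] with q hq
        have h3 := hHW q.1 q.2 hq
        simp only [Prod.mk.eta] at h3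
        rw [h3, (extChartAt (𝓡 n) p).right_inv (hσO q.1 q.2 hq).2]
      have h4 : HasFDerivAt (fun q ↦ extChartAt (𝓡 n) p (H q))
          (fderiv ℝ (fun q ↦ extChartAt (𝓡 n) p (H q)) (0, z)) (0, z) :=
        ((contDiffAt_chart_comp (hH (0, z)) (hp z hz)).differentiableAt (by simp)).hasFDerivAt
      have h5 : HasFDerivAt Φ _ (0, z) := h4.add
        ((hasFDerivAt_fst (𝕜 := ℝ) (p := ((0, z) : ℝ × ℂ))).smul
          (((hv.differentiable (by simp) z).hasFDerivAt).comp ((0, z) : ℝ × ℂ) hasFDerivAt_snd))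
      have h6 : HasFDerivAt (fun q ↦ Φ (σ q)) _ (0, z) :=
        HasFDerivAt.comp (g := Φ) (0, z) (hσ0.symm ▸ h5) hdσ
      rw [h2.fderiv_eq, h6.fderiv, ContinuousLinearMap.comp_apply, hσd]
      simp [hσ0]
    · have h1 : H' =ᶠ[nhds (0, z)] fun q ↦ H (σ q) := by
        filter_upwards [hKn 0 z hz] with q hq using hHK q.1 q.2 hq
      rw [hVK z hz, add_zero, du, h1.mfderiv_eq]
      have h2 : MDifferentiableAt 𝓘(ℝ, ℝ × ℂ) (𝓡 n) H (σ (0, z)) :=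
        (hH _).mdifferentiableAt (by simp)
      have h3 := HasMFDerivAt.comp (0, z) h2.hasMFDerivAt hdσ.hasMFDerivAt
      have h4 : mfderiv 𝓘(ℝ, ℝ × ℂ) (𝓡 n) (fun q ↦ H (σ q)) (0, z) = _ := h3.mfderiv
      rw [h4]
      have h5 : ∀ L : ℝ × ℂ →L[ℝ] EE n, L.comp (fderiv ℝ σ (0, z)) (1, 0) = L (1, 0) := by
        intro L
        rw [ContinuousLinearMap.comp_apply, hσd]
      have h6 : du (n := n) H (1, 0) (σ (0, z)) = du H (1, 0) (0, z) := by rw [hσ0]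
      rw [← h6]
      exact h5 (mfderiv 𝓘(ℝ, ℝ × ℂ) (𝓡 n) H (σ (0, z)))

/-- Every compactly supported vector field along a map of the plane is a variation field. -/
theorem exists_variation {F : ℂ → M} {V : ℂ → EE n} (hV : SmoothField F V) {R : ℝ}
    (hR : ∀ z, R < ‖z‖ → V z = 0) :
    ∃ H : ℝ × ℂ → M, ContMDiff 𝓘(ℝ, ℝ × ℂ) (𝓡 n) ∞ H ∧ (∀ z, H (0, z) = F z) ∧
      (∀ t z, R < ‖z‖ → H (t, z) = F z) ∧ ∀ z, du (n := n) H (1, 0) (0, z) = V z := by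
  classical
  have hF : ContMDiff 𝓘(ℝ, ℂ) (𝓡 n) ∞ F := hV.map
  have hex : ∀ c : ℂ, ∃ χ : ContDiffBump c, ∀ z ∈ Metric.closedBall c χ.rOut,
      F z ∈ (extChartAt (𝓡 n) (F c)).source := by
    intro c
    obtain ⟨r, hr, hball⟩ := Metric.mem_nhds_iff.1 (hF.continuous.continuousAt.preimage_mem_nhds
      (source_mem_nhds' (mem_extChartAt_source (I := 𝓡 n) (F c))))
    refine ⟨⟨r / 4, r / 2, by positivity, by linarith⟩, fun z hz ↦ hball ?_⟩
    exact Metric.closedBall_subset_ball (by change r / 2 < r; linarith) hz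
  choose χ hχ using hex
  -- Induction on the number of chart balls needed to cover the places where `V` is nonzero. The
  -- part `χ c • V` is realized in the chart at `F c`; the remainder `(1 - χ c) • V` vanishes on the
  -- ball around `c` and is covered by the other balls.
  have key : ∀ (T : Finset ℂ) (V : ℂ → EE n), SmoothField F V → (∀ z, R < ‖z‖ → V z = 0) →
      (∀ z, V z ≠ 0 → ∃ c ∈ T, z ∈ Metric.ball c (χ c).rIn) →
      ∃ H : ℝ × ℂ → M, ContMDiff 𝓘(ℝ, ℝ × ℂ) (𝓡 n) ∞ H ∧ (∀ z, H (0, z) = F z) ∧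
      (∀ t z, R < ‖z‖ → H (t, z) = F z) ∧ ∀ z, du (n := n) H (1, 0) (0, z) = V z := by
    intro T
    induction T using Finset.induction_on with
    | empty =>
      intro V hV hR hT
      have hV0 : ∀ z, V z = 0 := fun z ↦ by
        by_contra h
        simpa using hT z h
      have hs : ContMDiff 𝓘(ℝ, ℝ × ℂ) 𝓘(ℝ, ℂ) ∞ (Prod.snd : ℝ × ℂ → ℂ) := contDiff_snd.contMDiff
      refine ⟨fun q ↦ F q.2, hF.comp hs, fun z ↦ rfl, fun t z _ ↦ rfl, fun z ↦ ?_⟩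
      rw [hV0 z]
      have h1 : MDifferentiableAt 𝓘(ℝ, ℂ) (𝓡 n) F ((0, z) : ℝ × ℂ).2 :=
        (hF z).mdifferentiableAt (by simp)
      have h2 := (HasMFDerivAt.comp ((0, z) : ℝ × ℂ) h1.hasMFDerivAt
        (hasFDerivAt_snd (𝕜 := ℝ)).hasMFDerivAt).mfderiv
      have h3 : ∀ L : ℂ →L[ℝ] EE n, L.comp (ContinuousLinearMap.snd ℝ ℝ ℂ) (1, 0) = 0 := by
        intro L; simp
      rw [du]
      exact (congrArg (fun L ↦ L ((1, 0) : ℝ × ℂ)) h2).trans (h3 (mfderiv 𝓘(ℝ, ℂ) (𝓡 n) F z))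
    | insert c T _ ih =>
      intro V hV hR hT
      have hχs : ContDiff ℝ ∞ (χ c) := (χ c).contDiff
      obtain ⟨H, hH, hH0, hHR, hHd⟩ := ih (fun z ↦ (1 - χ c z) • V z)
        (hV.smul (contDiff_const.sub hχs)) (fun z hz ↦ by simp [hR z hz]) (by
          intro z hz
          have h1 : V z ≠ 0 := fun h ↦ hz (by simp [h])
          obtain ⟨c', hc', hzc'⟩ := hT z h1
          rcases Finset.mem_insert.1 hc' with rfl | h
          · exact absurd (by rw [(χ c').one_of_mem_closedBall (Metric.ball_subset_closedBall hzc'),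
              sub_self, zero_smul]) hz
          · exact ⟨c', h, hzc'⟩)
      set p := F c with hpdef
      have hout : ∀ z ∉ Metric.closedBall c (χ c).rOut, χ c z = 0 := by
        intro z hz
        rw [Metric.mem_closedBall, not_le] at hz
        exact (χ c).zero_of_le_dist hz.le
      have hv : ContDiff ℝ ∞ fun z ↦ χ c z • tc p (F z) (V z) := by
        refine contDiff_iff_contDiffAt.2 fun z ↦ ?_
        by_cases hz : z ∈ tsupport (χ c)
        · rw [(χ c).tsupport_eq] at hz
          exact hχs.contDiffAt.smul (hV.contDiffAt (hχ c z hz))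
        · have : (fun z ↦ χ c z • tc p (F z) (V z)) =ᶠ[nhds z] fun _ ↦ 0 := by
            filter_upwards [(isClosed_tsupport (χ c)).isOpen_compl.mem_nhds hz] with w hw
            rw [image_eq_zero_of_notMem_tsupport hw, zero_smul]
          exact contDiffAt_const.congr_of_eventuallyEq this
      obtain ⟨H', hH', hH'0, hH'R, hH'd⟩ := exists_variation_add hH
        (isCompact_closedBall c (χ c).rOut) (p := p) (V := fun z ↦ χ c z • V z)
        (fun z hz ↦ by rw [hH0]; exact hχ c z hz) hv
        (fun z hz ↦ by rw [hH0, map_smul]) (fun z hz ↦ by simp [hout z hz])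
        (fun z hz ↦ by simp [hout z hz])
      refine ⟨H', hH', fun z ↦ by rw [hH'0, hH0], fun t z hz ↦ ?_, fun z ↦ ?_⟩
      · rw [hH'R z (by simp [hR z hz]) (fun t ↦ by rw [hHR t z hz, hH0]), hH0]
      · rw [hH'd, hHd, ← add_smul, sub_add_cancel, one_smul]
  obtain ⟨T, -, hT⟩ := (isCompact_closedBall (0 : ℂ) R).elim_nhds_subcover
    (fun c ↦ Metric.ball c (χ c).rIn) fun c _ ↦ Metric.ball_mem_nhds c (χ c).rIn_pos
  refine key T V hV hR fun z hz ↦ ?_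
  have hzR : z ∈ Metric.closedBall (0 : ℂ) R := by
    rw [mem_closedBall_zero_iff]
    by_contra h
    exact hz (hR z (not_le.1 h))
  simpa using hT hzR

/-- Every vector field along a map of the sphere which vanishes near the south pole is a variation
field. -/
theorem exists_variation_sphere {f : S2 → M} (hf : ContMDiff (𝓡 2) (𝓡 n) ∞ f) {V : ℂ → EE n}
    (hV : SmoothField (fun ζ ↦ f (stereo ζ)) V) {R : ℝ} (hR : ∀ z, R < ‖z‖ → V z = 0) :
    ∃ (Fam : ℝ → S2 → M) (H : ℝ × ℂ → M),
      ContMDiff (𝓘(ℝ, ℝ).prod (𝓡 2)) (𝓡 n) ∞ (fun q : ℝ × S2 ↦ Fam q.1 q.2) ∧ Fam 0 = f ∧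
      (∀ t z, Fam t (stereo z) = H (t, z)) ∧ ContMDiff 𝓘(ℝ, ℝ × ℂ) (𝓡 n) ∞ H ∧
      (∀ z, H (0, z) = f (stereo z)) ∧ (∀ t z, R < ‖z‖ → H (t, z) = f (stereo z)) ∧
      ∀ z, du (n := n) H (1, 0) (0, z) = V z := by
  classical
  obtain ⟨H, hH, hH0, hHR, hHd⟩ := exists_variation hV hR
  -- Outside the compact image of the ball of radius `R` both branches equal `f`, which gives
  -- smoothness at the south pole.
  let Fam : ℝ → S2 → M := fun t x ↦
    if 1 + (x : EuclideanSpace ℝ (Fin 3)) 2 ≠ 0 then H (t, coord x) else f x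
  have hne : ∀ z, 1 + (stereo z : EuclideanSpace ℝ (Fin 3)) 2 ≠ 0 := by
    intro z
    have h1 := one_add_normSq_pos z
    have h2 : (stereo z : EuclideanSpace ℝ (Fin 3)) 2 = (1 + Complex.normSq z)⁻¹ *
      (1 - Complex.normSq z) := rfl
    rw [h2]
    have : 1 + (1 + Complex.normSq z)⁻¹ * (1 - Complex.normSq z) = 2 * (1 + Complex.normSq z)⁻¹ := by
      field_simp; ring
    rw [this]; positivity
  refine ⟨Fam, H, ?_, ?_, fun t z ↦ ?_, hH, hH0, hHR, hHd⟩
  · rintro ⟨t, x⟩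
    by_cases hx : 1 + (x : EuclideanSpace ℝ (Fin 3)) 2 = 0
    · have hcomp : IsClosed (stereo '' Metric.closedBall 0 R) :=
        ((isCompact_closedBall (0 : ℂ) R).image contMDiff_stereo.continuous).isClosed
      have hxn : x ∉ stereo '' Metric.closedBall 0 R := by
        rintro ⟨z, -, rfl⟩
        exact hne z hx
      have h1 : (fun q : ℝ × S2 ↦ Fam q.1 q.2) =ᶠ[nhds (t, x)] fun q ↦ f q.2 := by
        filter_upwards [continuousAt_snd.preimage_mem_nhds (hcomp.isOpen_compl.mem_nhds hxn)]
          with q hq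
        simp only [Fam]
        split_ifs with hq2
        · have h3 := stereo_coord_eq hq2
          rw [hHR, h3]
          by_contra h
          exact hq ⟨coord q.2, by simpa using h, h3⟩
        · rfl
      exact ((hf x).comp (t, x) contMDiffAt_snd).congr_of_eventuallyEq h1
    · have hopen : IsOpen {y : S2 | 1 + (y : EuclideanSpace ℝ (Fin 3)) 2 ≠ 0} := by
        have hp : Continuous fun y : EuclideanSpace ℝ (Fin 3) ↦ y 2 :=
          (EuclideanSpace.proj (𝕜 := ℝ) 2).continuous
        exact isOpen_ne.preimage (continuous_const.add (hp.comp continuous_subtype_val))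
      have h1 : (fun q : ℝ × S2 ↦ Fam q.1 q.2) =ᶠ[nhds (t, x)] fun q ↦ H (q.1, coord q.2) := by
        filter_upwards [continuousAt_snd.preimage_mem_nhds (hopen.mem_nhds hx)] with q hq
        exact if_pos hq
      refine ContMDiffAt.congr_of_eventuallyEq ?_ h1
      have h2 : ContMDiffAt (𝓘(ℝ, ℝ).prod (𝓡 2)) 𝓘(ℝ, ℝ × ℂ) ∞
          (fun q : ℝ × S2 ↦ (q.1, coord q.2)) (t, x) :=
        contMDiffAt_fst.prodMk_space ((contMDiffAt_coord hx).comp (t, x) contMDiffAt_snd)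
      exact (hH _).comp (t, x) h2
  · funext x
    simp only [Fam]
    split_ifs with hx
    · rw [hH0, stereo_coord_eq hx]
    · rfl
  · simp only [Fam, if_pos (hne z), coord_stereo]

end Variation

/-! ### The second variation of the energy -/

section SecondVariation

open Set

variable {n : ℕ} {M : Type*} [TopologicalSpace M] [ChartedSpace (EE n) M]
  [IsManifold (𝓡 n) ∞ M]

lemma du_comp {D D' : Type*} [NormedAddCommGroup D] [NormedSpace ℝ D] [NormedAddCommGroup D']
    [NormedSpace ℝ D'] {u : D → M} (hu : ContMDiff 𝓘(ℝ, D) (𝓡 n) ∞ u) {ι : D' → D} {L : D' →L[ℝ] D}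
    {z : D'} (hι : HasFDerivAt ι L z) (e : D') :
    du (n := n) (fun ζ ↦ u (ι ζ)) e z = du u (L e) (ι z) := by
  have h3 := HasMFDerivAt.comp z ((hu (ι z)).mdifferentiableAt (by simp)).hasMFDerivAt
    hι.hasMFDerivAt
  rw [du, du]
  exact congrArg (fun T ↦ T e) h3.mfderiv

lemma cov_eq_zero {D : Type*} [NormedAddCommGroup D] [NormedSpace ℝ D] (g : RMetric n M) {u : D → M}
    {V : D → EE n} (hV : SmoothField u V) {z : D} (h : ∀ᶠ ζ in nhds z, V ζ = 0) (e : D) :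
    cov g u V e z = 0 := by
  have h1 : V =ᶠ[nhds z] fun ζ ↦ (0 : ℝ) • V ζ := by
    filter_upwards [h] with ζ hζ
    rw [hζ, smul_zero]
  rw [cov_congr g h1, cov_smul g contDiff_const hV, h.self_of_nhds]
  simp

/-- Differentiation under the integral sign for integrands supported in a fixed ball. -/
lemma hasDerivAt_integral_of_support {k : ℝ × ℂ → ℝ} (hk : ContDiff ℝ ∞ k) {R : ℝ}
    (hR : ∀ t z, R < ‖z‖ → k (t, z) = 0) (t : ℝ) :
    HasDerivAt (fun t ↦ ∫ z, k (t, z)) (∫ z, fderiv ℝ k (t, z) (1, 0)) t := by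
  have hk' : Continuous fun q : ℝ × ℂ ↦ fderiv ℝ k q (1, 0) :=
    (hk.continuous_fderiv (by simp)).clm_apply continuous_const
  have hd : ∀ s z, HasDerivAt (fun s ↦ k (s, z)) (fderiv ℝ k (s, z) (1, 0)) s := by
    intro s z
    have h1 : HasFDerivAt k _ (s, z) := (hk.differentiable (by simp) (s, z)).hasFDerivAt
    have h2 : HasDerivAt (fun s : ℝ ↦ ((s, z) : ℝ × ℂ)) (1, 0) s :=
      (hasDerivAt_id s).prodMk (hasDerivAt_const s z)
    exact h1.comp_hasDerivAt s h2
  have hR' : ∀ s z, R < ‖z‖ → fderiv ℝ k (s, z) (1, 0) = 0 := by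
    intro s z hz
    have h1 := hd s z
    simp only [hR _ z hz] at h1
    exact h1.unique (hasDerivAt_const s 0)
  obtain ⟨C, hC⟩ := ((isCompact_Icc (a := t - 1) (b := t + 1)).prod
    (isCompact_closedBall (0 : ℂ) R)).exists_bound_of_continuousOn hk'.continuousOn
  have hsupp : ∀ {h : ℂ → ℝ}, (∀ z, R < ‖z‖ → h z = 0) → HasCompactSupport h := by
    intro h hh
    apply HasCompactSupport.intro (isCompact_closedBall (0 : ℂ) R)
    intro z hz
    rw [mem_closedBall_zero_iff, not_le] at hz
    exact hh z hz
  have hcs : ∀ s : ℝ, Continuous fun z : ℂ ↦ (s, z) := fun s ↦ continuous_const.prodMk continuous_id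
  refine (hasDerivAt_integral_of_dominated_loc_of_deriv_le (s := Icc (t - 1) (t + 1))
    (bound := (Metric.closedBall (0 : ℂ) R).indicator fun _ ↦ C)
    (Icc_mem_nhds (by linarith) (by linarith))
    (Filter.Eventually.of_forall fun s ↦ (hk.continuous.comp (hcs s)).aestronglyMeasurable)
    ((hk.continuous.comp (hcs t)).integrable_of_hasCompactSupport (hsupp (hR t)))
    (hk'.comp (hcs t)).aestronglyMeasurable
    (Filter.Eventually.of_forall fun z s hs ↦ ?_) ?_
    (Filter.Eventually.of_forall fun z s _ ↦ hd s z)).2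
  · rcases lt_or_ge R ‖z‖ with hz | hz
    · rw [hR' s z hz, norm_zero, indicator_of_notMem (by simpa using hz)]
    · rw [indicator_of_mem (by simpa using hz)]
      exact hC (s, z) ⟨hs, by simpa using hz⟩
  · exact (integrable_indicator_iff Metric.isClosed_closedBall.measurableSet).2
      (integrableOn_const (isCompact_closedBall (0 : ℂ) R).measure_lt_top.ne)

/-- The squared length of the derivative of a family of maps in a spatial direction. -/
def sqDu (g : RMetric n M) (H : ℝ × ℂ → M) (e : ℂ) (q : ℝ × ℂ) : ℝ :=
  ip g (H q) (du (n := n) H (0, e) q) (du (n := n) H (0, e) q)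

lemma contDiff_sqDu (g : RMetric n M) {H : ℝ × ℂ → M} (hH : ContMDiff 𝓘(ℝ, ℝ × ℂ) (𝓡 n) ∞ H)
    (e : ℂ) : ContDiff ℝ ∞ (sqDu g H e) :=
  (smoothField_du hH (0, e)).ip g (smoothField_du hH (0, e))

/-- The second time derivative of `|H_e|²`. -/
lemma fderiv_fderiv_sqDu (g : RMetric n M) {H : ℝ × ℂ → M}
    (hH : ContMDiff 𝓘(ℝ, ℝ × ℂ) (𝓡 n) ∞ H) (e : ℂ) (q : ℝ × ℂ) :
    fderiv ℝ (fun q ↦ fderiv ℝ (sqDu g H e) q (1, 0)) q (1, 0) =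
      2 * (ip g (H q) (cov g H (du H (1, 0)) (0, e) q) (cov g H (du H (1, 0)) (0, e) q)
        + rt g (H q) (du H (1, 0) q) (du H (0, e) q) (du H (1, 0) q) (du H (0, e) q)
        + ip g (H q) (cov g H (cov g H (du H (1, 0)) (1, 0)) (0, e) q) (du H (0, e) q)) := by
  have hT := smoothField_du (n := n) hH (1, 0)
  have hE := smoothField_du (n := n) hH (0, e)
  have h1 : (fun q ↦ fderiv ℝ (sqDu g H e) q (1, 0)) = fun q ↦
      2 * ip g (H q) (cov g H (du H (1, 0)) (0, e) q) (du H (0, e) q) := by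
    funext q
    have := fderiv_ip g hE hE (1, 0) q
    rw [cov_du_symm g hH, ip_symm g _ (du H (0, e) q)] at this
    change fderiv ℝ (fun ζ ↦ ip g (H ζ) (du H (0, e) ζ) (du H (0, e) ζ)) q (1, 0) = _
    rw [this]; ring
  have h2 := (hT.cov g (0, e)).ip g hE
  rw [h1, fderiv_const_mul (h2.differentiable (by simp) q), smul_apply,
    fderiv_ip g (hT.cov g (0, e)) hE, cov_du_symm g hH (1, 0) (0, e)]
  -- `∇_t ∇_e H_t = ∇_e ∇_t H_t + R(H_t, H_e) H_t`, which isolates the acceleration `∇_t H_t`.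
  have h3 := cov_commutator g hT (1, 0) (0, e) q
  rw [sub_eq_iff_eq_add] at h3
  rw [h3, map_add, add_apply, rt, smul_eq_mul]
  ring

/-- The second variation inequality for a stable harmonic map. -/
theorem second_variation_nonneg (g : RMetric n M) {f : S2 → M} (hf : IsHarmonic g f)
    (hstable : IsStable g f) {V : ℂ → EE n} (hV : SmoothField (fun ζ ↦ f (stereo ζ)) V) {R : ℝ}
    (hR : ∀ z, R < ‖z‖ → V z = 0) :
    0 ≤ ∫ z,
      ((ip g (f (stereo z)) (cov g (fun ζ ↦ f (stereo ζ)) V 1 z) (cov g (fun ζ ↦ f (stereo ζ)) V 1 z)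
        + rt g (f (stereo z)) (V z) (du (fun ζ ↦ f (stereo ζ)) 1 z) (V z)
          (du (fun ζ ↦ f (stereo ζ)) 1 z))
      + (ip g (f (stereo z)) (cov g (fun ζ ↦ f (stereo ζ)) V Complex.I z)
          (cov g (fun ζ ↦ f (stereo ζ)) V Complex.I z)
        + rt g (f (stereo z)) (V z) (du (fun ζ ↦ f (stereo ζ)) Complex.I z) (V z)
          (du (fun ζ ↦ f (stereo ζ)) Complex.I z))) := by
  obtain ⟨Fam, H, hFam, hFam0, hFH, hH, hH0, hHR, hHd⟩ := exists_variation_sphere hf.1 hV hR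
  have hF : ContMDiff 𝓘(ℝ, ℂ) (𝓡 n) ∞ fun ζ ↦ f (stereo ζ) := contMDiff_comp_stereo hf.1
  have hharm : ∀ z, cov g (fun ζ ↦ f (stereo ζ)) (du (fun ζ ↦ f (stereo ζ)) 1) 1 z
      + cov g (fun ζ ↦ f (stereo ζ)) (du (fun ζ ↦ f (stereo ζ)) Complex.I) Complex.I z = 0 := hf.2
  have hdec := exists_ip_du_le g hf.1
  set F : ℂ → M := fun ζ ↦ f (stereo ζ) with hFdef
  have hslice : (fun ζ ↦ H (0, ζ)) = F := funext hH0
  have hι : ∀ (t : ℝ) (z : ℂ), HasFDerivAt (fun ζ : ℂ ↦ (t, ζ)) (ContinuousLinearMap.inr ℝ ℝ ℂ) z :=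
    fun t z ↦ hasFDerivAt_prodMk_right t z
  have hduH : ∀ t z e, du (n := n) (fun ζ ↦ H (t, ζ)) e z = du H (0, e) (t, z) := by
    intro t z e
    simpa using du_comp hH (hι t z) e
  have hduF : ∀ z e, du (n := n) H (0, e) (0, z) = du F e z := fun z e ↦ by rw [← hduH, hslice]
  -- the energy density
  let ρ : ℝ × ℂ → ℝ := fun q ↦ sqDu g H 1 q + sqDu g H Complex.I q
  have hρ : ContDiff ℝ ∞ ρ := (contDiff_sqDu g hH 1).add (contDiff_sqDu g hH Complex.I)
  have henergy : ∀ t, energy g (Fam t) = 1 / 2 * ∫ z, ρ (t, z) := by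
    intro t
    have h1 : (fun ζ ↦ Fam t (stereo ζ)) = fun ζ ↦ H (t, ζ) := funext fun z ↦ hFH t z
    have h2 : ∀ u : ℂ → M, (∫ z, (ip g ((fun ζ ↦ Fam t (stereo ζ)) z)
        (du (fun ζ ↦ Fam t (stereo ζ)) 1 z) (du (fun ζ ↦ Fam t (stereo ζ)) 1 z)
        + ip g ((fun ζ ↦ Fam t (stereo ζ)) z) (du (fun ζ ↦ Fam t (stereo ζ)) Complex.I z)
        (du (fun ζ ↦ Fam t (stereo ζ)) Complex.I z))) = ∫ z, ρ (t, z) := by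
      intro u
      rw [h1]
      simp only [hduH]
      rfl
    exact congrArg (fun x ↦ 1 / 2 * x) (h2 F)
  have hρR : ∀ t z, R < ‖z‖ → ρ (t, z) = ρ (0, z) := by
    intro t z hz
    have h1 : ∀ t, (fun ζ ↦ H (t, ζ)) =ᶠ[nhds z] F := by
      intro t
      filter_upwards [(isOpen_lt continuous_const continuous_norm).mem_nhds hz] with ζ hζ
        using hHR t ζ hζ
    have h2 : ∀ t e, du (n := n) H (0, e) (t, z) = du F e z := by
      intro t e
      rw [← hduH, du, (h1 t).mfderiv_eq]
      rfl
    simp only [ρ, sqDu, h2, hHR _ z hz]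
  let T : ℝ × ℂ := (1, 0)
  -- The energy density itself is not compactly supported. Subtracting its value at time `0`, which
  -- is integrable by decay and constant in `t`, leaves an integrand supported in a fixed ball that
  -- can be differentiated under the integral.
  let k : ℝ × ℂ → ℝ := fun q ↦ ρ q - ρ (0, q.2)
  have hρ0 : ContDiff ℝ ∞ fun q : ℝ × ℂ ↦ ρ (0, q.2) := hρ.comp (contDiff_const.prodMk contDiff_snd)
  have hk : ContDiff ℝ ∞ k := hρ.sub hρ0
  have hkT : (fun q ↦ fderiv ℝ k q T) = fun q ↦ fderiv ℝ ρ q T := by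
    funext q
    have h1 : HasFDerivAt (fun q : ℝ × ℂ ↦ ((0, q.2) : ℝ × ℂ)) _ q :=
      (hasFDerivAt_const (0 : ℝ) q).prodMk (hasFDerivAt_snd (𝕜 := ℝ))
    have h2 : HasFDerivAt (fun q : ℝ × ℂ ↦ ρ (0, q.2)) _ q :=
      ((hρ.differentiable (by simp) _).hasFDerivAt).comp q h1
    have h3 : HasFDerivAt k _ q := ((hρ.differentiable (by simp) q).hasFDerivAt).sub h2
    rw [h3.fderiv]
    simp only [T, sub_apply, ContinuousLinearMap.comp_apply, ContinuousLinearMap.prod_apply,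
      zero_apply, sub_eq_self]
    exact map_zero _
  have hk' : ContDiff ℝ ∞ fun q ↦ fderiv ℝ k q T :=
    (hk.fderiv_right (m := ∞) (by simp)).clm_apply contDiff_const
  have hkR : ∀ t z, R < ‖z‖ → k (t, z) = 0 := fun t z hz ↦ by simp only [k, hρR t z hz, sub_self]
  have hkR' : ∀ t z, R < ‖z‖ → fderiv ℝ k (t, z) T = 0 := by
    intro t z hz
    have : k =ᶠ[nhds (t, z)] fun _ ↦ 0 := by
      filter_upwards [(isOpen_lt continuous_const (continuous_norm.comp continuous_snd)).mem_nhds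
        (show R < ‖((t, z) : ℝ × ℂ).2‖ from hz)] with q hq using hkR q.1 q.2 hq
    rw [this.fderiv_eq]; simp
  have hint0 : Integrable fun z ↦ ρ (0, z) := by
    obtain ⟨C, hC0, hC⟩ := hdec
    refine integrable_of_decay (C := 2 * C) (hρ.continuous.comp (continuous_const.prodMk
      continuous_id)) fun z hz ↦ ?_
    have e1 := hC z 1 1 hz (by simp) (by simp)
    have e2 := hC z Complex.I Complex.I hz (by simp) (by simp)
    simp only [ρ, sqDu, hduF, hH0]
    refine (abs_add_le _ _).trans ?_
    simp only [hFdef] at e1 e2 ⊢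
    linarith
  have hintk : ∀ t, Integrable fun z ↦ k (t, z) := by
    intro t
    refine (hk.continuous.comp (continuous_const.prodMk continuous_id)).integrable_of_hasCompactSupport
      (HasCompactSupport.intro (isCompact_closedBall (0 : ℂ) R) fun z hz ↦ ?_)
    rw [mem_closedBall_zero_iff, not_le] at hz
    exact hkR t z hz
  have hE : (fun t ↦ energy g (Fam t)) = fun t ↦ 1 / 2 * ((∫ z, k (t, z)) + ∫ z, ρ (0, z)) := by
    funext t
    rw [henergy, ← integral_add (hintk t) hint0]
    simp only [k, sub_add_cancel]
  have hD1 : deriv (fun t ↦ energy g (Fam t)) = fun t ↦ 1 / 2 * ∫ z, fderiv ℝ k (t, z) T := by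
    funext t
    rw [hE]
    exact (((hasDerivAt_integral_of_support hk hkR t).add_const _).const_mul _).deriv
  have hD2 : iteratedDeriv 2 (fun t ↦ energy g (Fam t)) 0
      = 1 / 2 * ∫ z, fderiv ℝ (fun q ↦ fderiv ℝ k q T) (0, z) T := by
    rw [iteratedDeriv_succ, iteratedDeriv_one, hD1]
    exact ((hasDerivAt_integral_of_support hk' hkR' 0).const_mul _).deriv
  have hnonneg := hstable Fam hFam hFam0
  rw [hD2, ← integral_const_mul] at hnonneg
  -- the fields along the given map
  have hT : SmoothField (n := n) H (du H T) := smoothField_du hH T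
  have hrestr : ∀ {W : ℝ × ℂ → EE n}, SmoothField H W → SmoothField F fun ζ ↦ W (0, ζ) := by
    intro W hW
    have h1 : ContMDiff 𝓘(ℝ, ℂ) 𝓘(ℝ, ℝ × ℂ) ∞ fun ζ : ℂ ↦ ((0 : ℝ), ζ) :=
      (contDiff_const.prodMk contDiff_id).contMDiff
    have h2 : SmoothField (fun ζ ↦ H (0, ζ)) fun ζ ↦ W (0, ζ) := hW.comp h1
    rwa [hslice] at h2
  have hcov : ∀ {W : ℝ × ℂ → EE n}, SmoothField H W → ∀ e z,
      cov g H W (0, e) (0, z) = cov g F (fun ζ ↦ W (0, ζ)) e z := by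
    intro W hW e z
    have h1 := cov_comp g hW (hι 0 z) e
    rw [hslice] at h1
    rw [h1]; simp
  -- The acceleration of the variation. By harmonicity its contribution is the divergence of the
  -- field with components `⟨A, F_x⟩` and `⟨A, F_y⟩`, whose integral vanishes; the second variation
  -- thus depends only on `V`.
  let A : ℂ → EE n := fun z ↦ cov g H (du H T) T (0, z)
  have hA : SmoothField F A := hrestr (hT.cov g T)
  have hVT : (fun ζ ↦ du (n := n) H T (0, ζ)) = V := funext hHd
  have hAR : ∀ z, R < ‖z‖ → A z = 0 := by
    intro z hz
    refine cov_eq_zero g hT ?_ T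
    filter_upwards [(isOpen_lt continuous_const (continuous_norm.comp continuous_snd)).mem_nhds
        (show R < ‖((0, z) : ℝ × ℂ).2‖ from hz)] with q hq
    have h1 : (fun s ↦ H (s, q.2)) = fun _ ↦ F q.2 := funext fun s ↦ hHR s q.2 hq
    have h2 := du_comp hH (hasFDerivAt_prodMk_left (𝕜 := ℝ) q.1 q.2) 1
    rw [h1] at h2
    have h3 : du (n := n) (fun _ : ℝ ↦ F q.2) 1 q.1 = 0 := by
      rw [du, mfderiv_const]; rfl
    rw [h3] at h2
    simpa using h2.symm
  have hFe := fun e : ℂ ↦ smoothField_du (n := n) hF e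
  let X : ℂ → ℂ → ℝ := fun e z ↦ ip g (F z) (A z) (du F e z)
  have hX : ∀ e, ContDiff ℝ ∞ (X e) := fun e ↦ hA.ip g (hFe e)
  have hsupp : ∀ {h : ℂ → ℝ}, (∀ z, R < ‖z‖ → h z = 0) → HasCompactSupport h := by
    intro h hh
    apply HasCompactSupport.intro (isCompact_closedBall (0 : ℂ) R)
    intro z hz
    rw [mem_closedBall_zero_iff, not_le] at hz
    exact hh z hz
  have hXc : ∀ e, HasCompactSupport (X e) := fun e ↦ hsupp fun z hz ↦ by simp [X, hAR z hz]
  have hdX : ∀ e, Integrable fun z ↦ fderiv ℝ (X e) z e := fun e ↦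
    Continuous.integrable_of_hasCompactSupport
      (((hX e).continuous_fderiv (by simp)).clm_apply continuous_const)
      ((hXc e).fderiv_apply (𝕜 := ℝ) e)
  let Q : ℂ → ℂ → ℝ := fun e z ↦ ip g (F z) (cov g F V e z) (cov g F V e z)
    + rt g (F z) (V z) (du F e z) (V z) (du F e z)
  have hQ : ∀ e, Integrable (Q e) := by
    intro e
    refine Continuous.integrable_of_hasCompactSupport
      (((hV.cov g e).ip g (hV.cov g e)).continuous.add
        ((hV.cv g (hFe e) hV).ip g (hFe e)).continuous) (hsupp fun z hz ↦ ?_)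
    have h1 : cov g F V e z = 0 := cov_eq_zero g hV (by
      filter_upwards [(isOpen_lt continuous_const continuous_norm).mem_nhds hz] with ζ hζ
        using hR ζ hζ) e
    have h2 : ∀ p a b, cv g p a b (0 : EE n) = 0 := fun p a b ↦ by
      simpa using cv_smul_right g p 0 a b 0
    change ip g (F z) (cov g F V e z) (cov g F V e z)
      + ip g (F z) (cv g (F z) (V z) (du F e z) (V z)) (du F e z) = 0
    rw [h1, hR z hz, h2, map_zero, map_zero, zero_apply, add_zero]
  have hpt : ∀ e z, fderiv ℝ (fun q ↦ fderiv ℝ (sqDu g H e) q T) (0, z) T =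
      2 * (Q e z + ip g (F z) (cov g F A e z) (du F e z)) := by
    intro e z
    rw [fderiv_fderiv_sqDu g hH, hcov hT, hcov (hT.cov g T), hduF, hH0, hHd, hVT]
  have hdiv : ∀ z, ip g (F z) (cov g F A 1 z) (du F 1 z)
      + ip g (F z) (cov g F A Complex.I z) (du F Complex.I z)
      = fderiv ℝ (X 1) z 1 + fderiv ℝ (X Complex.I) z Complex.I := by
    intro z
    have h1 := fderiv_ip g hA (hFe 1) 1 z
    have h2 := fderiv_ip g hA (hFe Complex.I) Complex.I z
    have h3 := congrArg (ip g (F z) (A z)) (hharm z)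
    rw [map_add, map_zero] at h3
    change fderiv ℝ (X 1) z 1 = _ at h1
    change fderiv ℝ (X Complex.I) z Complex.I = _ at h2
    linarith
  have hsum : ∀ z, 1 / 2 * fderiv ℝ (fun q ↦ fderiv ℝ k q T) (0, z) T = (Q 1 z + Q Complex.I z)
      + (fderiv ℝ (X 1) z 1 + fderiv ℝ (X Complex.I) z Complex.I) := by
    intro z
    have h1 : (fun q ↦ fderiv ℝ k q T) = fun q ↦ fderiv ℝ (sqDu g H 1) q T
        + fderiv ℝ (sqDu g H Complex.I) q T := by
      rw [hkT]
      funext q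
      have h2 : HasFDerivAt ρ _ q := ((contDiff_sqDu g hH 1).differentiable (by simp) q).hasFDerivAt.add
        ((contDiff_sqDu g hH Complex.I).differentiable (by simp) q).hasFDerivAt
      rw [h2.fderiv, add_apply]
    have h4 : ∀ e, DifferentiableAt ℝ (fun q ↦ fderiv ℝ (sqDu g H e) q T) (0, z) := fun e ↦
      ((((contDiff_sqDu g hH e).fderiv_right (m := ∞) (by simp)).clm_apply
        contDiff_const).differentiable (by simp)) _
    rw [h1, fderiv_fun_add (h4 1) (h4 Complex.I), add_apply, hpt, hpt, ← hdiv]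
    ring
  simp only [hsum] at hnonneg
  rw [integral_add (f := fun z ↦ Q 1 z + Q Complex.I z) ((hQ 1).add (hQ Complex.I))
    (g := fun z ↦ fderiv ℝ (X 1) z 1 + fderiv ℝ (X Complex.I) z Complex.I)
    ((hdX 1).add (hdX Complex.I)),
    integral_add (hdX 1) (hdX Complex.I),
    integral_fderiv_apply_eq_zero ((hX 1).of_le (by simp)) (hXc 1),
    integral_fderiv_apply_eq_zero ((hX Complex.I).of_le (by simp)) (hXc Complex.I)] at hnonneg
  simpa [Q] using hnonneg

end SecondVariation

/-! ### Algebra of the curvature tensor -/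

section CurvatureAlgebra

variable {n : ℕ} {M : Type*} [TopologicalSpace M] [ChartedSpace (EE n) M]
  [IsManifold (𝓡 n) ∞ M] (g : RMetric n M) (p : M)

lemma rt_anti_left (a b c d : EE n) : rt g p a b c d = - rt g p b a c d := by
  rw [rt, rt, cv_antisymm, map_neg, neg_apply]

lemma rt_anti_right (a b c d : EE n) : rt g p a b c d = - rt g p a b d c := cv_skew g p a b c d

lemma rt_bianchi (a b c d : EE n) : rt g p a b c d + rt g p b c a d + rt g p c a b d = 0 := by
  rw [rt, rt, rt, ← add_apply, ← add_apply, ← map_add, ← map_add, cv_bianchi, map_zero, zero_apply]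

lemma rt_add_two (a b b' c d : EE n) : rt g p a (b + b') c d = rt g p a b c d + rt g p a b' c d := by
  rw [rt, rt, rt, cv_add_mid, map_add, add_apply]

lemma rt_smul_two (r : ℝ) (a b c d : EE n) : rt g p a (r • b) c d = r * rt g p a b c d := by
  rw [rt, rt, cv_smul_mid, map_smul, smul_apply, smul_eq_mul]

lemma rt_smul_four (r : ℝ) (a b c d : EE n) : rt g p a b c (r • d) = r * rt g p a b c d := by
  rw [rt, rt, map_smul, smul_eq_mul]

lemma rt_smul_one (r : ℝ) (a b c d : EE n) : rt g p (r • a) b c d = r * rt g p a b c d := by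
  rw [rt, rt, cv_smul_left, map_smul, smul_apply, smul_eq_mul]

lemma rt_add_three (a b c c' d : EE n) : rt g p a b (c + c') d = rt g p a b c d + rt g p a b c' d := by
  rw [rt, rt, rt, cv_add_right, map_add, add_apply]

lemma rt_smul_three (r : ℝ) (a b c d : EE n) : rt g p a b (r • c) d = r * rt g p a b c d := by
  rw [rt, rt, cv_smul_right, map_smul, smul_apply, smul_eq_mul]

lemma rt_self_left (a c d : EE n) : rt g p a a c d = 0 := by
  have := rt_anti_left g p a a c d
  linarith

/-- The sum of the sectional curvature terms of `a`, `b` with `X`, `Y`. -/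
def secSum (X Y a b : EE n) : ℝ :=
  rt g p X a a X + rt g p Y a a Y + (rt g p X b b X + rt g p Y b b Y)

/-- The curvature term `R(X - i Y, a + i b, a - i b, X + i Y)`. -/
def kap (X Y a b : EE n) : ℝ :=
  -(rt g p X a X a + rt g p Y b X a + (rt g p X a Y b + rt g p Y b Y b))
    - (rt g p X b X b - rt g p Y a X b - (rt g p X b Y a - rt g p Y a Y a))

/-- Pair symmetry and one Bianchi identity merge the mixed terms into `-2 R(X, Y, a, b)`. This
splits the complex curvature into a part that is nonnegative for positive curvature and the density
of the Hermitian form. -/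
lemma kap_eq (X Y a b : EE n) : kap g p X Y a b = secSum g p X Y a b - 2 * rt g p X Y a b := by
  have h1 := rt_bianchi g p X b Y a
  rw [rt_pair g p b Y X a, rt_anti_right g p X a b Y, rt_anti_left g p Y X b a,
    rt_anti_right g p X Y b a] at h1
  rw [kap, secSum, rt_pair g p Y b X a, rt_pair g p Y a X b, rt_anti_right g p X a a X,
    rt_anti_right g p Y a a Y, rt_anti_right g p X b b X, rt_anti_right g p Y b b Y]
  linarith

lemma kap_smul (r : ℝ) (X Y a b : EE n) : kap g p X Y (r • a) (r • b) = r ^ 2 * kap g p X Y a b := by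
  simp only [kap, rt_smul_two, rt_smul_four]
  ring

/-- The curvature term does not change if a multiple of `X - i Y` is added to `a + i b`. -/
lemma kap_add (r t : ℝ) (X Y a b : EE n) :
    kap g p X Y (a + (r • X + t • Y)) (b + (t • X - r • Y)) = kap g p X Y a b := by
  set a' := a + (r • X + t • Y) with ha'
  set b' := b + (t • X - r • Y) with hb'
  have hs : ∀ u v c d, rt g p u (-v) c d = - rt g p u v c d := by
    intro u v c d
    simpa using rt_smul_two g p (-1) u v c d
  -- The added vector is `(r + i t)(X - iY)`, annihilated by `R(X - iY, ·)`. Here `h1` and `h2` are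
  -- the real and imaginary parts of this for the first pair of arguments; `h3` and `h4` follow for
  -- the second pair by pair symmetry.
  have h1 : ∀ c d, rt g p X a' c d + rt g p Y b' c d = rt g p X a c d + rt g p Y b c d := by
    intro c d
    simp only [ha', hb', sub_eq_add_neg, rt_add_two, rt_smul_two, hs, rt_self_left]
    rw [rt_anti_left g p Y X]
    ring
  have h2 : ∀ c d, rt g p X b' c d - rt g p Y a' c d = rt g p X b c d - rt g p Y a c d := by
    intro c d
    simp only [ha', hb', sub_eq_add_neg, rt_add_two, rt_smul_two, hs, rt_self_left]
    rw [rt_anti_left g p Y X]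
    ring
  have h3 : ∀ c d, rt g p c d X a' + rt g p c d Y b' = rt g p c d X a + rt g p c d Y b := by
    intro c d
    rw [rt_pair g p c d X a', rt_pair g p c d Y b', rt_pair g p c d X a, rt_pair g p c d Y b, h1]
  have h4 : ∀ c d, rt g p c d X b' - rt g p c d Y a' = rt g p c d X b - rt g p c d Y a := by
    intro c d
    rw [rt_pair g p c d X b', rt_pair g p c d Y a', rt_pair g p c d X b, rt_pair g p c d Y a, h2]
  rw [kap, kap, h1, h1, h2, h2]
  have e1 := h3 X a
  have e2 := h3 Y b
  have e3 := h4 X b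
  have e4 := h4 Y a
  linarith

end CurvatureAlgebra

/-! ### Conformality of harmonic spheres -/

section Conformal

open Complex Set

variable {n : ℕ} {M : Type*} [TopologicalSpace M] [ChartedSpace (EE n) M]
  [IsManifold (𝓡 n) ∞ M] (g : RMetric n M)

/-- A harmonic sphere is weakly conformal: its Hopf differential is holomorphic and decays. -/
theorem conformal_of_harmonic {f : S2 → M} (hf : IsHarmonic g f) (z : ℂ) :
    ip g (f (stereo z)) (du (n := n) (fun ζ ↦ f (stereo ζ)) 1 z) (du (fun ζ ↦ f (stereo ζ)) 1 z)
      = ip g (f (stereo z)) (du (fun ζ ↦ f (stereo ζ)) I z) (du (fun ζ ↦ f (stereo ζ)) I z) ∧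
    ip g (f (stereo z)) (du (fun ζ ↦ f (stereo ζ)) 1 z) (du (fun ζ ↦ f (stereo ζ)) I z) = 0 := by
  have hF : ContMDiff 𝓘(ℝ, ℂ) (𝓡 n) ∞ fun ζ ↦ f (stereo ζ) := contMDiff_comp_stereo hf.1
  have hharm : ∀ z, cov g (fun ζ ↦ f (stereo ζ)) (du (fun ζ ↦ f (stereo ζ)) 1) 1 z
      + cov g (fun ζ ↦ f (stereo ζ)) (du (fun ζ ↦ f (stereo ζ)) Complex.I) Complex.I z = 0 := hf.2
  obtain ⟨C, hC0, hC⟩ := exists_ip_du_le g hf.1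
  set F : ℂ → M := fun ζ ↦ f (stereo ζ)
  have hFz : ∀ z, f (stereo z) = F z := fun _ ↦ rfl
  simp only [hFz] at hC ⊢
  have hX := smoothField_du (n := n) hF 1
  have hY := smoothField_du (n := n) hF I
  let u : ℂ → ℝ := fun z ↦ ip g (F z) (du F 1 z) (du F 1 z) - ip g (F z) (du F I z) (du F I z)
  let v : ℂ → ℝ := fun z ↦ -2 * ip g (F z) (du F 1 z) (du F I z)
  have hu : ContDiff ℝ ∞ u := (hX.ip g hX).sub (hY.ip g hY)
  have hv : ContDiff ℝ ∞ v := contDiff_const.mul (hX.ip g hY)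
  have hdu : ∀ e z, fderiv ℝ u z e = 2 * ip g (F z) (cov g F (du F 1) e z) (du F 1 z)
      - 2 * ip g (F z) (cov g F (du F I) e z) (du F I z) := by
    intro e z
    have h1 : HasFDerivAt u _ z := ((hX.ip g hX).differentiable (by simp) z).hasFDerivAt.sub
      ((hY.ip g hY).differentiable (by simp) z).hasFDerivAt
    rw [h1.fderiv, sub_apply, fderiv_ip g hX hX, fderiv_ip g hY hY,
      ip_symm g _ (du F 1 z), ip_symm g _ (du F I z)]
    ring
  have hdv : ∀ e z, fderiv ℝ v z e = -2 * (ip g (F z) (cov g F (du F 1) e z) (du F I z)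
      + ip g (F z) (cov g F (du F I) e z) (du F 1 z)) := by
    intro e z
    have h1 : HasFDerivAt v _ z := ((hX.ip g hY).differentiable (by simp) z).hasFDerivAt.const_mul _
    rw [h1.fderiv, smul_apply, fderiv_ip g hX hY, ip_symm g _ (du F 1 z), smul_eq_mul]
  -- The Hopf differential. Harmonicity and the symmetry `∇_x F_y = ∇_y F_x` are its Cauchy-Riemann
  -- equations. It decays like `|z|⁻⁴` because `f` is smooth across the south pole, so Liouville's
  -- theorem makes it vanish.
  let φ : ℂ → ℂ := fun z ↦ (u z : ℂ) + I * (v z : ℂ)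
  have hφ : ∀ z, HasFDerivAt φ (ofRealCLM.comp (fderiv ℝ u z) + I • ofRealCLM.comp (fderiv ℝ v z))
      z := fun z ↦ (ofRealCLM.hasFDerivAt.comp z (hu.differentiable (by simp) z).hasFDerivAt).add
        ((ofRealCLM.hasFDerivAt.comp z (hv.differentiable (by simp) z).hasFDerivAt).const_mul I)
  have hhol : Differentiable ℂ φ := by
    intro z
    rw [differentiableAt_complex_iff_differentiableAt_real]
    refine ⟨(hφ z).differentiableAt, ?_⟩
    rw [(hφ z).fderiv]
    have hsym := cov_du_symm g hF 1 I z
    have e1 := congrArg (fun w ↦ ip g (F z) w (du F 1 z)) (hharm z)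
    have e2 := congrArg (fun w ↦ ip g (F z) w (du F I z)) (hharm z)
    simp only [map_add, add_apply, map_zero, zero_apply] at e1 e2
    have h1 : fderiv ℝ u z I = - fderiv ℝ v z 1 := by
      rw [hdu, hdv, hsym]; linarith
    have h2 : fderiv ℝ v z I = fderiv ℝ u z 1 := by
      rw [hdu, hdv, hsym]; linarith
    simp only [add_apply, ContinuousLinearMap.comp_apply, ofRealCLM_apply, smul_apply, h1, h2,
      smul_eq_mul, ofReal_neg]
    linear_combination (-(fderiv ℝ v z 1 : ℂ)) * I_sq
  have hlim : Filter.Tendsto φ (Filter.cocompact ℂ) (nhds 0) := by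
    have hb : ∀ z, 1 ≤ ‖z‖ → ‖φ z‖ ≤ 4 * C * (‖z‖ ^ 4)⁻¹ := by
      intro z hz
      have h1 := hC z 1 1 hz (by simp) (by simp)
      have h2 := hC z I I hz (by simp) (by simp)
      have h3 := hC z 1 I hz (by simp) (by simp)
      have h4 : ‖φ z‖ ≤ |u z| + |v z| := by
        refine (norm_add_le _ _).trans ?_
        simp
      have h5 : |u z| ≤ _ := abs_sub (ip g (F z) (du F 1 z) (du F 1 z)) _
      have h6 : |v z| = 2 * |ip g (F z) (du F 1 z) (du F I z)| := by
        rw [abs_mul]; norm_num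
      linarith
    have h4 : Filter.Tendsto (fun z : ℂ ↦ 4 * C * (‖z‖ ^ 4)⁻¹) (Filter.cocompact ℂ) (nhds 0) := by
      have h5 : Filter.Tendsto (fun z : ℂ ↦ ‖z‖ ^ 4) (Filter.cocompact ℂ) Filter.atTop :=
        (Filter.tendsto_pow_atTop (by norm_num)).comp (tendsto_norm_cocompact_atTop)
      simpa using (tendsto_inv_atTop_zero.comp h5).const_mul (4 * C)
    refine squeeze_zero_norm' ?_ h4
    filter_upwards [tendsto_norm_cocompact_atTop.eventually_ge_atTop 1] with z hz using hb z hz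
  have h0 := hhol.apply_eq_of_tendsto_cocompact z hlim
  have hre := congrArg re h0
  have him := congrArg im h0
  simp only [φ, add_re, add_im, mul_re, mul_im, I_re, I_im, ofReal_re, ofReal_im, zero_re, zero_im,
    u, v] at hre him
  constructor <;> linarith

end Conformal

/-! ### The complexified second variation inequality -/

section Complexified

open Complex Set

variable {n : ℕ} {M : Type*} [TopologicalSpace M] [ChartedSpace (EE n) M]
  [IsManifold (𝓡 n) ∞ M] (g : RMetric n M)

/-- The real part of `∇_x W + i ∇_y W` for `W = a + i b`. -/
def dRe (F : ℂ → M) (a b : ℂ → EE n) (z : ℂ) : EE n := cov g F a 1 z - cov g F b I z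

/-- The imaginary part of `∇_x W + i ∇_y W` for `W = a + i b`. -/
def dIm (F : ℂ → M) (a b : ℂ → EE n) (z : ℂ) : EE n := cov g F b 1 z + cov g F a I z

/-- The squared length of a complexified tangent vector. -/
def nsq (p : M) (v w : EE n) : ℝ := ip g p v v + ip g p w w

lemma ip_nonneg (p : M) (v : EE n) : 0 ≤ ip g p v v := by
  rcases eq_or_ne v 0 with rfl | h
  · simp
  · exact (ip_pos g p h).le

lemma nsq_nonneg (p : M) (v w : EE n) : 0 ≤ nsq g p v w :=
  add_nonneg (ip_nonneg g p v) (ip_nonneg g p w)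

lemma SmoothField.sub {F : ℂ → M} {V W : ℂ → EE n} (hV : SmoothField F V) (hW : SmoothField F W) :
    SmoothField F (fun z ↦ V z - W z) := by
  have := hV.add (hW.smul (φ := fun _ ↦ -1) contDiff_const)
  simpa [sub_eq_add_neg] using this

/-- Stability, applied to the real and imaginary parts of a complexified field. -/
theorem integral_kap_le {f : S2 → M} (hf : IsHarmonic g f) (hstable : IsStable g f)
    {a b : ℂ → EE n} (ha : SmoothField (fun ζ ↦ f (stereo ζ)) a)
    (hb : SmoothField (fun ζ ↦ f (stereo ζ)) b) {R : ℝ} (hRa : ∀ z, R < ‖z‖ → a z = 0)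
    (hRb : ∀ z, R < ‖z‖ → b z = 0) :
    ∫ z, kap g (f (stereo z)) (du (fun ζ ↦ f (stereo ζ)) 1 z) (du (fun ζ ↦ f (stereo ζ)) I z)
      (a z) (b z) ≤ ∫ z, nsq g (f (stereo z)) (dRe g (fun ζ ↦ f (stereo ζ)) a b z)
        (dIm g (fun ζ ↦ f (stereo ζ)) a b z) := by
  have h1 := second_variation_nonneg g hf hstable ha hRa
  have h2 := second_variation_nonneg g hf hstable hb hRb
  have hF : ContMDiff 𝓘(ℝ, ℂ) (𝓡 n) ∞ fun ζ ↦ f (stereo ζ) := contMDiff_comp_stereo hf.1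
  set F : ℂ → M := fun ζ ↦ f (stereo ζ)
  have hFz : ∀ z, f (stereo z) = F z := fun _ ↦ rfl
  simp only [hFz] at h1 h2 ⊢
  have hFe := fun e : ℂ ↦ smoothField_du (n := n) hF e
  have hsupp : ∀ {h : ℂ → ℝ}, (∀ z, R < ‖z‖ → h z = 0) → HasCompactSupport h := by
    intro h hh
    apply HasCompactSupport.intro (isCompact_closedBall (0 : ℂ) R)
    intro z hz
    rw [mem_closedBall_zero_iff, not_le] at hz
    exact hh z hz
  have hcov0 : ∀ {V : ℂ → EE n}, SmoothField F V → (∀ z, R < ‖z‖ → V z = 0) → ∀ e z, R < ‖z‖ →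
      cov g F V e z = 0 := fun hV hVR e z hz ↦ cov_eq_zero g hV (by
      filter_upwards [(isOpen_lt continuous_const continuous_norm).mem_nhds hz] with ζ hζ
        using hVR ζ hζ) e
  have hcv0 : ∀ p u v, cv g p u v (0 : EE n) = 0 := fun p u v ↦ by
      simpa using cv_smul_right g p 0 u v 0
  let Q : (ℂ → EE n) → ℂ → ℂ → ℝ := fun V e z ↦ ip g (F z) (cov g F V e z) (cov g F V e z)
    + rt g (F z) (V z) (du F e z) (V z) (du F e z)
  have hQ : ∀ {V : ℂ → EE n}, SmoothField F V → (∀ z, R < ‖z‖ → V z = 0) → ∀ e,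
      Integrable (Q V e) := by
    intro V hV hVR e
    refine Continuous.integrable_of_hasCompactSupport
      (((hV.cov g e).ip g (hV.cov g e)).continuous.add
        ((hV.cv g (hFe e) hV).ip g (hFe e)).continuous) (hsupp fun z hz ↦ ?_)
    change ip g (F z) (cov g F V e z) (cov g F V e z)
      + ip g (F z) (cv g (F z) (V z) (du F e z) (V z)) (du F e z) = 0
    rw [hcov0 hV hVR e z hz, hVR z hz, hcv0, map_zero, map_zero, zero_apply, add_zero]
  -- The cross terms of `|∇_x W + i ∇_y W|²` are `-2⟨∇_x a, ∇_y b⟩ + 2⟨∇_y a, ∇_x b⟩`. They equal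
  -- `-2(∂_y Z_1 - ∂_x Z_I)` up to the commutator of `∇_x` and `∇_y` on `a`, which supplies the term
  -- `-2 R(X, Y, a, b)` of `kap`.
  let Z : ℂ → ℂ → ℝ := fun e z ↦ ip g (F z) (cov g F a e z) (b z)
  have hZ : ∀ e, ContDiff ℝ ∞ (Z e) := fun e ↦ (ha.cov g e).ip g hb
  have hZc : ∀ e, HasCompactSupport (Z e) := fun e ↦ hsupp fun z hz ↦ by simp [Z, hRb z hz]
  have hdZ : ∀ e e', Integrable fun z ↦ fderiv ℝ (Z e) z e' := fun e e' ↦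
    Continuous.integrable_of_hasCompactSupport
      (((hZ e).continuous_fderiv (by simp)).clm_apply continuous_const)
      ((hZc e).fderiv_apply (𝕜 := ℝ) e')
  have hP : SmoothField F (dRe g F a b) := (ha.cov g 1).sub (hb.cov g I)
  have hI : SmoothField F (dIm g F a b) := (hb.cov g 1).add (ha.cov g I)
  have hN : Integrable fun z ↦ nsq g (F z) (dRe g F a b z) (dIm g F a b z) := by
    refine Continuous.integrable_of_hasCompactSupport
      ((hP.ip g hP).continuous.add (hI.ip g hI).continuous) (hsupp fun z hz ↦ ?_)
    change ip g (F z) (dRe g F a b z) (dRe g F a b z) + ip g (F z) (dIm g F a b z) (dIm g F a b z) = 0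
    simp only [dRe, dIm, hcov0 ha hRa _ z hz, hcov0 hb hRb _ z hz]
    simp
  have hpt : ∀ z, kap g (F z) (du F 1 z) (du F I z) (a z) (b z) =
      (nsq g (F z) (dRe g F a b z) (dIm g F a b z)
        - ((Q a 1 z + Q a I z) + (Q b 1 z + Q b I z)))
      + 2 * (fderiv ℝ (Z 1) z I - fderiv ℝ (Z I) z 1) := by
    intro z
    have e1 : fderiv ℝ (Z 1) z I = _ := fderiv_ip g (ha.cov g 1) hb I z
    have e2 : fderiv ℝ (Z I) z 1 = _ := fderiv_ip g (ha.cov g I) hb 1 z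
    have e3 := congrArg (fun w ↦ ip g (F z) w (b z)) (cov_commutator g ha 1 I z)
    simp only [map_sub, sub_apply] at e3
    change _ = rt g (F z) (du F 1 z) (du F I z) (a z) (b z) at e3
    have e4 : ∀ V W : EE n, rt g (F z) V W V W = - rt g (F z) W V V W := fun V W ↦
      rt_anti_left g (F z) V W V W
    rw [kap_eq, e1, e2]
    simp only [Q, secSum, nsq, dRe, dIm, map_add, map_sub, add_apply, sub_apply, e4]
    rw [ip_symm g _ (cov g F b I z) (cov g F a 1 z), ip_symm g _ (cov g F a I z) (cov g F b 1 z)]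
    linarith
  let N : ℂ → ℝ := fun z ↦ nsq g (F z) (dRe g F a b z) (dIm g F a b z)
  let q : (ℂ → EE n) → ℂ → ℝ := fun V z ↦ Q V 1 z + Q V I z
  let w : ℂ → ℝ := fun z ↦ fderiv ℝ (Z 1) z I - fderiv ℝ (Z I) z 1
  have hqa : Integrable (q a) := (hQ ha hRa 1).add (hQ ha hRa I)
  have hqb : Integrable (q b) := (hQ hb hRb 1).add (hQ hb hRb I)
  have hw : Integrable w := (hdZ 1 I).sub (hdZ I 1)
  have hw0 : ∫ z, w z = 0 := by
    rw [integral_sub (hdZ 1 I) (hdZ I 1),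
      integral_fderiv_apply_eq_zero ((hZ 1).of_le (by simp)) (hZc 1),
      integral_fderiv_apply_eq_zero ((hZ I).of_le (by simp)) (hZc I), sub_zero]
  have hsum : ∫ z, kap g (F z) (du F 1 z) (du F I z) (a z) (b z)
      = ∫ z, (N z - (q a z + q b z) + 2 * w z) := integral_congr_ae (ae_of_all _ hpt)
  have e1 : ∫ z, (N z - (q a z + q b z) + 2 * w z)
      = (∫ z, (N z - (q a z + q b z))) + ∫ z, 2 * w z :=
    integral_add (hN.sub (hqa.add hqb)) (hw.const_mul 2)
  have e2 : ∫ z, (N z - (q a z + q b z)) = (∫ z, N z) - ∫ z, (q a z + q b z) :=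
    integral_sub hN (hqa.add hqb)
  have e3 : ∫ z, (q a z + q b z) = (∫ z, q a z) + ∫ z, q b z := integral_add hqa hqb
  rw [hsum, e1, e2, e3, integral_const_mul, hw0]
  change 0 ≤ ∫ z, q a z at h1
  change 0 ≤ ∫ z, q b z at h2
  change _ ≤ ∫ z, N z
  linarith

end Complexified

/-! ### The operator `∇_x + i ∇_y` on products and on multiples of `F_x - i F_y` -/

section HolomorphicFields

open Complex Set

variable {n : ℕ} {M : Type*} [TopologicalSpace M] [ChartedSpace (EE n) M]
  [IsManifold (𝓡 n) ∞ M] (g : RMetric n M) {F : ℂ → M} {a b a' b' : ℂ → EE n}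

lemma nsq_add_le (p : M) (u₁ v₁ w₁ u₂ v₂ w₂ : EE n) : nsq g p (u₁ + v₁ + w₁) (u₂ + v₂ + w₂)
    ≤ 3 * (nsq g p u₁ u₂ + nsq g p v₁ v₂ + nsq g p w₁ w₂) := by
  have key : ∀ u v w : EE n, ip g p (u + v + w) (u + v + w)
      ≤ 3 * (ip g p u u + ip g p v v + ip g p w w) := by
    intro u v w
    have h1 := ip_nonneg g p (u - v)
    have h2 := ip_nonneg g p (u - w)
    have h3 := ip_nonneg g p (v - w)
    simp only [map_add, map_sub, add_apply, sub_apply] at h1 h2 h3 ⊢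
    rw [ip_symm g p v u] at h1 ⊢
    rw [ip_symm g p w u] at h2 ⊢
    rw [ip_symm g p w v] at h3 ⊢
    linarith
  have h1 := key u₁ v₁ w₁
  have h2 := key u₂ v₂ w₂
  simp only [nsq]
  linarith

lemma nsq_rotate (p : M) (r t : ℝ) (v w : EE n) :
    nsq g p (r • v - t • w) (r • w + t • v) = (r ^ 2 + t ^ 2) * nsq g p v w := by
  simp only [nsq, map_add, map_sub, map_smul, add_apply, sub_apply, smul_apply, smul_eq_mul]
  rw [ip_symm g p w v]
  ring

lemma nsq_smul (p : M) (r : ℝ) (v w : EE n) : nsq g p (r • v) (r • w) = r ^ 2 * nsq g p v w := by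
  simp only [nsq, map_smul, smul_apply, smul_eq_mul]
  ring

lemma nsq_neg_right (p : M) (v w : EE n) : nsq g p v (-w) = nsq g p v w := by simp [nsq]

lemma continuous_nsq (ha : SmoothField F a) (hb : SmoothField F b) :
    Continuous fun z ↦ nsq g (F z) (a z) (b z) :=
  (ha.ip g ha).continuous.add (hb.ip g hb).continuous

lemma cov_sub (ha : SmoothField F a) (hb : SmoothField F b) (e z : ℂ) :
    cov g F (fun ζ ↦ a ζ - b ζ) e z = cov g F a e z - cov g F b e z := by
  have h := cov_add g (ha.sub hb) hb e z
  simp only [sub_add_cancel] at h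
  exact eq_sub_of_add_eq h.symm

lemma dRe_add (ha : SmoothField F a) (hb : SmoothField F b) (ha' : SmoothField F a')
    (hb' : SmoothField F b') (z : ℂ) :
    dRe g F (fun z ↦ a z + a' z) (fun z ↦ b z + b' z) z = dRe g F a b z + dRe g F a' b' z := by
  rw [dRe, dRe, dRe, cov_add g ha ha', cov_add g hb hb']; abel

lemma dIm_add (ha : SmoothField F a) (hb : SmoothField F b) (ha' : SmoothField F a')
    (hb' : SmoothField F b') (z : ℂ) :
    dIm g F (fun z ↦ a z + a' z) (fun z ↦ b z + b' z) z = dIm g F a b z + dIm g F a' b' z := by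
  rw [dIm, dIm, dIm, cov_add g ha ha', cov_add g hb hb']; abel

lemma dRe_smul {χ : ℂ → ℝ} (hχ : ContDiff ℝ ∞ χ) (ha : SmoothField F a) (hb : SmoothField F b)
    (z : ℂ) : dRe g F (fun z ↦ χ z • a z) (fun z ↦ χ z • b z) z
      = (fderiv ℝ χ z 1 • a z - fderiv ℝ χ z I • b z) + χ z • dRe g F a b z := by
  rw [dRe, dRe, cov_smul g hχ ha, cov_smul g hχ hb, smul_sub]; abel

lemma dIm_smul {χ : ℂ → ℝ} (hχ : ContDiff ℝ ∞ χ) (ha : SmoothField F a) (hb : SmoothField F b)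
    (z : ℂ) : dIm g F (fun z ↦ χ z • a z) (fun z ↦ χ z • b z) z
      = (fderiv ℝ χ z 1 • b z + fderiv ℝ χ z I • a z) + χ z • dIm g F a b z := by
  rw [dIm, dIm, cov_smul g hχ ha, cov_smul g hχ hb, smul_add]; abel

section Multiples

variable {h : ℂ → ℂ} (hF : ContMDiff 𝓘(ℝ, ℂ) (𝓡 n) ∞ F)
  (hharm : ∀ z, cov g F (du F 1) 1 z + cov g F (du F I) I z = 0) (hh : ContDiff ℝ ∞ h)

/-- The real part of `h (F_x - i F_y)`. -/
def mulRe (n : ℕ) {M : Type*} [TopologicalSpace M] [ChartedSpace (EE n) M] [IsManifold (𝓡 n) ∞ M]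
    (F : ℂ → M) (h : ℂ → ℂ) (z : ℂ) : EE n := (h z).re • du F 1 z + (h z).im • du F I z

/-- The imaginary part of `h (F_x - i F_y)`. -/
def mulIm (n : ℕ) {M : Type*} [TopologicalSpace M] [ChartedSpace (EE n) M] [IsManifold (𝓡 n) ∞ M]
    (F : ℂ → M) (h : ℂ → ℂ) (z : ℂ) : EE n := (h z).im • du F 1 z - (h z).re • du F I z

include hF hh in
lemma smoothField_mulRe : SmoothField F (mulRe n F h) :=
  ((smoothField_du hF 1).smul (reCLM.contDiff.comp hh)).add
    ((smoothField_du hF I).smul (imCLM.contDiff.comp hh))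

include hF hh in
lemma smoothField_mulIm : SmoothField F (mulIm n F h) :=
  ((smoothField_du hF 1).smul (imCLM.contDiff.comp hh)).sub
    ((smoothField_du hF I).smul (reCLM.contDiff.comp hh))

include hh in
lemma fderiv_re_im (e z : ℂ) : fderiv ℝ (fun z ↦ (h z).re) z e = (fderiv ℝ h z e).re ∧
    fderiv ℝ (fun z ↦ (h z).im) z e = (fderiv ℝ h z e).im := by
  have hd := (hh.differentiable (by simp) z).hasFDerivAt
  have h1 : HasFDerivAt (fun z ↦ (h z).re) _ z := reCLM.hasFDerivAt.comp z hd
  have h2 : HasFDerivAt (fun z ↦ (h z).im) _ z := imCLM.hasFDerivAt.comp z hd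
  rw [h1.fderiv, h2.fderiv]
  exact ⟨rfl, rfl⟩

include hF hharm hh in
-- `(∇_x + i ∇_y)(F_x - i F_y) = 0`: the real part is the harmonic map equation and the imaginary
-- part is the vanishing of torsion. Only the coefficient `h` is differentiated, so correcting a
-- section by a multiple of `F_x - i F_y` is a scalar problem.
lemma dRe_mul (z : ℂ) : dRe g F (mulRe n F h) (mulIm n F h) z = mulRe n F (dbar h) z := by
  have hX := smoothField_du (n := n) hF 1
  have hY := smoothField_du (n := n) hF I
  have hr : ContDiff ℝ ∞ fun z ↦ (h z).re := reCLM.contDiff.comp hh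
  have hi : ContDiff ℝ ∞ fun z ↦ (h z).im := imCLM.contDiff.comp hh
  have e1 : cov g F (mulRe n F h) 1 z = _ := cov_add g (hX.smul hr) (hY.smul hi) 1 z
  have e2 : cov g F (mulIm n F h) I z = _ := cov_sub g (hX.smul hi) (hY.smul hr) I z
  have e3 : cov g F (du F I) I z = - cov g F (du F 1) 1 z :=
    eq_neg_of_add_eq_zero_right (hharm z)
  rw [dRe, e1, e2, cov_smul g hr hX, cov_smul g hi hY, cov_smul g hi hX, cov_smul g hr hY,
    (fderiv_re_im hh 1 z).1, (fderiv_re_im hh 1 z).2, (fderiv_re_im hh I z).1,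
    (fderiv_re_im hh I z).2, cov_du_symm g hF 1 I z, e3]
  simp only [mulRe, dbar, add_re, add_im, mul_re, mul_im, I_re, I_im]
  module

include hF hharm hh in
lemma dIm_mul (z : ℂ) : dIm g F (mulRe n F h) (mulIm n F h) z = mulIm n F (dbar h) z := by
  have hX := smoothField_du (n := n) hF 1
  have hY := smoothField_du (n := n) hF I
  have hr : ContDiff ℝ ∞ fun z ↦ (h z).re := reCLM.contDiff.comp hh
  have hi : ContDiff ℝ ∞ fun z ↦ (h z).im := imCLM.contDiff.comp hh
  have e1 : cov g F (mulRe n F h) I z = _ := cov_add g (hX.smul hr) (hY.smul hi) I z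
  have e2 : cov g F (mulIm n F h) 1 z = _ := cov_sub g (hX.smul hi) (hY.smul hr) 1 z
  have e3 : cov g F (du F I) I z = - cov g F (du F 1) 1 z :=
    eq_neg_of_add_eq_zero_right (hharm z)
  rw [dIm, e1, e2, cov_smul g hr hX, cov_smul g hi hY, cov_smul g hi hX, cov_smul g hr hY,
    (fderiv_re_im hh 1 z).1, (fderiv_re_im hh 1 z).2, (fderiv_re_im hh I z).1,
    (fderiv_re_im hh I z).2, cov_du_symm g hF 1 I z, e3]
  simp only [mulIm, dbar, add_re, add_im, mul_re, mul_im, I_re, I_im]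
  module

lemma nsq_mul (z : ℂ) : nsq g (F z) (mulRe n F h z) (mulIm n F h z)
    = ‖h z‖ ^ 2 * nsq g (F z) (du F 1 z) (du F I z) := by
  have h1 := nsq_rotate g (F z) (h z).re (-(h z).im) (du F 1 z) (du F I z)
  rw [← nsq_neg_right] at h1
  rw [← normSq_eq_norm_sq, normSq_apply, mulRe, mulIm]
  rw [show (h z).re * (h z).re + (h z).im * (h z).im = (h z).re ^ 2 + (-(h z).im) ^ 2 by ring, ← h1]
  congr 1 <;> module

end Multiples

lemma exists_radius {E : Type*} [Zero E] {χ : ℂ → E} (hχ : HasCompactSupport χ) :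
    ∃ R, ∀ z, R < ‖z‖ → χ z = 0 := by
  obtain ⟨R, hR⟩ := hχ.isBounded.subset_closedBall 0
  refine ⟨R, fun z hz ↦ image_eq_zero_of_notMem_tsupport fun h ↦ ?_⟩
  have := hR h
  rw [mem_closedBall_zero_iff] at this
  linarith

lemma norm_dbar_ofReal_sq {χ : ℂ → ℝ} (hχ : ContDiff ℝ ∞ χ) (z : ℂ) :
    ‖dbar (fun z ↦ (χ z : ℂ)) z‖ ^ 2 = gradSq χ z := by
  have h1 : HasFDerivAt (fun z ↦ (χ z : ℂ)) (ofRealCLM.comp (fderiv ℝ χ z)) z :=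
    ofRealCLM.hasFDerivAt.comp z (hχ.differentiable (by simp) z).hasFDerivAt
  rw [← normSq_eq_norm_sq, normSq_apply, dbar, h1.fderiv, gradSq]
  simp
  ring

end HolomorphicFields

/-! ### The correction of a holomorphic section, with a regularized coefficient -/

section KeyInequality

open Complex Set

variable {n : ℕ} {M : Type*} [TopologicalSpace M] [ChartedSpace (EE n) M]
  [IsManifold (𝓡 n) ∞ M] (g : RMetric n M)

/-- The curvature inequality for a section whose `∂̄`-derivative is tangential, with a regularized
error term. -/
lemma integral_sq_mul_kap_le_add {f : S2 → M} (hf : IsHarmonic g f) (hstable : IsStable g f)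
    {F : ℂ → M} (hFf : F = fun ζ ↦ f (stereo ζ)) {a b : ℂ → EE n} (ha : SmoothField F a)
    (hb : SmoothField F b) {S L : ℝ} (hS : ∀ z, nsq g (F z) (a z) (b z) ≤ S)
    (hL : ∀ z, nsq g (F z) (du F 1 z) (du F I z) ≤ L) {lam : ℂ → ℝ} (hlam : ContDiff ℝ ∞ lam)
    (hlam0 : ∀ z, 0 ≤ lam z)
    (hP : ∀ z, lam z • dRe g F a b z = ip g (F z) (dRe g F a b z) (du F 1 z) • du F 1 z
      + ip g (F z) (dRe g F a b z) (du F I z) • du F I z)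
    (hQ : ∀ z, lam z • dIm g F a b z = ip g (F z) (dRe g F a b z) (du F I z) • du F 1 z
      - ip g (F z) (dRe g F a b z) (du F 1 z) • du F I z)
    {χ : ℂ → ℝ} (hχ : ContDiff ℝ ∞ χ) (hχc : HasCompactSupport χ) {δ η : ℝ} (hδ : 0 < δ)
    (hη : 0 < η) :
    ∫ z, χ z ^ 2 * kap g (F z) (du F 1 z) (du F I z) (a z) (b z) ≤
      3 * ((∫ z, gradSq χ z) * S + (∫ z, (χ z) ^ 2 * nsq g (F z) (dRe g F a b z) (dIm g F a b z)
        * (δ / (lam z + δ)) ^ 2) + η) := by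
  have hF : ContMDiff 𝓘(ℝ, ℂ) (𝓡 n) ∞ F := hFf ▸ contMDiff_comp_stereo hf.1
  have hharm : ∀ z, cov g F (du F 1) 1 z + cov g F (du F I) I z = 0 := by rw [hFf]; exact hf.2
  have hX := smoothField_du (n := n) hF 1
  have hY := smoothField_du (n := n) hF I
  have hPs : SmoothField F (dRe g F a b) := (ha.cov g 1).sub (hb.cov g I)
  have hQs : SmoothField F (dIm g F a b) := (hb.cov g 1).add (ha.cov g I)
  have hden : ∀ z, lam z + δ ≠ 0 := fun z ↦ by have := hlam0 z; positivity
  -- By `hP` and `hQ`, `lam` times the `∂̄`-derivative of the section is `(⟨P, X⟩ + i⟨P, Y⟩)(X -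
  -- iY)`, where `P` is its real part. Dividing by `lam + δ` instead of `lam` keeps the coefficient
  -- `p + i q` smooth across the branch points.
  let p : ℂ → ℝ := fun z ↦ ip g (F z) (dRe g F a b z) (du F 1 z) / (lam z + δ)
  let q : ℂ → ℝ := fun z ↦ ip g (F z) (dRe g F a b z) (du F I z) / (lam z + δ)
  have hp : ContDiff ℝ ∞ p := (hPs.ip g hX).div (hlam.add contDiff_const) hden
  have hq : ContDiff ℝ ∞ q := (hPs.ip g hY).div (hlam.add contDiff_const) hden
  -- With `∂̄h = β`, the field `χ s + h (X - iY)` has a `∂̄`-derivative consisting only of the term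
  -- with `dχ` and the regularization error.
  let β : ℂ → ℂ := fun z ↦ -((χ z : ℂ) * ((p z : ℂ) + (q z : ℂ) * I))
  have hχC : ContDiff ℝ ∞ fun z ↦ (χ z : ℂ) := ofRealCLM.contDiff.comp hχ
  have hβ : ContDiff ℝ ∞ β := (hχC.mul ((ofRealCLM.contDiff.comp hp).add
    ((ofRealCLM.contDiff.comp hq).mul contDiff_const))).neg
  obtain ⟨R, hR⟩ := exists_radius hχc
  have hβR : ∀ z, R < ‖z‖ → β z = 0 := fun z hz ↦ by simp [β, hR z hz]
  have hβc : HasCompactSupport β := by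
    apply HasCompactSupport.intro (isCompact_closedBall (0 : ℂ) R)
    intro z hz
    rw [mem_closedBall_zero_iff, not_le] at hz
    exact hβR z hz
  obtain ⟨h, hh, hdh, C, hC⟩ := exists_dbar_eq hβ hβc
  have hL0 : 0 ≤ L := (nsq_nonneg g _ _ _).trans (hL 0)
  -- The solution `h` is bounded but need not have compact support, so it is truncated by a second
  -- cutoff equal to `1` on the ball containing the support of `χ`. Its energy is chosen after the
  -- bound `C` of `h`, so that this truncation costs at most `η`; the summand `1` excludes a zero
  -- denominator.
  obtain ⟨ψ, hψ, hψc, hψ0, -, hψ1, hψE⟩ := exists_cutoff R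
    (show 0 < η / (C ^ 2 * L + 1) by positivity)
  obtain ⟨R', hR'⟩ := exists_radius hψc
  let H : ℂ → ℂ := fun z ↦ (ψ z : ℂ) * h z
  have hH : ContDiff ℝ ∞ H := (ofRealCLM.contDiff.comp hψ).mul hh
  let D : ℂ → ℂ := fun z ↦ dbar (fun z ↦ (ψ z : ℂ)) z * h z
  have hdH : ∀ z, dbar H z = β z + D z := by
    intro z
    have h1 : dbar H z = _ := dbar_mul (hψ.differentiable (by simp) z) (hh.differentiable (by simp) z)
    rw [h1, hdh]
    rcases lt_or_ge R ‖z‖ with hz | hz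
    · rw [hβR z hz, mul_zero]
    · rw [hψ1 z hz, ofReal_one, one_mul]
  have hAs := (ha.smul hχ).add (smoothField_mulRe hF hH)
  have hBs := (hb.smul hχ).add (smoothField_mulIm hF hH)
  have hA0 : ∀ z, max R R' < ‖z‖ → χ z • a z + mulRe n F H z = 0 := fun z hz ↦ by
    simp [hR z (lt_of_le_of_lt (le_max_left _ _) hz), mulRe, H,
      hR' z (lt_of_le_of_lt (le_max_right _ _) hz)]
  have hB0 : ∀ z, max R R' < ‖z‖ → χ z • b z + mulIm n F H z = 0 := fun z hz ↦ by
    simp [hR z (lt_of_le_of_lt (le_max_left _ _) hz), mulIm, H,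
      hR' z (lt_of_le_of_lt (le_max_right _ _) hz)]
  have key := integral_kap_le g hf hstable (hFf ▸ hAs) (hFf ▸ hBs) hA0 hB0
  have hkey : ∫ z, kap g (F z) (du F 1 z) (du F I z) (χ z • a z + mulRe n F H z)
      (χ z • b z + mulIm n F H z) ≤ ∫ z, nsq g (F z)
        (dRe g F (fun z ↦ χ z • a z + mulRe n F H z) (fun z ↦ χ z • b z + mulIm n F H z) z)
        (dIm g F (fun z ↦ χ z • a z + mulRe n F H z) (fun z ↦ χ z • b z + mulIm n F H z) z) := by
    subst hFf
    exact key
  -- The correction is a multiple of `X - iY`, invisible to the curvature term; the cutoff enters as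
  -- `χ²`.
  have hkap : ∀ z, kap g (F z) (du F 1 z) (du F I z) (χ z • a z + mulRe n F H z)
      (χ z • b z + mulIm n F H z) = χ z ^ 2 * kap g (F z) (du F 1 z) (du F I z) (a z) (b z) := by
    intro z
    rw [mulRe, mulIm, kap_add, kap_smul]
  simp only [hkap] at hkey
  refine hkey.trans ?_
  -- The fraction `1 - lam / (lam + δ)` of the `∂̄`-derivative that the regularized correction fails
  -- to remove.
  let θ : ℂ → ℝ := fun z ↦ δ / (lam z + δ)
  have hθ : Continuous θ := continuous_const.div (hlam.continuous.add continuous_const) hden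
  let N : ℂ → ℝ := fun z ↦ (χ z) ^ 2 * nsq g (F z) (dRe g F a b z) (dIm g F a b z) * θ z ^ 2
  have hN : Integrable N := by
    refine Continuous.integrable_of_hasCompactSupport
      (((hχ.continuous.pow 2).mul (continuous_nsq g hPs hQs)).mul (hθ.pow 2)) ?_
    apply HasCompactSupport.intro (isCompact_closedBall (0 : ℂ) R)
    intro z hz
    rw [mem_closedBall_zero_iff, not_le] at hz
    simp [N, hR z hz]
  have hg1 := integrable_gradSq hχ hχc
  have hg2 := integrable_gradSq hψ hψc
  have hpt : ∀ z, nsq g (F z)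
        (dRe g F (fun z ↦ χ z • a z + mulRe n F H z) (fun z ↦ χ z • b z + mulIm n F H z) z)
        (dIm g F (fun z ↦ χ z • a z + mulRe n F H z) (fun z ↦ χ z • b z + mulIm n F H z) z)
      ≤ 3 * (gradSq χ z * S + N z + gradSq ψ z * (C ^ 2 * L)) := by
    intro z
    have e1 : θ z • dRe g F a b z = dRe g F a b z - (p z • du F 1 z + q z • du F I z) := by
      have h1 := congrArg (fun v ↦ (lam z + δ)⁻¹ • v) (hP z)
      simp only [smul_add, smul_smul] at h1
      have h2 : p z = (lam z + δ)⁻¹ * ip g (F z) (dRe g F a b z) (du F 1 z) := by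
        simp only [p, div_eq_inv_mul]
      have h3 : q z = (lam z + δ)⁻¹ * ip g (F z) (dRe g F a b z) (du F I z) := by
        simp only [q, div_eq_inv_mul]
      have h4 : θ z = 1 - (lam z + δ)⁻¹ * lam z := by
        have := hden z
        simp only [θ]; field_simp; ring
      rw [h2, h3, ← h1, h4, sub_smul, one_smul]
    have e2 : θ z • dIm g F a b z = dIm g F a b z - (q z • du F 1 z - p z • du F I z) := by
      have h1 := congrArg (fun v ↦ (lam z + δ)⁻¹ • v) (hQ z)
      simp only [smul_sub, smul_smul] at h1
      have h2 : p z = (lam z + δ)⁻¹ * ip g (F z) (dRe g F a b z) (du F 1 z) := by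
        simp only [p, div_eq_inv_mul]
      have h3 : q z = (lam z + δ)⁻¹ * ip g (F z) (dRe g F a b z) (du F I z) := by
        simp only [q, div_eq_inv_mul]
      have h4 : θ z = 1 - (lam z + δ)⁻¹ * lam z := by
        have := hden z
        simp only [θ]; field_simp; ring
      rw [h2, h3, ← h1, h4, sub_smul, one_smul]
    have e3 : dRe g F (fun z ↦ χ z • a z + mulRe n F H z) (fun z ↦ χ z • b z + mulIm n F H z) z
        = (fderiv ℝ χ z 1 • a z - fderiv ℝ χ z I • b z) + (χ z * θ z) • dRe g F a b z
          + mulRe n F D z := by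
      rw [dRe_add g (ha.smul hχ) (hb.smul hχ) (smoothField_mulRe hF hH) (smoothField_mulIm hF hH),
        dRe_smul g hχ ha hb, dRe_mul g hF hharm hH, mul_smul, e1]
      simp only [mulRe, hdH, β]
      simp
      module
    have e4 : dIm g F (fun z ↦ χ z • a z + mulRe n F H z) (fun z ↦ χ z • b z + mulIm n F H z) z
        = (fderiv ℝ χ z 1 • b z + fderiv ℝ χ z I • a z) + (χ z * θ z) • dIm g F a b z
          + mulIm n F D z := by
      rw [dIm_add g (ha.smul hχ) (hb.smul hχ) (smoothField_mulRe hF hH) (smoothField_mulIm hF hH),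
        dIm_smul g hχ ha hb, dIm_mul g hF hharm hH, mul_smul, e2]
      simp only [mulIm, hdH, β]
      simp
      module
    rw [e3, e4]
    refine (nsq_add_le g _ _ _ _ _ _ _).trans ?_
    rw [nsq_rotate, nsq_smul, nsq_mul]
    have h1 : (fderiv ℝ χ z 1 ^ 2 + fderiv ℝ χ z I ^ 2) * nsq g (F z) (a z) (b z)
        ≤ gradSq χ z * S := mul_le_mul_of_nonneg_left (hS z) (gradSq_nonneg χ z)
    have h2 : (χ z * θ z) ^ 2 * nsq g (F z) (dRe g F a b z) (dIm g F a b z) = N z := by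
      simp only [N]; ring
    have h3 : ‖D z‖ ^ 2 * nsq g (F z) (du F 1 z) (du F I z) ≤ gradSq ψ z * (C ^ 2 * L) := by
      have h4 : ‖D z‖ ^ 2 = gradSq ψ z * ‖h z‖ ^ 2 := by
        simp only [D, norm_mul, mul_pow, norm_dbar_ofReal_sq hψ]
      rw [h4, mul_assoc]
      have h5 : ‖h z‖ ^ 2 ≤ C ^ 2 := by gcongr; exact hC z
      have := gradSq_nonneg ψ z
      have := nsq_nonneg g (F z) (du F 1 z) (du F I z)
      gcongr
      exact hL z
    linarith
  have hint : Integrable fun z ↦ 3 * (gradSq χ z * S + N z + gradSq ψ z * (C ^ 2 * L)) :=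
    (((hg1.mul_const S).add hN).add (hg2.mul_const _)).const_mul 3
  refine (integral_mono_of_nonneg (ae_of_all _ fun z ↦ nsq_nonneg g _ _ _) hint
    (ae_of_all _ hpt)).trans ?_
  have e1 : ∫ z, (gradSq χ z * S + N z + gradSq ψ z * (C ^ 2 * L))
      = (∫ z, (gradSq χ z * S + N z)) + ∫ z, gradSq ψ z * (C ^ 2 * L) :=
    integral_add ((hg1.mul_const S).add hN) (hg2.mul_const _)
  have e2 : ∫ z, (gradSq χ z * S + N z) = (∫ z, gradSq χ z * S) + ∫ z, N z :=
    integral_add (hg1.mul_const S) hN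
  rw [integral_const_mul, e1, e2, integral_mul_const, integral_mul_const]
  have h6 : (∫ z, gradSq ψ z) * (C ^ 2 * L) ≤ η := by
    have h7 : 0 ≤ C ^ 2 * L := by positivity
    calc (∫ z, gradSq ψ z) * (C ^ 2 * L) ≤ η / (C ^ 2 * L + 1) * (C ^ 2 * L) := by gcongr
      _ ≤ η := by
          rw [div_mul_eq_mul_div, div_le_iff₀ (by positivity)]
          nlinarith
  gcongr

end KeyInequality

/-! ### Removing the regularization and the cutoffs -/

section LimitInequality

open Complex Set Filter

variable {n : ℕ} {M : Type*} [TopologicalSpace M] [ChartedSpace (EE n) M]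
  [IsManifold (𝓡 n) ∞ M] (g : RMetric n M)

lemma continuous_rt {F : ℂ → M} {A B C D : ℂ → EE n} (hA : SmoothField F A) (hB : SmoothField F B)
    (hC : SmoothField F C) (hD : SmoothField F D) :
    Continuous fun z ↦ rt g (F z) (A z) (B z) (C z) (D z) :=
  ((hA.cv g hB hC).ip g hD).continuous

lemma continuous_secSum {F : ℂ → M} {A B C D : ℂ → EE n} (hA : SmoothField F A)
    (hB : SmoothField F B) (hC : SmoothField F C) (hD : SmoothField F D) :
    Continuous fun z ↦ secSum g (F z) (A z) (B z) (C z) (D z) :=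
  ((continuous_rt g hA hC hC hA).add (continuous_rt g hB hC hC hB)).add
    ((continuous_rt g hA hD hD hA).add (continuous_rt g hB hD hD hB))

/-- The regularization of the error term disappears in the limit. -/
lemma tendsto_integral_regularized {w lam : ℂ → ℝ} (hw : Continuous w) (hwc : HasCompactSupport w)
    (hlam : Continuous lam) (hlam0 : ∀ z, 0 ≤ lam z) (hvol : volume {z | lam z = 0} = 0) :
    Tendsto (fun k : ℕ ↦ ∫ z, w z * ((1 / ((k : ℝ) + 1)) / (lam z + 1 / ((k : ℝ) + 1))) ^ 2) atTop
      (nhds 0) := by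
  have hpos : ∀ k : ℕ, (0 : ℝ) < 1 / ((k : ℝ) + 1) := fun k ↦ by positivity
  have hden : ∀ (k : ℕ) z, lam z + 1 / ((k : ℝ) + 1) ≠ 0 := fun k z ↦ by
    have := hlam0 z; have := hpos k; positivity
  have h := tendsto_integral_of_dominated_convergence (μ := volume)
    (F := fun (k : ℕ) z ↦ w z * ((1 / ((k : ℝ) + 1)) / (lam z + 1 / ((k : ℝ) + 1))) ^ 2)
    (f := fun _ ↦ (0 : ℝ)) (fun z ↦ |w z|) ?_ ?_ ?_ ?_
  · simpa using h
  · intro k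
    exact (hw.mul ((continuous_const.div (hlam.add continuous_const) (hden k)).pow
      2)).aestronglyMeasurable
  · exact (hw.integrable_of_hasCompactSupport hwc).abs
  · intro k
    refine ae_of_all _ fun z ↦ ?_
    rw [Real.norm_eq_abs, abs_mul]
    refine mul_le_of_le_one_right (abs_nonneg _) ?_
    have h1 := hpos k
    have h2 : 0 ≤ 1 / ((k : ℝ) + 1) / (lam z + 1 / ((k : ℝ) + 1)) :=
      div_nonneg h1.le (add_nonneg (hlam0 z) h1.le)
    have h3 : 1 / ((k : ℝ) + 1) / (lam z + 1 / ((k : ℝ) + 1)) ≤ 1 :=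
      div_le_one_of_le₀ (by linarith [hlam0 z]) (add_nonneg (hlam0 z) h1.le)
    rw [abs_of_nonneg (sq_nonneg _)]
    exact pow_le_one₀ h2 h3
  -- Only here does the measure of the branch set matter: at a point with `lam z = 0` the quotient
  -- is `1` for every `k`.
  · have hae : ∀ᵐ z, lam z ≠ 0 := by
      rw [ae_iff]; simpa using hvol
    filter_upwards [hae] with z hz
    have h1 : Tendsto (fun k : ℕ ↦ 1 / ((k : ℝ) + 1)) atTop (nhds 0) :=
      tendsto_one_div_add_atTop_nhds_zero_nat
    have h2 := ((h1.div (h1.const_add (lam z)) (by simpa using hz)).pow 2).const_mul (w z)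
    simpa using h2

variable {f : S2 → M} (hf : IsHarmonic g f) (hstable : IsStable g f)
    {F : ℂ → M} (hFf : F = fun ζ ↦ f (stereo ζ)) {a b : ℂ → EE n} (ha : SmoothField F a)
    (hb : SmoothField F b) {S L : ℝ} (hS : ∀ z, nsq g (F z) (a z) (b z) ≤ S)
    (hL : ∀ z, nsq g (F z) (du F 1 z) (du F I z) ≤ L) {lam : ℂ → ℝ} (hlam : ContDiff ℝ ∞ lam)
    (hlam0 : ∀ z, 0 ≤ lam z) (hvol : volume {z | lam z = 0} = 0)
    (hP : ∀ z, lam z • dRe g F a b z = ip g (F z) (dRe g F a b z) (du F 1 z) • du F 1 z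
      + ip g (F z) (dRe g F a b z) (du F I z) • du F I z)
    (hQ : ∀ z, lam z • dIm g F a b z = ip g (F z) (dRe g F a b z) (du F I z) • du F 1 z
      - ip g (F z) (dRe g F a b z) (du F 1 z) • du F I z)

include hf hstable hFf ha hb hS hL hlam hlam0 hvol hP hQ

/-- The curvature inequality for a section whose `∂̄`-derivative is tangential. -/
theorem integral_sq_mul_kap_le {χ : ℂ → ℝ} (hχ : ContDiff ℝ ∞ χ) (hχc : HasCompactSupport χ) :
    ∫ z, χ z ^ 2 * kap g (F z) (du F 1 z) (du F I z) (a z) (b z) ≤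
      3 * ((∫ z, gradSq χ z) * S) := by
  have hPs : SmoothField F (dRe g F a b) := (ha.cov g 1).sub (hb.cov g I)
  have hQs : SmoothField F (dIm g F a b) := (hb.cov g 1).add (ha.cov g I)
  have hwc : HasCompactSupport fun z ↦ χ z ^ 2 * nsq g (F z) (dRe g F a b z) (dIm g F a b z) := by
    obtain ⟨R, hR⟩ := exists_radius hχc
    apply HasCompactSupport.intro (isCompact_closedBall (0 : ℂ) R)
    intro z hz
    rw [mem_closedBall_zero_iff, not_le] at hz
    simp [hR z hz]
  have hwcont : Continuous fun z ↦ χ z ^ 2 * nsq g (F z) (dRe g F a b z) (dIm g F a b z) :=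
    (hχ.continuous.pow 2).mul (continuous_nsq g hPs hQs)
  have h1 := tendsto_integral_regularized hwcont hwc hlam.continuous hlam0 hvol
  have h2 : Tendsto (fun k : ℕ ↦ 1 / ((k : ℝ) + 1)) atTop (nhds 0) :=
    tendsto_one_div_add_atTop_nhds_zero_nat
  have h3 := ((h1.const_add ((∫ z, gradSq χ z) * S)).add h2).const_mul 3
  rw [add_zero, add_zero] at h3
  refine ge_of_tendsto' h3 fun k ↦ ?_
  exact integral_sq_mul_kap_le_add g hf hstable hFf ha hb hS hL hlam hlam0 hP hQ hχ hχc
    (by positivity) (by positivity)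

/-- The integral of the sectional curvatures is bounded by that of the Hermitian form. -/
theorem integral_secSum_le
    (hsec : ∀ z, 0 ≤ secSum g (F z) (du F 1 z) (du F I z) (a z) (b z))
    (hm : Integrable fun z ↦ 2 * rt g (F z) (du F 1 z) (du F I z) (a z) (b z)) {R : ℝ}
    (hR : 0 < R) :
    ∫ z, cut R z ^ 2 * secSum g (F z) (du F 1 z) (du F I z) (a z) (b z)
      ≤ ∫ z, 2 * rt g (F z) (du F 1 z) (du F I z) (a z) (b z) := by
  have hF : ContMDiff 𝓘(ℝ, ℂ) (𝓡 n) ∞ F := ha.map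
  have hX := smoothField_du (n := n) hF 1
  have hY := smoothField_du (n := n) hF I
  have hsc := continuous_secSum g hX hY ha hb
  set σ : ℂ → ℝ := fun z ↦ secSum g (F z) (du F 1 z) (du F I z) (a z) (b z) with hσ
  set m : ℂ → ℝ := fun z ↦ 2 * rt g (F z) (du F 1 z) (du F I z) (a z) (b z) with hmdef
  have hmc : Continuous m := continuous_const.mul (continuous_rt g hX hY ha hb)
  have hε : ∀ k : ℕ, (0 : ℝ) < 1 / ((k : ℝ) + 1) := fun k ↦ by positivity
  -- The cutoffs are `1` on the support of `cut R`, so that the fixed left-hand side is dominated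
  -- for every `k` without assuming the sectional term integrable. They are also `1` on balls
  -- exhausting the plane, and their energies tend to zero.
  choose χ hχ hχc hχ0 hχ1 hχR hχE using fun k : ℕ ↦ exists_cutoff (max (2 * R) k) (hε k)
  have hS0 : 0 ≤ S := (nsq_nonneg g _ _ _).trans (hS 0)
  have hχ2c : ∀ {χ : ℂ → ℝ}, HasCompactSupport χ → HasCompactSupport fun z ↦ χ z ^ 2 := by
    intro χ h
    exact h.comp_left (g := fun x : ℝ ↦ x ^ 2) (by simp)
  have hint : ∀ {χ h : ℂ → ℝ}, ContDiff ℝ ∞ χ → HasCompactSupport χ → Continuous h →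
      Integrable fun z ↦ χ z ^ 2 * h z := by
    intro χ h h1 h2 h3
    exact ((h1.continuous.pow 2).mul h3).integrable_of_hasCompactSupport
      (HasCompactSupport.mul_right (hχ2c h2))
  have hbound : ∀ k : ℕ, ∫ z, cut R z ^ 2 * σ z ≤
      3 * (1 / ((k : ℝ) + 1) * S) + ∫ z, χ k z ^ 2 * m z := by
    intro k
    have h1 : ∫ z, cut R z ^ 2 * σ z ≤ ∫ z, χ k z ^ 2 * σ z := by
      refine integral_mono (hint (contDiff_cut R) (hasCompactSupport_cut hR) hsc)
        (hint (hχ k) (hχc k) hsc) fun z ↦ ?_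
      refine mul_le_mul_of_nonneg_right ?_ (hsec z)
      rcases le_or_gt ‖z‖ (2 * R) with hz | hz
      · rw [hχR k z (hz.trans (le_max_left _ _))]
        exact pow_le_pow_left₀ (cut_nonneg R z) (cut_le_one R z) 2
      · rw [cut_eq_zero hR hz.le]
        nlinarith [hχ0 k z]
    have h2 := integral_sq_mul_kap_le g hf hstable hFf ha hb hS hL hlam hlam0 hvol hP hQ (hχ k)
      (hχc k)
    have h3 : ∫ z, χ k z ^ 2 * kap g (F z) (du F 1 z) (du F I z) (a z) (b z)
        = (∫ z, χ k z ^ 2 * σ z) - ∫ z, χ k z ^ 2 * m z := by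
      rw [← integral_sub (hint (hχ k) (hχc k) hsc) (hint (hχ k) (hχc k) hmc)]
      refine integral_congr_ae (ae_of_all _ fun z ↦ ?_)
      simp only [kap_eq, hσ, hmdef]
      ring
    have h4 : (∫ z, gradSq (χ k) z) * S ≤ 1 / ((k : ℝ) + 1) * S :=
      mul_le_mul_of_nonneg_right (hχE k) hS0
    linarith
  have hlim : Tendsto (fun k ↦ ∫ z, χ k z ^ 2 * m z) atTop (nhds (∫ z, m z)) := by
    refine tendsto_integral_of_dominated_convergence (fun z ↦ |m z|) (fun k ↦
      (((hχ k).continuous.pow 2).mul hmc).aestronglyMeasurable) hm.abs (fun k ↦ ae_of_all _ fun z ↦ ?_)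
      (ae_of_all _ fun z ↦ ?_)
    · rw [Real.norm_eq_abs, abs_mul, abs_of_nonneg (sq_nonneg _)]
      exact mul_le_of_le_one_left (abs_nonneg _) (pow_le_one₀ (hχ0 k z) (hχ1 k z))
    · refine tendsto_const_nhds.congr' ?_
      obtain ⟨N, hN⟩ := exists_nat_ge ‖z‖
      filter_upwards [eventually_ge_atTop N] with k hk
      have : ‖z‖ ≤ max (2 * R) k := hN.trans ((Nat.cast_le.2 hk).trans (le_max_right _ _))
      rw [hχR k z this, one_pow, one_mul]
  have h2 : Tendsto (fun k : ℕ ↦ 1 / ((k : ℝ) + 1)) atTop (nhds 0) :=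
    tendsto_one_div_add_atTop_nhds_zero_nat
  have h3 := ((h2.mul_const S).const_mul 3).add hlim
  rw [zero_mul, mul_zero, zero_add] at h3
  exact ge_of_tendsto' h3 hbound

end LimitInequality

/-! ### Positivity of the curvature term -/

section Positivity

variable {n : ℕ} {M : Type*} [TopologicalSpace M] [ChartedSpace (EE n) M]
  [IsManifold (𝓡 n) ∞ M] (g : RMetric n M)

lemma curv_eq_rt (p : M) (a b c d : EE n) : curv g p a b c d = rt g p a b c d := by
  have h : ip g p (curvOp g p a b c) d = rt g p a b c d := by rw [curvOp_eq_cv]; rfl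
  exact h

variable {g}

lemma rt_pos (hg : PositiveCurvature g) (p : M) {a b : EE n} (h : LinearIndependent ℝ ![a, b]) :
    0 < rt g p a b b a := by
  rw [← curv_eq_rt]; exact hg p a b h

/-- On dependent pairs the expression vanishes by skew symmetry, so positivity on planes gives
nonnegativity throughout. -/
lemma rt_nonneg (hg : PositiveCurvature g) (p : M) (a b : EE n) : 0 ≤ rt g p a b b a := by
  by_cases h : LinearIndependent ℝ ![a, b]
  · exact (rt_pos hg p h).le
  · rw [LinearIndependent.pair_iff] at h
    push Not at h
    obtain ⟨s, t, hst, hne⟩ := h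
    refine le_of_eq (Eq.symm ?_)
    by_cases hs : s = 0
    · have ht := hne hs
      have hb : b = 0 := by simpa [hs, ht] using hst
      have := rt_smul_two g p 0 a b b a
      rw [hb] at this ⊢
      simpa using this
    · have ha : a = (-(s⁻¹ * t)) • b := by
        have h1 : a = s⁻¹ • (s • a + t • b) - (s⁻¹ * t) • b := by
          rw [smul_add, smul_smul, smul_smul, inv_mul_cancel₀ hs, one_smul, add_sub_cancel_right]
        rw [hst, smul_zero, zero_sub] at h1
        rw [neg_smul]; exact h1
      rw [ha, rt_smul_one, rt_self_left, mul_zero]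

lemma linearIndependent_of_ip (p : M) {X a : EE n} (hX : X ≠ 0) (ha : a ≠ 0)
    (h : ip g p X a = 0) : LinearIndependent ℝ ![X, a] := by
  rw [LinearIndependent.pair_iff]
  intro s t hst
  have h1 := congrArg (fun v ↦ ip g p v X) hst
  have h2 := congrArg (fun v ↦ ip g p v a) hst
  simp only [map_add, map_smul, add_apply, smul_apply, smul_eq_mul, map_zero, zero_apply,
    ip_symm g p a X, h, mul_zero, add_zero, zero_add, mul_eq_zero, (ip_pos g p hX).ne',
    (ip_pos g p ha).ne', or_false] at h1 h2
  exact ⟨h1, h2⟩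

lemma secSum_nonneg (hg : PositiveCurvature g) (p : M) (X Y a b : EE n) :
    0 ≤ secSum g p X Y a b := by
  have := rt_nonneg hg p
  exact add_nonneg (add_nonneg (this _ _) (this _ _)) (add_nonneg (this _ _) (this _ _))

/-- A nonzero one of `a` and `b` is orthogonal to `X`, hence spans a plane with it, and the
corresponding sectional term is positive. -/
lemma secSum_pos (hg : PositiveCurvature g) (p : M) {X Y a b : EE n} (hX : X ≠ 0)
    (hab : ¬ (a = 0 ∧ b = 0)) (ha : ip g p X a = 0) (hb : ip g p X b = 0) :
    0 < secSum g p X Y a b := by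
  have h := rt_nonneg hg p
  by_cases h0 : a = 0
  · have h1 := rt_pos hg p (linearIndependent_of_ip p hX (fun h1 ↦ hab ⟨h0, h1⟩) hb)
    exact add_pos_of_nonneg_of_pos (add_nonneg (h _ _) (h _ _)) (add_pos_of_pos_of_nonneg h1 (h _ _))
  · have h1 := rt_pos hg p (linearIndependent_of_ip p hX h0 ha)
    exact add_pos_of_pos_of_nonneg (add_pos_of_pos_of_nonneg h1 (h _ _))
      (add_nonneg (h _ _) (h _ _))

end Positivity

/-! ### The complexification of a real vector space -/

section Complexified

open Complex

variable {V : Type*} [AddCommGroup V] [Module ℝ V]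

lemma reT_tmul (c : ℂ) (v : V) : reT (c ⊗ₜ[ℝ] v) = c.re • v := by simp [reT]

lemma imT_tmul (c : ℂ) (v : V) : imT (c ⊗ₜ[ℝ] v) = c.im • v := by simp [imT]

lemma reT_add (s t : ℂ ⊗[ℝ] V) : reT (s + t) = reT s + reT t := by simp [reT]

lemma imT_add (s t : ℂ ⊗[ℝ] V) : imT (s + t) = imT s + imT t := by simp [imT]

lemma reT_mkT (v w : V) : reT (mkT v w) = v := by simp [mkT, reT_add, reT_tmul]

lemma imT_mkT (v w : V) : imT (mkT v w) = w := by simp [mkT, imT_add, imT_tmul]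

lemma reT_smul_imT_smul (c : ℂ) (s : ℂ ⊗[ℝ] V) :
    reT (c • s) = c.re • reT s - c.im • imT s ∧ imT (c • s) = c.re • imT s + c.im • reT s := by
  induction s using TensorProduct.induction_on with
  | zero => simp [reT, imT]
  | tmul d v =>
    rw [TensorProduct.smul_tmul', reT_tmul, imT_tmul, reT_tmul, imT_tmul, smul_eq_mul, mul_re,
      mul_im]
    constructor <;> module
  | add x y hx hy =>
    rw [smul_add, reT_add, imT_add, reT_add, imT_add, hx.1, hx.2, hy.1, hy.2]
    constructor <;> module

lemma reT_smul (c : ℂ) (s : ℂ ⊗[ℝ] V) : reT (c • s) = c.re • reT s - c.im • imT s :=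
  (reT_smul_imT_smul c s).1

lemma imT_smul (c : ℂ) (s : ℂ ⊗[ℝ] V) : imT (c • s) = c.re • imT s + c.im • reT s :=
  (reT_smul_imT_smul c s).2

lemma mkT_reT_imT (s : ℂ ⊗[ℝ] V) : mkT (reT s) (imT s) = s := by
  induction s using TensorProduct.induction_on with
  | zero => simp [reT, imT, mkT]
  | tmul d v =>
    rw [reT_tmul, imT_tmul, mkT, ← TensorProduct.smul_tmul, ← TensorProduct.smul_tmul,
      ← TensorProduct.add_tmul]
    congr 1
    apply Complex.ext <;> simp
  | add x y hx hy =>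
    conv_rhs => rw [← hx, ← hy]
    rw [reT_add, imT_add, mkT, mkT, mkT, TensorProduct.tmul_add, TensorProduct.tmul_add]
    abel

end Complexified

/-! ### The Hermitian form in real terms -/

section Form

open Complex

variable {n : ℕ} {M : Type*} [TopologicalSpace M] [ChartedSpace (EE n) M]
  [IsManifold (𝓡 n) ∞ M] (g : RMetric n M)

/-- The density of the Hermitian form with respect to `dx dy`, in terms of the real and imaginary
parts of the sections. -/
def density (F : ℂ → M) (a b a' b' : ℂ → EE n) (z : ℂ) : ℂ :=
  ((rt g (F z) (du F 1 z) (du F I z) (a z) (b' z)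
      - rt g (F z) (du F 1 z) (du F I z) (b z) (a' z) : ℝ) : ℂ)
    + I * ((rt g (F z) (du F 1 z) (du F I z) (a z) (a' z)
      + rt g (F z) (du F 1 z) (du F I z) (b z) (b' z) : ℝ) : ℂ)

lemma rt_zero_left (p : M) (b c d : EE n) : rt g p 0 b c d = 0 := by
  simpa using rt_smul_one g p 0 b b c d

lemma rt_neg_four (p : M) (a b c d : EE n) : rt g p a b c (-d) = - rt g p a b c d := by
  simpa using rt_smul_four g p (-1) a b c d

/-- The orthonormal frame and the area density enter only through the product of `B` and `r`; by
`hB` this is the form `R(X, Y, ·, ·)`, which has no singularity at branch points. -/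
lemma I_mul_extC (p : M) (X Y : EE n) {r : ℝ} {B : EE n → EE n → ℝ}
    (hB : ∀ c d, B c d * r = rt g p X Y c d) (v w : ℂ ⊗[ℝ] EE n) :
    I * extC B v (conjT w) * (r : ℂ) =
      ((rt g p X Y (reT v) (imT w) - rt g p X Y (imT v) (reT w) : ℝ) : ℂ)
      + I * ((rt g p X Y (reT v) (reT w) + rt g p X Y (imT v) (imT w) : ℝ) : ℂ) := by
  rw [extC, conjT, reT_mkT, imT_mkT]
  have h1 := hB (reT v) (reT w)
  have h2 := hB (imT v) (reT w)
  have h3 := hB (reT v) (-imT w)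
  have h4 := hB (imT v) (-imT w)
  rw [rt_neg_four] at h3 h4
  apply Complex.ext
  · simp only [mul_re, mul_im, add_re, add_im, I_re, I_im, ofReal_re, ofReal_im]
    linarith
  · simp only [mul_re, mul_im, add_re, add_im, I_re, I_im, ofReal_re, ofReal_im]
    linarith

/-- By conformality the Gram-Schmidt process only rescales: `e₁ = X / l`, `e₂ = Y / l`, and the area
density is `l²`. Where `X = 0` both sides vanish. -/
lemma curv_frame_mul_area {f : S2 → M} (hf : IsHarmonic g f) {F : ℂ → M}
    (hFf : F = fun ζ ↦ f (stereo ζ)) (z : ℂ) (c d : EE n) :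
    curv g (f (stereo z)) (e₁ g f z) (e₂ g f z) c d * areaDensity g f z
      = rt g (F z) (du F 1 z) (du F I z) c d := by
  subst hFf
  obtain ⟨h1, h2⟩ := conformal_of_harmonic g hf z
  set X : EE n := du (n := n) (fun ζ ↦ f (stereo ζ)) 1 z with hX
  set Y : EE n := du (n := n) (fun ζ ↦ f (stereo ζ)) I z with hY
  set l : ℝ := √(ip g (f (stereo z)) X X) with hl
  have hgX : gnorm g (f (stereo z)) (dd (n := n) f 1 z) = l := rfl
  have he1 : (e₁ g f z : EE n) = l⁻¹ • X := rfl
  have hperp : (fyPerp g f z : EE n) = Y := by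
    change Y - ip g (f (stereo z)) Y (l⁻¹ • X) • (l⁻¹ • X) = Y
    rw [map_smul, ip_symm, h2, smul_zero, zero_smul, sub_zero]
  have hgp : gnorm g (f (stereo z)) (fyPerp g f z) = l := by
    have : gnorm g (f (stereo z)) (fyPerp g f z) = √(ip g (f (stereo z)) (fyPerp g f z) (fyPerp g f z)) :=
      rfl
    rw [this, hperp, ← h1]
  have he2 : (e₂ g f z : EE n) = l⁻¹ • Y := by
    have : (e₂ g f z : EE n) = (gnorm g (f (stereo z)) (fyPerp g f z))⁻¹ • (fyPerp g f z : EE n) := rfl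
    rw [this, hgp, hperp]
    rfl
  have harea : areaDensity g f z = l * l := by rw [areaDensity, hgX, hgp]
  have hc : curv g (f (stereo z)) (e₁ g f z) (e₂ g f z) c d
      = rt g (f (stereo z)) (l⁻¹ • X) (l⁻¹ • Y) c d := by
    rw [← he1, ← he2]; exact curv_eq_rt g _ _ _ _ _
  rw [hc, harea, rt_smul_one, rt_smul_two]
  by_cases hX0 : X = 0
  · simp [hX0, rt_zero_left]
  · have hl0 : l ≠ 0 := (Real.sqrt_pos.2 (ip_pos g _ hX0)).ne'
    field_simp

lemma form_eq_integral {f : S2 → M} (hf : IsHarmonic g f) {F : ℂ → M}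
    (hFf : F = fun ζ ↦ f (stereo ζ)) (s t : CSection n f) :
    form g f s t = ∫ z, density g F (fun z ↦ reT (s (stereo z))) (fun z ↦ imT (s (stereo z)))
      (fun z ↦ reT (t (stereo z))) (fun z ↦ imT (t (stereo z))) z := by
  refine integral_congr_ae (ae_of_all _ fun z ↦ ?_)
  exact I_mul_extC g (F z) (du F 1 z) (du F I z) (curv_frame_mul_area g hf hFf z)
    (s (stereo z)) (t (stereo z))

end Form

/-! ### Holomorphic sections of the normal bundle in real terms -/

section Holomorphic

open Complex Set

variable {n : ℕ} {M : Type*} [TopologicalSpace M] [ChartedSpace (EE n) M]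
  [IsManifold (𝓡 n) ∞ M] (g : RMetric n M)

lemma du_comp_stereo_eq {f : S2 → M} (hf : ContMDiff (𝓡 2) (𝓡 n) ∞ f) (e z : ℂ) :
    du (n := n) (fun ζ ↦ f (stereo ζ)) e z
      = mfderiv (𝓡 2) (𝓡 n) f (stereo z) (mfderiv 𝓘(ℝ, ℂ) (𝓡 2) stereo z e) := by
  have h := mfderiv_comp z (I'' := 𝓡 n) ((hf (stereo z)).mdifferentiableAt (by simp))
    ((contMDiff_stereo z).mdifferentiableAt (by simp))
  exact congrArg (fun T ↦ T e) h

/-- The derivatives of a normal field, paired with the tangent plane, and the harmonic map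
equation. -/
lemma ip_dRe_dIm {F : ℂ → M} (hF : ContMDiff 𝓘(ℝ, ℂ) (𝓡 n) ∞ F)
    (hharm : ∀ z, cov g F (du F 1) 1 z + cov g F (du F I) I z = 0) {a b : ℂ → EE n}
    (ha : SmoothField F a) (hb : SmoothField F b) (hna : ∀ e z, ip g (F z) (du F e z) (a z) = 0)
    (hnb : ∀ e z, ip g (F z) (du F e z) (b z) = 0) (z : ℂ) :
    ip g (F z) (dIm g F a b z) (du F 1 z) = ip g (F z) (dRe g F a b z) (du F I z) ∧
      ip g (F z) (dIm g F a b z) (du F I z) = - ip g (F z) (dRe g F a b z) (du F 1 z) := by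
  -- Differentiating `⟨F_e', V⟩ = 0` moves the derivative to `F_e'`. The conclusion says that the
  -- `∂̄`-derivative has zero complex bilinear product with `F_x - i F_y`; an isotropic line in the
  -- complexified tangent plane is its own orthogonal complement there, so a tangential such vector
  -- lies in the line.
  have key : ∀ {V : ℂ → EE n}, SmoothField F V → (∀ e z, ip g (F z) (du F e z) (V z) = 0) →
      ∀ e e', ip g (F z) (cov g F V e z) (du F e' z) = - ip g (F z) (cov g F (du F e') e z) (V z) := by
    intro V hV hn e e'
    have h1 := fderiv_ip g (smoothField_du hF e') hV e z
    have h2 : (fun ζ ↦ ip g (F ζ) (du F e' ζ) (V ζ)) = fun _ ↦ 0 := funext fun ζ ↦ hn e' ζ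
    rw [h2, fderiv_fun_const, Pi.zero_apply, zero_apply, ip_symm g _ (du F e' z)] at h1
    linarith
  have h3 : cov g F (du F I) I z = - cov g F (du F 1) 1 z := eq_neg_of_add_eq_zero_right (hharm z)
  simp only [dRe, dIm, map_add, map_sub, add_apply, sub_apply, key ha hna, key hb hnb,
    cov_du_symm g hF 1 I z, h3, map_neg, neg_apply]
  constructor <;> ring

/-- The `∂̄`-derivative of a holomorphic section is tangential. -/
lemma exists_dRe_dIm_eq {f : S2 → M} {s : CSection n f} (hs : s ∈ holSections g f) {F : ℂ → M}
    (hFf : F = fun ζ ↦ f (stereo ζ)) (z : ℂ)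
    (h : LinearIndependent ℝ ![du (n := n) F 1 z, du (n := n) F I z]) : ∃ c d : ℂ,
      dRe g F (fun ζ ↦ reT (s (stereo ζ))) (fun ζ ↦ imT (s (stereo ζ))) z
        = c.re • du F 1 z + d.re • du F I z ∧
      dIm g F (fun ζ ↦ reT (s (stereo ζ))) (fun ζ ↦ imT (s (stereo ζ))) z
        = c.im • du F 1 z + d.im • du F I z := by
  subst hFf
  obtain ⟨c, d, hcd⟩ := Submodule.mem_span_pair.1 (hs.2 z h)
  set X : EE n := du (n := n) (fun ζ ↦ f (stereo ζ)) 1 z with hX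
  set Y : EE n := du (n := n) (fun ζ ↦ f (stereo ζ)) I z with hY
  set A : EE n := dRe g (fun ζ ↦ f (stereo ζ)) (fun ζ ↦ reT (s (stereo ζ)))
    (fun ζ ↦ imT (s (stereo ζ))) z with hA
  set B : EE n := dIm g (fun ζ ↦ f (stereo ζ)) (fun ζ ↦ reT (s (stereo ζ)))
    (fun ζ ↦ imT (s (stereo ζ))) z with hB
  have h1 : ∀ p q r t : EE n, reT ((1 / 2 : ℂ) • (mkT p q + I • mkT r t)) = (1 / 2 : ℝ) • (p - t) ∧
      imT ((1 / 2 : ℂ) • (mkT p q + I • mkT r t)) = (1 / 2 : ℝ) • (q + r) := by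
    intro p q r t
    have hr : (1 / 2 : ℂ).re = 1 / 2 := by norm_num
    have hi : (1 / 2 : ℂ).im = 0 := by norm_num
    rw [reT_smul, imT_smul, reT_add, imT_add, reT_smul, imT_smul, hr, hi]
    simp only [reT_mkT, imT_mkT, I_re, I_im]
    constructor <;> module
  have h2 : ∀ p q : EE n, reT (c • ((1 : ℂ) ⊗ₜ[ℝ] p) + d • ((1 : ℂ) ⊗ₜ[ℝ] q)) = c.re • p + d.re • q ∧
      imT (c • ((1 : ℂ) ⊗ₜ[ℝ] p) + d • ((1 : ℂ) ⊗ₜ[ℝ] q)) = c.im • p + d.im • q := by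
    intro p q
    rw [reT_add, imT_add, TensorProduct.smul_tmul', TensorProduct.smul_tmul', smul_eq_mul, mul_one,
      smul_eq_mul, mul_one, reT_tmul, reT_tmul, imT_tmul, imT_tmul]
    exact ⟨rfl, rfl⟩
  have hre : c.re • X + d.re • Y = (1 / 2 : ℝ) • A := by
    rw [← (h2 X Y).1]
    exact (congrArg reT hcd).trans (h1 _ _ _ _).1
  have him : c.im • X + d.im • Y = (1 / 2 : ℝ) • B := by
    rw [← (h2 X Y).2]
    exact (congrArg imT hcd).trans (h1 _ _ _ _).2
  -- The factor `2` undoes the `½` in `∇_z̄`, since `dRe` and `dIm` are the parts of `∇_x + i ∇_y`.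
  refine ⟨2 * c, 2 * d, ?_, ?_⟩
  · have : A = (2 : ℝ) • ((1 / 2 : ℝ) • A) := by module
    rw [this, ← hre]
    simp [smul_smul]
  · have : B = (2 : ℝ) • ((1 / 2 : ℝ) • B) := by module
    rw [this, ← him]
    simp [smul_smul]

/-- A map of the plane with vanishing differential is constant. -/
lemma const_of_du_eq_zero {F : ℂ → M} (hF : ContMDiff 𝓘(ℝ, ℂ) (𝓡 n) ∞ F)
    (h : ∀ z, du (n := n) F 1 z = 0 ∧ du (n := n) F I z = 0) (z w : ℂ) : F z = F w := by
  refine IsLocallyConstant.apply_eq_of_preconnectedSpace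
    ((IsLocallyConstant.iff_eventually_eq F).2 fun z ↦ ?_) z w
  obtain ⟨r, hr, hball⟩ := Metric.mem_nhds_iff.1
    ((hF z).continuousAt.preimage_mem_nhds (source_mem_nhds' (mem_extChartAt_source (I := 𝓡 n) (F z))))
  filter_upwards [Metric.ball_mem_nhds z hr] with y hy
  have hz : z ∈ Metric.ball z r := Metric.mem_ball_self hr
  refine (extChartAt (𝓡 n) (F z)).injOn (hball hy) (hball hz) ?_
  refine Metric.isOpen_ball.is_const_of_fderiv_eq_zero (𝕜 := ℝ)
    (f := fun ζ ↦ extChartAt (𝓡 n) (F z) (F ζ)) (convex_ball z r).isPreconnected ?_ ?_ hy hz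
  · intro ζ hζ
    have := (contMDiffAt_chart (hball hζ)).comp ζ (hF ζ)
    exact (this.contDiffAt.differentiableAt (by simp)).differentiableWithinAt
  · intro ζ hζ
    ext1 e
    have := tc_du ((hF ζ).mdifferentiableAt (by simp)) (hball hζ) e
    rw [← this, du_eq_re_im, (h ζ).1, (h ζ).2]
    simp

lemma exists_nsq_du_le {f : S2 → M} (hf : ContMDiff (𝓡 2) (𝓡 n) ∞ f) {F : ℂ → M}
    (hFf : F = fun ζ ↦ f (stereo ζ)) : ∃ L, ∀ z, nsq g (F z) (du F 1 z) (du F I z) ≤ L := by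
  subst hFf
  obtain ⟨C, hC0, hC⟩ := exists_ip_du_le g hf
  have hF := contMDiff_comp_stereo hf
  set F : ℂ → M := fun ζ ↦ f (stereo ζ)
  have hFz : ∀ z, f (stereo z) = F z := fun _ ↦ rfl
  simp only [hFz] at hC
  obtain ⟨C', hC'0, hC'⟩ := exists_bound_closedBall
    (continuous_nsq g (smoothField_du (n := n) hF 1) (smoothField_du (n := n) hF I))
  refine ⟨C + C + C', fun z ↦ ?_⟩
  rcases le_total ‖z‖ 1 with hz | hz
  · have := (le_abs_self _).trans (hC' z hz)
    linarith
  · have h1 := (le_abs_self _).trans (hC z 1 1 hz (by simp) (by simp))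
    have h2 := (le_abs_self _).trans (hC z I I hz (by simp) (by simp))
    have h3 : C * (‖z‖ ^ 4)⁻¹ ≤ C :=
      mul_le_of_le_one_right hC0 (inv_le_one_of_one_le₀ (one_le_pow₀ hz))
    rw [nsq]
    linarith

lemma integrable_rt_du {f : S2 → M} (hf : ContMDiff (𝓡 2) (𝓡 n) ∞ f) {F : ℂ → M}
    (hFf : F = fun ζ ↦ f (stereo ζ)) {V W : S2 → EE n}
    (hV : ContMDiff (𝓡 2) (𝓡 n).tangent ∞ (tb f V))
    (hW : ContMDiff (𝓡 2) (𝓡 n).tangent ∞ (tb f W)) :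
    Integrable fun z ↦ rt g (F z) (du F 1 z) (du F I z) (V (stereo z)) (W (stereo z)) := by
  subst hFf
  obtain ⟨C, -, hC⟩ := exists_rt_du_le g hf hV hW
  have hF := contMDiff_comp_stereo hf
  exact integrable_of_decay (continuous_rt g (smoothField_du hF 1) (smoothField_du hF I)
    (smoothField_comp_stereo hV) (smoothField_comp_stereo hW)) hC

end Holomorphic

/-! ### Strict positivity on nonzero holomorphic sections -/

section Positive

open Complex Set

variable {n : ℕ} {M : Type*} [TopologicalSpace M] [T2Space M] [ChartedSpace (EE n) M]
  [IsManifold (𝓡 n) ∞ M] (g : RMetric n M)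

/-- Were the differential zero throughout the coordinate plane, `f` would be constant on a dense
set, hence everywhere, as `M` is Hausdorff. -/
lemma volume_zeros_du {f : S2 → M} (hf : IsHarmonic g f) (hconst : ¬ ∃ c : M, ∀ x, f x = c)
    {F : ℂ → M} (hFf : F = fun ζ ↦ f (stereo ζ)) :
    volume {z | du (n := n) F 1 z = 0 ∧ du (n := n) F I z = 0} = 0 := by
  have hF : ContMDiff 𝓘(ℝ, ℂ) (𝓡 n) ∞ F := hFf ▸ contMDiff_comp_stereo hf.1
  have hharm : ∀ z, cov g F (du F 1) 1 z + cov g F (du F I) I z = 0 := by rw [hFf]; exact hf.2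
  refine volume_zeros_eq_zero g hF hharm ?_
  by_contra! h
  have hc := const_of_du_eq_zero hF h
  refine hconst ⟨F 0, fun x ↦ congrFun (denseRange_stereo.equalizer hf.1.continuous
    continuous_const ?_) x⟩
  funext z
  have : F z = f (stereo z) := by rw [hFf]
  rw [Function.comp_apply, ← this, hc z 0]
  rfl

/-- The Hermitian form is positive on nonzero holomorphic sections. -/
theorem integral_rt_pos (hg : PositiveCurvature g) {f : S2 → M} (hf : IsHarmonic g f)
    (hconst : ¬ ∃ c : M, ∀ x, f x = c) (hstable : IsStable g f) {s : CSection n f}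
    (hs : s ∈ holSections g f) (hs0 : s ≠ 0) {F : ℂ → M} (hFf : F = fun ζ ↦ f (stereo ζ)) :
    0 < ∫ z, 2 * rt g (F z) (du F 1 z) (du F I z) (reT (s (stereo z))) (imT (s (stereo z))) := by
  have hF : ContMDiff 𝓘(ℝ, ℂ) (𝓡 n) ∞ F := hFf ▸ contMDiff_comp_stereo hf.1
  have hharm : ∀ z, cov g F (du F 1) 1 z + cov g F (du F I) I z = 0 := by rw [hFf]; exact hf.2
  have hconf : ∀ z, ip g (F z) (du F 1 z) (du F 1 z) = ip g (F z) (du F I z) (du F I z) ∧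
      ip g (F z) (du F 1 z) (du F I z) = 0 := by
    subst hFf; exact conformal_of_harmonic g hf
  have hX := smoothField_du (n := n) hF 1
  have hY := smoothField_du (n := n) hF I
  let A : S2 → EE n := fun x ↦ reT (s x)
  let B : S2 → EE n := fun x ↦ imT (s x)
  have hA : ContMDiff (𝓡 2) (𝓡 n).tangent ∞ (tb f A) := hs.1.1
  have hB : ContMDiff (𝓡 2) (𝓡 n).tangent ∞ (tb f B) := hs.1.2.1
  let a : ℂ → EE n := fun z ↦ A (stereo z)
  let b : ℂ → EE n := fun z ↦ B (stereo z)
  have ha : SmoothField F a := hFf ▸ smoothField_comp_stereo hA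
  have hb : SmoothField F b := hFf ▸ smoothField_comp_stereo hB
  have hna : ∀ e z, ip g (F z) (du F e z) (a z) = 0 := by
    intro e z; subst hFf
    rw [du_comp_stereo_eq hf.1]
    exact (hs.1.2.2 (stereo z) _).1
  have hnb : ∀ e z, ip g (F z) (du F e z) (b z) = 0 := by
    intro e z; subst hFf
    rw [du_comp_stereo_eq hf.1]
    exact (hs.1.2.2 (stereo z) _).2
  let lam : ℂ → ℝ := fun z ↦ ip g (F z) (du F 1 z) (du F 1 z)
  have hlam : ContDiff ℝ ∞ lam := hX.ip g hX
  have hlam0 : ∀ z, 0 ≤ lam z := fun z ↦ ip_nonneg g _ _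
  have hzero : ∀ (p : M) (v : EE n), ip g p v v = 0 → v = 0 := by
    intro p v h
    by_contra hv
    exact (ip_pos g p hv).ne' h
  have hlamX : ∀ z, lam z = 0 → du (n := n) F 1 z = 0 ∧ du (n := n) F I z = 0 := fun z hz ↦
    ⟨hzero _ _ hz, hzero _ _ ((hconf z).1.symm.trans hz)⟩
  have hvol : volume {z | lam z = 0} = 0 :=
    measure_mono_null (fun z hz ↦ hlamX z hz) (volume_zeros_du g hf hconst hFf)
  have htang : ∀ z, lam z ≠ 0 → ∃ c d : ℂ, dRe g F a b z = c.re • du F 1 z + d.re • du F I z ∧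
      dIm g F a b z = c.im • du F 1 z + d.im • du F I z := by
    intro z hz
    refine exists_dRe_dIm_eq g hs hFf z (linearIndependent_of_ip (g := g) (F z) ?_ ?_ (hconf z).2)
    · intro h; exact hz (by simp [lam, h])
    · intro h; exact hz (by simp only [lam, (hconf z).1, h, map_zero])
  have hdd := ip_dRe_dIm g hF hharm ha hb hna hnb
  -- Expansion of a tangential vector in the orthogonal frame `X, Y`, both of squared length `lam`.
  -- At branch points both sides vanish.
  have hP : ∀ z, lam z • dRe g F a b z = ip g (F z) (dRe g F a b z) (du F 1 z) • du F 1 z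
      + ip g (F z) (dRe g F a b z) (du F I z) • du F I z := by
    intro z
    by_cases hz : lam z = 0
    · rw [hz, (hlamX z hz).1, (hlamX z hz).2]; simp
    · obtain ⟨c, d, h1, -⟩ := htang z hz
      have hYX : ip g (F z) (du F I z) (du F 1 z) = 0 := by rw [ip_symm]; exact (hconf z).2
      rw [h1]
      simp only [map_add, map_smul, add_apply, smul_apply, smul_eq_mul, hYX, (hconf z).2,
        ← (hconf z).1, lam]
      module
  -- The same expansion, with the coefficients of the imaginary part expressed by those of the real
  -- part through `hdd`; this is the proportionality to `X - iY`.
  have hQ : ∀ z, lam z • dIm g F a b z = ip g (F z) (dRe g F a b z) (du F I z) • du F 1 z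
      - ip g (F z) (dRe g F a b z) (du F 1 z) • du F I z := by
    intro z
    rw [sub_eq_add_neg, ← neg_smul, ← (hdd z).1, ← (hdd z).2]
    by_cases hz : lam z = 0
    · rw [hz, (hlamX z hz).1, (hlamX z hz).2]; simp
    · obtain ⟨c, d, -, h1⟩ := htang z hz
      have hYX : ip g (F z) (du F I z) (du F 1 z) = 0 := by rw [ip_symm]; exact (hconf z).2
      rw [h1]
      simp only [map_add, map_smul, add_apply, smul_apply, smul_eq_mul, hYX, (hconf z).2,
        ← (hconf z).1, lam]
      module
  obtain ⟨C₁, -, hC₁⟩ := exists_ip_le g hA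
  obtain ⟨C₂, -, hC₂⟩ := exists_ip_le g hB
  have hS : ∀ z, nsq g (F z) (a z) (b z) ≤ C₁ + C₂ := by
    intro z; subst hFf; exact add_le_add (hC₁ _) (hC₂ _)
  obtain ⟨L, hL⟩ := exists_nsq_du_le g hf.1 hFf
  have hsec : ∀ z, 0 ≤ secSum g (F z) (du F 1 z) (du F I z) (a z) (b z) := fun z ↦
    secSum_nonneg hg _ _ _ _ _
  have hsc := continuous_secSum g hX hY ha hb
  obtain ⟨z₀, hz₀⟩ : ∃ z, ¬ (a z = 0 ∧ b z = 0) := by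
    by_contra! h
    have h1 := eq_zero_of_comp_stereo g hA fun z ↦ (h z).1
    have h2 := eq_zero_of_comp_stereo g hB fun z ↦ (h z).2
    refine hs0 (funext fun x ↦ ?_)
    have h3 : mkT (A x) (B x) = s x := mkT_reT_imT (s x)
    rw [← h3, h1, h2]
    simp only [mkT, TensorProduct.tmul_zero, add_zero]
    rfl
  have hnc := continuous_nsq g ha hb
  have hopen : IsOpen {z | 0 < nsq g (F z) (a z) (b z)} := isOpen_lt continuous_const hnc
  have hz₀' : 0 < nsq g (F z₀) (a z₀) (b z₀) := by
    refine (nsq_nonneg g _ _ _).lt_of_ne fun h ↦ hz₀ ?_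
    have h1 := ip_nonneg g (F z₀) (a z₀)
    have h2 := ip_nonneg g (F z₀) (b z₀)
    rw [nsq] at h
    exact ⟨hzero _ _ (by linarith), hzero _ _ (by linarith)⟩
  -- The section is nonzero on a nonempty open set, which has positive measure and so is not
  -- contained in the null set of branch points.
  obtain ⟨z₁, hz₁, hz₁'⟩ : ∃ z, 0 < nsq g (F z) (a z) (b z) ∧ lam z ≠ 0 := by
    by_contra! h
    exact (hopen.measure_pos volume ⟨z₀, hz₀'⟩).ne' (measure_mono_null (fun z hz ↦ h z hz) hvol)
  have hR : 0 < ‖z₁‖ + 1 := by positivity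
  have hpos : 0 < ∫ z, cut (‖z₁‖ + 1) z ^ 2
      * secSum g (F z) (du F 1 z) (du F I z) (a z) (b z) := by
    have hcc : Continuous fun z ↦ cut (‖z₁‖ + 1) z ^ 2
        * secSum g (F z) (du F 1 z) (du F I z) (a z) (b z) :=
      ((contDiff_cut _).continuous.pow 2).mul hsc
    refine hcc.integral_pos_of_hasCompactSupport_nonneg_nonzero ?_
      (fun z ↦ mul_nonneg (sq_nonneg _) (hsec z)) (x := z₁) (ne_of_gt ?_)
    · obtain ⟨R, hR⟩ := exists_radius (hasCompactSupport_cut hR)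
      apply HasCompactSupport.intro (isCompact_closedBall (0 : ℂ) R)
      intro z hz
      rw [mem_closedBall_zero_iff, not_le] at hz
      simp [hR z hz]
    · rw [cut_eq_one hR (by linarith), one_pow, one_mul]
      refine secSum_pos hg _ (fun h ↦ hz₁' (by simp [lam, h])) (fun h ↦ hz₁.ne' ?_) (hna 1 z₁)
        (hnb 1 z₁)
      rw [h.1, h.2]
      simp [nsq]
  exact hpos.trans_le (integral_secSum_le g hf hstable hFf ha hb hS hL hlam hlam0 hvol hP hQ hsec
    ((integrable_rt_du g hf.1 hFf hA hB).const_mul 2) hR)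

end Positive

/-! ### The properties of the Hermitian form -/

section Hermitian

open Complex

variable {n : ℕ} {M : Type*} [TopologicalSpace M] [ChartedSpace (EE n) M]
  [IsManifold (𝓡 n) ∞ M] (g : RMetric n M)

lemma density_add_smul (F : ℂ → M) (a₁ b₁ a₂ b₂ a b : ℂ → EE n) (c : ℂ) (z : ℂ) :
    density g F (fun z ↦ c.re • a₁ z - c.im • b₁ z + a₂ z) (fun z ↦ c.re • b₁ z + c.im • a₁ z + b₂ z)
      a b z = c * density g F a₁ b₁ a b z + density g F a₂ b₂ a b z := by
  simp only [density, sub_eq_add_neg, ← neg_smul, rt_add_three, rt_smul_three]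
  apply Complex.ext
  · simp only [mul_re, mul_im, add_re, add_im, I_re, I_im, ofReal_re, ofReal_im]
    ring
  · simp only [mul_re, mul_im, add_re, add_im, I_re, I_im, ofReal_re, ofReal_im]
    ring

/-- Skew symmetry of `R` in its last pair makes the complex extension skew-Hermitian, and the factor
`i` makes it Hermitian. -/
lemma density_conj (F : ℂ → M) (a b a' b' : ℂ → EE n) (z : ℂ) :
    density g F a b a' b' z = (starRingEnd ℂ) (density g F a' b' a b z) := by
  simp only [density]
  rw [rt_anti_right g _ _ _ (a z) (b' z), rt_anti_right g _ _ _ (b z) (a' z),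
    rt_anti_right g _ _ _ (a z) (a' z), rt_anti_right g _ _ _ (b z) (b' z)]
  apply Complex.ext
  · simp only [conj_re, mul_re, add_re, I_re, I_im, ofReal_re, ofReal_im]
    ring
  · simp only [conj_im, mul_im, add_im, I_re, I_im, ofReal_re, ofReal_im]
    ring

lemma density_self (F : ℂ → M) (a b : ℂ → EE n) (z : ℂ) :
    density g F a b a b z = ((2 * rt g (F z) (du F 1 z) (du F I z) (a z) (b z) : ℝ) : ℂ) := by
  have h : ∀ v, rt g (F z) (du F 1 z) (du F I z) v v = 0 := by
    intro v
    have := rt_anti_right g (F z) (du F 1 z) (du F I z) v v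
    linarith
  rw [density, h, h, rt_anti_right g _ _ _ (b z) (a z), sub_neg_eq_add, ← two_mul]
  simp

/-- The parts of both sections are smooth on the compact sphere, so the density decays like `|z|⁻⁴`.
Additivity of the integral in `form_add_smul` depends on this. -/
lemma integrable_density {f : S2 → M} (hf : IsHarmonic g f) {s t : CSection n f}
    (hs : IsNormalSection g f s) (ht : IsNormalSection g f t) {F : ℂ → M}
    (hFf : F = fun ζ ↦ f (stereo ζ)) :
    Integrable (density g F (fun z ↦ reT (s (stereo z))) (fun z ↦ imT (s (stereo z)))
      (fun z ↦ reT (t (stereo z))) (fun z ↦ imT (t (stereo z)))) := by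
  have h := @integrable_rt_du n M _ _ _ g f hf.1 F hFf
  exact (((h hs.1 ht.2.1).sub (h hs.2.1 ht.1)).ofReal).add
    ((((h hs.1 ht.1).add (h hs.2.1 ht.2.1)).ofReal).const_mul I)

theorem form_add_smul {f : S2 → M} (hf : IsHarmonic g f) {s₁ s₂ s₃ : CSection n f}
    (h₁ : IsNormalSection g f s₁) (h₂ : IsNormalSection g f s₂) (h₃ : IsNormalSection g f s₃)
    (a : ℂ) : form g f (a • s₁ + s₂) s₃ = a * form g f s₁ s₃ + form g f s₂ s₃ := by
  rw [form_eq_integral g hf rfl, form_eq_integral g hf rfl, form_eq_integral g hf rfl,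
    ← integral_const_mul, ← integral_add ((integrable_density g hf h₁ h₃ rfl).const_mul a)
      (integrable_density g hf h₂ h₃ rfl)]
  refine integral_congr_ae (ae_of_all _ fun z ↦ ?_)
  have e1 : ∀ z, reT ((a • s₁ + s₂) (stereo z)) = a.re • reT (s₁ (stereo z))
      - a.im • imT (s₁ (stereo z)) + reT (s₂ (stereo z)) := fun z ↦ by
    rw [Pi.add_apply, Pi.smul_apply, reT_add, reT_smul]
  have e2 : ∀ z, imT ((a • s₁ + s₂) (stereo z)) = a.re • imT (s₁ (stereo z))
      + a.im • reT (s₁ (stereo z)) + imT (s₂ (stereo z)) := fun z ↦ by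
    rw [Pi.add_apply, Pi.smul_apply, imT_add, imT_smul]
  exact (congrArg₂ (fun A B : ℂ → EE n ↦ density g (fun ζ ↦ f (stereo ζ)) A B
    (fun z ↦ reT (s₃ (stereo z))) (fun z ↦ imT (s₃ (stereo z))) z) (funext e1) (funext e2)).trans
    (density_add_smul g _ _ _ _ _ _ _ a z)

theorem form_conj {f : S2 → M} (hf : IsHarmonic g f) (s t : CSection n f) :
    form g f s t = star (form g f t s) := by
  rw [form_eq_integral g hf rfl, form_eq_integral g hf rfl]
  refine Eq.trans ?_ integral_conj
  exact integral_congr_ae (ae_of_all _ fun z ↦ density_conj g _ _ _ _ _ z)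

theorem form_self {f : S2 → M} (hf : IsHarmonic g f) (s : CSection n f) {F : ℂ → M}
    (hFf : F = fun ζ ↦ f (stereo ζ)) : form g f s s =
      ((∫ z, 2 * rt g (F z) (du F 1 z) (du F I z) (reT (s (stereo z))) (imT (s (stereo z))) : ℝ) : ℂ) := by
  refine (form_eq_integral g hf hFf s s).trans (Eq.trans ?_ integral_ofReal)
  exact integral_congr_ae (ae_of_all _ fun z ↦ density_self g _ _ _ z)

end Hermitian

end StableSphere

end

theorem mainTheorem5 {n : ℕ} {M : Type*} [TopologicalSpace M] [T2Space M]
    [SecondCountableTopology M] [ChartedSpace (StableSphere.EE n) M] [IsManifold (𝓡 n) ∞ M]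
    (g : StableSphere.RMetric n M) (hg : StableSphere.PositiveCurvature g)
    (f : StableSphere.S2 → M) (hf : StableSphere.IsHarmonic g f)
    (hconst : ¬ ∃ c : M, ∀ x, f x = c) (hstable : StableSphere.IsStable g f) :
    (∀ s₁ ∈ StableSphere.holSections g f, ∀ s₂ ∈ StableSphere.holSections g f,
      ∀ s₃ ∈ StableSphere.holSections g f, ∀ a : ℂ,
        StableSphere.form g f (a • s₁ + s₂) s₃
          = a * StableSphere.form g f s₁ s₃ + StableSphere.form g f s₂ s₃) ∧
    (∀ s₁ ∈ StableSphere.holSections g f, ∀ s₂ ∈ StableSphere.holSections g f,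
      StableSphere.form g f s₁ s₂ = star (StableSphere.form g f s₂ s₁)) ∧
    (∀ s ∈ StableSphere.holSections g f, s ≠ 0 →
      0 < (StableSphere.form g f s s).re ∧ (StableSphere.form g f s s).im = 0) := by
  refine ⟨fun s₁ h₁ s₂ h₂ s₃ h₃ a ↦ StableSphere.form_add_smul g hf h₁.1 h₂.1 h₃.1 a,
    fun s₁ _ s₂ _ ↦ StableSphere.form_conj g hf s₁ s₂, fun s hs hs0 ↦ ?_⟩
  rw [StableSphere.form_self g hf s rfl]
  exact ⟨StableSphere.integral_rt_pos g hg hf hconst hstable hs hs0 rfl, Complex.ofReal_im _⟩
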